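/- Fix $h_2\in\mathbb R$, $\hbar>0$, $m>0$, $\omega>0$, $E>0$. **Setting.** Let $G=\mathbb R^4$ with the group law $$(x_1,x_2,x_3,x_4)(y_1,y_2,y_3,y_4)=\bigl(x_1+y_1,\;x_2+y_2,\;x_3+y_3+x_1y_2,\;x_4+y_4+x_1y_3+\tfrac12x_1^2y_2\bigr),$$ with centre $Z=\{(0,0,0,x_4)\}$, let $\mathsf s(x_1,x_2,x_3)=(x_1,x_2,x_3,0)$ be the section of $G\to G/Z\simeq\mathbb R^3$, and let $X_j$ ($j=1,\dots,4$) be the generator of the one-parameter subgroup along the $j$-th coordinate axis. Let $$[\rho(x)\phi](y)=e^{2\pi i(h_2x_2+\hbar(x_4-x_3y+\frac12x_2y^2))}\phi(y-x_1)$$ be the representation of $G$ on $L^2(\mathbb R)$, and $\tilde\rho$ the representation on functions on $G/Z$ induced from the character $e^{2\pi i\hbar x_4}$ of $Z$: $$[\tilde\rho(y)f](x)=e^{2\pi i\hbar(y_4-y_1y_3+\frac12y_1^2y_2+y_1x_3-\frac12y_1^2x_2)}f(x_1-y_1,\;x_2-y_2,\;x_3-y_3-y_1x_2+y_1y_2).$$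 For $\phi(y)=c\,e^{-\pi\hbar Ey^2}$, $c\ne0$, let $[\mathcal W_\phi k](x)=\langle k,\rho(\mathsf s(x))\phi\rangle$, $k\in L^2(\mathbb R)$, and let $L_\phi(G/Z)$ be the image of $\mathcal W_\phi$. Let $\mathfrak L^{X}$ be the left-invariant vector field of $X$ acting on functions $f$ on $G/Z$ through their lifts $e^{-2\pi i\hbar x_4}f(x_1,x_2,x_3)$, and put $$\mathcal C=-i\mathfrak L^{X_1}+E\,\mathfrak L^{X_3},\qquad \mathcal S=(\mathfrak L^{X_3})^2-2\,\mathfrak L^{X_2}\mathfrak L^{X_4}-8\pi^2h_2\hbar,$$ $$H=\frac1{2m}\Bigl(\frac{i\,d\tilde\rho^{X_1}}{\sqrt{2\pi}}\Bigr)^2+\frac{m\omega^2}2\Bigl(\frac{i\,d\tilde\rho^{X_3}}{\sqrt{2\pi}}\Bigr)^2 .$$ Let $H_1$ be the first-order operator $$H_1=\frac{i\hbar}m\Bigl((x_3+x_1x_2)\partial_1-\bigl((ix_2+E)^2-m^2\omega^2\bigr)\partial_2-(E^2x_1-x_2x_3)\partial_3\Bigr)$$ $$\quad-\frac{\hbar}{2m}\Bigl(-8i\pi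 h_2Ex_2-ix_2+4\pi h_2x_2^2-2\pi\hbar x_3^2+4\pi h_2m^2\omega^2-E-4\pi h_2E^2-4i\pi E\hbar x_1^2x_2+2\pi\hbar E^2x_1^2\Bigr)I .$$ Put $$z=\frac{x_3-iEx_1}{ix_2+E+m\omega},\qquad u=\frac{m\omega-(ix_2+E)}{m\omega+(ix_2+E)},$$ let $\mathbb D$ be the open unit disc (so $u\in\mathbb D$), and for $f_2(z,u)$ let (principal square roots) $$\mathcal F[f_2](t;x)=\frac{\sqrt{E+m\omega}}{\sqrt{ix_2+E+m\omega}}\exp\Bigl(-\tfrac{i\omega}2t-\pi\hbar Ex_1^2-2\pi ih_2x_2-\pi\hbar\frac{(x_3-iEx_1)^2}{ix_2+E+m\omega}\Bigr)f_2\bigl(e^{-i\omega t}z,\,e^{-2i\omega t}u\bigr).$$ The heat equation below is $$\partial_uf_2=-\frac1{8\pi\hbar m\omega}\,\partial^2_{zz}f_2 .$$ A function $f(t;x)$ solves the Schrödinger equation with operator $A$ on $\Omega\subseteq\mathbb R^3$ if it is differentiable in $t$ and $i\hbar\,\partial_tf=Af$ for all $t\in\mathbb R$, $x\in\Omega$.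 **Claims.** 1. Every $F\in L_\phi(G/Z)$ is smooth and satisfies $\mathcal CF=0$ and $\mathcal SF=0$. 2. On $C^2$ functions, $$H_1=H+\Bigl(\tfrac{i}{4\pi m}\partial_1+\tfrac{i}{2\pi m}\bigl(-\tfrac i2E+x_2\bigr)\partial_3+\tfrac{i\hbar}{2m}x_1(-E+2ix_2)\Bigr)\mathcal C+\Bigl(-\tfrac1{4\pi m}(ix_2+E)^2+\tfrac{m\omega^2}{4\pi}\Bigr)\mathcal S .$$ 3. If $f(t;\cdot)\in L_\phi(G/Z)$ for all $t$, then $f$ solves the Schrödinger equation with $H$ (on any set $\Omega$) if and only if it solves the one with $H_1$. 4. Let $V\subseteq\mathbb D$ be a connected open set, invariant under rotations about $0$, such that $\Omega=\{x: u\in V\}$ is non-empty. For every $f_2$ analytic on $\mathbb C\times V$, the function $f=\mathcal F[f_2]$ is smooth on $\mathbb R\times\Omega$, satisfies $\mathcal Cf=0$ and solves the Schrödinger equation with $H_1$ on $\Omega$. Moreover, the following are equivalent: $\mathcal Sf=0$ on $\mathbb R\times\Omega$; $f$ solves the Schrödinger equation with $H$ on $\Omega$; $f_2$ satisfies the heat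 equation on $\mathbb C\times V$. 5. Let $V,\Omega$ be as in 4 and $W=\{w:\operatorname{Re}w>0,\ \frac{m\omega-w}{m\omega+w}\in V\}$. If $f(t;x)=e^{-\pi\hbar Ex_1^2}f_1(t;x_3-iEx_1,ix_2+E)$ on $\mathbb R\times\Omega$, with $f_1$ continuous on $\mathbb R\times\mathbb C\times W$ and analytic in its last two variables on $\mathbb C\times W$ for each $t$, and $f$ solves the Schrödinger equation with $H_1$ on $\Omega$, then $f=\mathcal F[f_2]$ on $\mathbb R\times\Omega$ for some $f_2$ analytic on $\mathbb C\times V$. 6. Let $R>0$. (a) If $f_2$ is analytic on $\mathbb C\times\{|u|<R\}$ and satisfies the heat equation there, then, with $g(\xi)=f_2(\xi,0)$, for all $z\in\mathbb C$ and all $u$ with $|u+R/2|<R/2$ (in particular for $-R<u<0$), $$f_2(z,u)=\Bigl(-\frac{2m\omega\hbar}{u}\Bigr)^{1/2}\int_{\mathbb R}g(\xi)\,e^{2\pi\hbar m\omega\frac{(z-\xi)^2}{u}}\,d\xi ,$$ and the integral converges absolutely. (b) Conversely, let $g:\mathbb R\to\mathbb C$ be continuous, $0<\delta\le R$, and let $f_2$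 be analytic on $\mathbb C\times\{|u|<R\}$ and be given by this (absolutely convergent) integral for all real $z$ and all $-\delta<u<0$. Then $f_2$ satisfies the heat equation on $\mathbb C\times\{|u|<R\}$, $f_2(\xi,0)=g(\xi)$ for all real $\xi$, and $\mathcal F[f_2]$ solves the Schrödinger equation with $H$ on $\{x:|u|<R\}$. 7. (General solution on the image space.) For every $k_0\in L^2(\mathbb R)$ there is an $f_2$, analytic on $\mathbb C\times\mathbb D$ and satisfying the heat equation there, such that $\mathcal F[f_2](0;\cdot)=\mathcal W_\phi k_0$ and $\mathcal F[f_2]$ solves the Schrödinger equation with $H$ on $\mathbb R^3$. If $t\mapsto k_t\in L^2(\mathbb R)$ is continuous, then $f(t;\cdot)=\mathcal W_\phi k_t$ solves the Schrödinger equation with $H$ on $\mathbb R^3$ if and only if $f=\mathcal F[f_2]$ for some $f_2$ analytic on $\mathbb C\times\mathbb D$ that satisfies the heat equation there. -/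

import Mathlib

open MeasureTheory Complex

noncomputable section

namespace ShearOsc

/-! ### The group and its representations -/

/-- The nilpotent step-three group `G`, in canonical coordinates
`(x₁, x₂, x₃, x₄) = exp(x₄ X₄) exp(x₃ X₃) exp(x₂ X₂) exp(x₁ X₁)`. -/
@[ext]
structure G where
  c1 : ℝ
  c2 : ℝ
  c3 : ℝ
  c4 : ℝ

instance : Mul G :=
  ⟨fun x y => ⟨x.c1 + y.c1, x.c2 + y.c2, x.c3 + y.c3 + x.c1 * y.c2,
    x.c4 + y.c4 + x.c1 * y.c3 + x.c1 ^ 2 * y.c2 / 2⟩⟩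

instance : One G := ⟨⟨0, 0, 0, 0⟩⟩

instance : Inv G :=
  ⟨fun x => ⟨-x.c1, -x.c2, -x.c3 + x.c1 * x.c2,
    -x.c4 + x.c1 * x.c3 - x.c1 ^ 2 * x.c2 / 2⟩⟩

theorem gmul_def (x y : G) : x * y = ⟨x.c1 + y.c1, x.c2 + y.c2, x.c3 + y.c3 + x.c1 * y.c2,
    x.c4 + y.c4 + x.c1 * y.c3 + x.c1 ^ 2 * y.c2 / 2⟩ := rfl

theorem gone_def : (1 : G) = ⟨0, 0, 0, 0⟩ := rfl

theorem ginv_def (x : G) : x⁻¹ = ⟨-x.c1, -x.c2, -x.c3 + x.c1 * x.c2,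
    -x.c4 + x.c1 * x.c3 - x.c1 ^ 2 * x.c2 / 2⟩ := rfl

instance : Group G where
  mul_assoc x y z := by ext <;> simp only [gmul_def] <;> ring
  one_mul x := by ext <;> simp [gmul_def, gone_def]
  mul_one x := by ext <;> simp [gmul_def, gone_def]
  inv_mul_cancel x := by ext <;> simp only [gmul_def, gone_def, ginv_def] <;> ring

/-- Points `(x₁, x₂, x₃)` of the homogeneous space `G / Z`, `Z` the centre. -/
abbrev Pt := ℝ × ℝ × ℝ

/-- The section `G / Z → G`, `(x₁, x₂, x₃) ↦ (x₁, x₂, x₃, 0)`. -/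
def sec (x : Pt) : G := ⟨x.1, x.2.1, x.2.2, 0⟩

/-- One-parameter subgroups `t ↦ exp (t Xⱼ)`. -/
def exp1 (t : ℝ) : G := ⟨t, 0, 0, 0⟩
def exp2 (t : ℝ) : G := ⟨0, t, 0, 0⟩
def exp3 (t : ℝ) : G := ⟨0, 0, t, 0⟩
def exp4 (t : ℝ) : G := ⟨0, 0, 0, t⟩

/-- The irreducible unitary representation of `G` on functions of one real variable:
`[ρ(x)φ](y) = exp(2πi(h₂x₂ + ħ(x₄ - x₃y + x₂y²/2))) φ(y - x₁)`. -/
def rep (h2 hb : ℝ) (g : G) (φ : ℝ → ℂ) (y : ℝ) : ℂ :=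
  cexp (2 * Real.pi * I * (h2 * g.c2 + hb * (g.c4 - g.c3 * y + g.c2 * y ^ 2 / 2)))
    * φ (y - g.c1)

/-- The induced coherent state transform `[W_φ k](x) = ⟨k, ρ(s(x)) φ⟩` of `k ∈ L²(ℝ)`
(linear in the first argument). -/
def cst (h2 hb : ℝ) (φ : ℝ → ℂ) (k : Lp ℂ 2 (volume : Measure ℝ)) (x : Pt) : ℂ :=
  ∫ y : ℝ, k y * starRingEnd ℂ (rep h2 hb (sec x) φ y)

/-- The image space `L_φ(G/Z)` of the coherent state transform. -/
def imageSpace (h2 hb : ℝ) (φ : ℝ → ℂ) : Set (Pt → ℂ) := Set.range (cst h2 hb φ)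

/-- The Gaussian (squeezed) fiducial vector `c exp(-π ħ E y²)`. -/
def gaussianVec (hb E : ℝ) (c : ℂ) (y : ℝ) : ℂ := c * Real.exp (-Real.pi * hb * E * y ^ 2)

/-- The lift of a function on `G/Z` to the covariant function
`F(x₁,x₂,x₃,x₄) = exp(-2πiħx₄) f(x₁,x₂,x₃)` on `G`. -/
def liftFn (hb : ℝ) (f : Pt → ℂ) (g : G) : ℂ :=
  cexp (-(2 * Real.pi * I * hb * g.c4)) * f (g.c1, g.c2, g.c3)

/-- The left invariant vector field (Lie derivative) of the one-parameter subgroup `e`,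
`d/dt F(g e(t))` at `t = 0`, acting on functions on `G/Z` through their lifts. -/
def lieDeriv (hb : ℝ) (e : ℝ → G) (f : Pt → ℂ) (x : Pt) : ℂ :=
  deriv (fun t : ℝ => liftFn hb f (sec x * e t)) 0

/-- The representation of `G` on functions on `G/Z` induced from the character
`exp(2πiħx₄)` of the centre. -/
def indRep (hb : ℝ) (y : G) (f : Pt → ℂ) (x : Pt) : ℂ :=
  cexp (2 * Real.pi * I * hb * (y.c4 - y.c1 * y.c3 + y.c1 ^ 2 * y.c2 / 2
      + y.c1 * x.2.2 - y.c1 ^ 2 * x.2.1 / 2))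
    * f (x.1 - y.c1, x.2.1 - y.c2, x.2.2 - y.c3 - y.c1 * x.2.1 + y.c1 * y.c2)

/-- The derived representation along the one-parameter subgroup `e`. -/
def derivedRep (hb : ℝ) (e : ℝ → G) (f : Pt → ℂ) (x : Pt) : ℂ :=
  deriv (fun t : ℝ => indRep hb (e t) f x) 0

/-! ### Differential operators -/

/-- The partial derivatives on `G/Z`. -/
def d1 (f : Pt → ℂ) (x : Pt) : ℂ := deriv (fun s : ℝ => f (s, x.2.1, x.2.2)) x.1
def d2 (f : Pt → ℂ) (x : Pt) : ℂ := deriv (fun s : ℝ => f (x.1, s, x.2.2)) x.2.1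
def d3 (f : Pt → ℂ) (x : Pt) : ℂ := deriv (fun s : ℝ => f (x.1, x.2.1, s)) x.2.2

/-- The analyticity operator `C = -i 𝔏^{X₁} + E 𝔏^{X₃}`. -/
def opC (hb E : ℝ) (f : Pt → ℂ) (x : Pt) : ℂ :=
  -I * lieDeriv hb exp1 f x + E * lieDeriv hb exp3 f x

/-- The structural operator `S = (𝔏^{X₃})² - 2 𝔏^{X₂} 𝔏^{X₄} - 8π²h₂ħ`. -/
def opS (h2 hb : ℝ) (f : Pt → ℂ) (x : Pt) : ℂ :=
  lieDeriv hb exp3 (lieDeriv hb exp3 f) x - 2 * lieDeriv hb exp2 (lieDeriv hb exp4 f) x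
    - 8 * Real.pi ^ 2 * h2 * hb * f x

/-- The quantised observable `(i / √(2π)) dρ̃^X`. -/
def observable (hb : ℝ) (e : ℝ → G) (f : Pt → ℂ) (x : Pt) : ℂ :=
  I / (Real.sqrt (2 * Real.pi) : ℂ) * derivedRep hb e f x

/-- The Weyl quantisation `H` of the harmonic oscillator `(p²/m + mω²q²)/2`. -/
def ham (hb m ω : ℝ) (f : Pt → ℂ) (x : Pt) : ℂ :=
  1 / (2 * m) * observable hb exp1 (observable hb exp1 f) x
    + m * ω ^ 2 / 2 * observable hb exp3 (observable hb exp3 f) x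

/-- The reduced Hamiltonian `H₁`, a first-order operator. -/
def redHam (h2 hb m ω E : ℝ) (f : Pt → ℂ) (x : Pt) : ℂ :=
  I * hb / m *
      ((x.2.2 + x.1 * x.2.1) * d1 f x
        - ((I * x.2.1 + E) ^ 2 - m ^ 2 * ω ^ 2) * d2 f x
        - (E ^ 2 * x.1 - x.2.1 * x.2.2) * d3 f x)
    - hb / (2 * m) *
      (-(8 * I * Real.pi * h2 * E * x.2.1) - I * x.2.1 + 4 * Real.pi * h2 * x.2.1 ^ 2
        - 2 * Real.pi * hb * x.2.2 ^ 2 + 4 * Real.pi * h2 * m ^ 2 * ω ^ 2 - E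
        - 4 * Real.pi * h2 * E ^ 2 - 4 * I * Real.pi * E * hb * x.1 ^ 2 * x.2.1
        + 2 * Real.pi * hb * E ^ 2 * x.1 ^ 2) * f x

/-- `f(t; x)` satisfies `iħ ∂ₜ f - A f = 0` for all real `t` and all `x ∈ Ω`. -/
def Solves (hb : ℝ) (A : (Pt → ℂ) → Pt → ℂ) (Ω : Set Pt) (f : ℝ → Pt → ℂ) : Prop :=
  ∀ t : ℝ, ∀ x ∈ Ω, DifferentiableAt ℝ (fun s : ℝ => f s x) t ∧
    I * hb * deriv (fun s : ℝ => f s x) t - A (f t) x = 0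

/-! ### The geometric solution -/

/-- `z = (x₃ - iEx₁) / (ix₂ + E + mω)`. -/
def zVar (m ω E : ℝ) (x : Pt) : ℂ := (x.2.2 - I * E * x.1) / (I * x.2.1 + E + m * ω)

/-- The Cayley-type transform `w ↦ (mω - w) / (mω + w)`. -/
def cayley (m ω : ℝ) (w : ℂ) : ℂ := (m * ω - w) / (m * ω + w)

/-- `u = (mω - (ix₂ + E)) / (mω + (ix₂ + E))`. -/
def uVar (m ω E : ℝ) (x : Pt) : ℂ := cayley m ω (I * x.2.1 + E)

/-- The points of `G/Z` with `u ∈ V`. -/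
def region (m ω E : ℝ) (V : Set ℂ) : Set Pt := {x | uVar m ω E x ∈ V}

/-- The explicit formula for the solution, in terms of `f₂(z, u)`. -/
def geomSol (h2 hb m ω E : ℝ) (f2 : ℂ × ℂ → ℂ) (t : ℝ) (x : Pt) : ℂ :=
  (Real.sqrt (E + m * ω) : ℂ) / (I * x.2.1 + E + m * ω) ^ (1 / 2 : ℂ)
    * cexp (-(I * ω / 2 * t) - Real.pi * hb * E * x.1 ^ 2 - 2 * Real.pi * I * h2 * x.2.1
        - Real.pi * hb * (x.2.2 - I * E * x.1) ^ 2 / (I * x.2.1 + E + m * ω))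
    * f2 (cexp (-(I * ω * t)) * zVar m ω E x, cexp (-(2 * I * ω * t)) * uVar m ω E x)

/-- `f₂(z,u)` is an analytic function of two complex variables on `ℂ × V`. -/
def AnalyticOver (V : Set ℂ) (f2 : ℂ × ℂ → ℂ) : Prop :=
  AnalyticOnNhd ℂ f2 (Set.univ ×ˢ V)

/-- The heat-like equation `∂_u f₂ = -(8πħmω)⁻¹ ∂²_{zz} f₂` on `ℂ × V`. -/
def HeatLike (hb m ω : ℝ) (V : Set ℂ) (f2 : ℂ × ℂ → ℂ) : Prop :=
  ∀ z : ℂ, ∀ u ∈ V, deriv (fun w : ℂ => f2 (z, w)) u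
    = -(1 / (8 * Real.pi * hb * m * ω)) * iteratedDeriv 2 (fun w : ℂ => f2 (w, u)) z

/-- The integrand of the Gaussian integral. -/
def gaussIntegrand (hb m ω : ℝ) (g : ℝ → ℂ) (z u : ℂ) (ξ : ℝ) : ℂ :=
  g ξ * cexp (2 * Real.pi * hb * m * ω * (z - ξ) ^ 2 / u)

/-- The Gaussian integral
`(-2mωħ/u)^{1/2} ∫ g(ξ) exp(2πħmω(z - ξ)²/u) dξ` (principal square root). -/
def gaussIntegral (hb m ω : ℝ) (g : ℝ → ℂ) (z u : ℂ) : ℂ :=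
  (-(2 * m * ω * hb) / u) ^ (1 / 2 : ℂ) * ∫ ξ : ℝ, gaussIntegrand hb m ω g z u ξ

/-- `V` is a non-empty connected open subset of the unit disc, invariant under rotations about
the origin (a disc, a punctured disc or an annulus). -/
structure IsRotDomain (V : Set ℂ) : Prop where
  isOpen : IsOpen V
  isConnected : IsConnected V
  subset_disc : V ⊆ Metric.ball 0 1
  rotate : ∀ u ∈ V, ∀ θ : ℝ, cexp (I * θ) * u ∈ V

end ShearOsc

end

open ShearOsc

namespace ShearOsc

open Filter Topology

/-! ### Partial derivatives and invariant vector fields -/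

section Partials

variable {f g : Pt → ℂ} {x : Pt}

/-! The transform of the Gaussian has the form `exp(-πħE x₁²) F(s, w)` with `s = x₃ - iEx₁`, `w =
ix₂ + E` and `F` analytic for `Re w > 0`; up to an elementary factor `F` is the integral of `k(y)
exp(-πħ w y² + 2πiħ s y)`. Every such function is killed by `C`, because `x₁` enters only through
`s` and the Gaussian. On profiles `F` the operator `S` is `∂_s² - 4πħ ∂_w - 8π²h₂ħ`, and it kills
the kernel above since both `∂_s²` and `∂_w` produce `y²`. Modulo `C` and `S` all second-order terms
of `H` can be traded for first-order ones, which gives `H₁` (`redHam_eq`).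

On profiles the first-order part of `H₁` is `(ħ/m)(w s ∂_s + (w² - m²ω²) ∂_w)`. The coordinates `(z,
u)` linearise this field: it becomes `ħω(z ∂_z + 2u ∂_u)`, whose flow rotates `z` and `u` with
frequencies `ω` and `2ω`. The prefactor absorbs the zero-order part up to the phase `exp(-iωt/2)`,
and it also satisfies `SF = 0`. Hence `𝓕[f₂]` solves the equation with `H₁` for every `f₂`, while
`S𝓕[f₂]` is a non-vanishing multiple of `∂_z² f₂ + 8πħmω ∂_u f₂` at the rotated point
(`solves_redHam_geomSol`, `opS_geomSol`).

The points of `G/Z` see only the line `Re w = E`, that is, an arc of values of `u`. Conditions known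
on this arc are spread over `V` by the identity theorem. For uniqueness the transport equation is
integrated in time, so that it becomes the vanishing of a holomorphic function of a complex angle
`θ`; the arc supplies an accumulating set of angles, and the equation then holds on the whole strip
of angles, where it is solved along characteristics (`hasDerivAt_family_of_frequently`,
`transport_family`). Joint analyticity of the integrals comes from an Osgood lemma
(`analyticAt_of_separately`).

For the Gaussian integral, put `c = 2πħmω` and `b = -c/u`. The heat equation turns the Taylor series
in `u` into `Σ (κu)ⁿ/n! · ∂_z²ⁿ f₂(z, 0)` with `κ = -1/(4c)`, and its coefficients are exactly the
even Gaussian moments with weight `exp(-by²)`. Convergence on `|u| < R` is therefore the absolute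
convergence needed to integrate the even part of the datum term by term for `Re b > c/R`, which is
the disc `|u + R/2| < R/2`; the odd part integrates to zero (`lap_heat`, `heat_eq_gauss`).
Conversely, differentiation under the integral gives the heat equation, and an approximate identity
gives the initial value (`heat_of_gauss`, `initial_of_gauss`). -/

theorem hasDerivAt_d1 (hf : DifferentiableAt ℝ f x) :
    HasDerivAt (fun s : ℝ => f (s, x.2.1, x.2.2)) (d1 f x) x.1 := by
  have h : DifferentiableAt ℝ (fun s : ℝ => ((s, x.2.1, x.2.2) : Pt)) x.1 := by fun_prop
  exact (DifferentiableAt.comp (g := f) x.1 hf h).hasDerivAt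

theorem hasDerivAt_d2 (hf : DifferentiableAt ℝ f x) :
    HasDerivAt (fun s : ℝ => f (x.1, s, x.2.2)) (d2 f x) x.2.1 := by
  have h : DifferentiableAt ℝ (fun s : ℝ => ((x.1, s, x.2.2) : Pt)) x.2.1 := by fun_prop
  exact (DifferentiableAt.comp (g := f) x.2.1 hf h).hasDerivAt

theorem hasDerivAt_d3 (hf : DifferentiableAt ℝ f x) :
    HasDerivAt (fun s : ℝ => f (x.1, x.2.1, s)) (d3 f x) x.2.2 := by
  have h : DifferentiableAt ℝ (fun s : ℝ => ((x.1, x.2.1, s) : Pt)) x.2.2 := by fun_prop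
  exact (DifferentiableAt.comp (g := f) x.2.2 hf h).hasDerivAt

theorem d1_eq_fderiv (hf : DifferentiableAt ℝ f x) : d1 f x = fderiv ℝ f x (1, 0, 0) := by
  have h : HasDerivAt (fun s : ℝ => ((s, x.2.1, x.2.2) : Pt)) (1, 0, 0) x.1 :=
    (hasDerivAt_id _).prodMk ((hasDerivAt_const _ _).prodMk (hasDerivAt_const _ _))
  exact (HasFDerivAt.comp_hasDerivAt (l := f) x.1 hf.hasFDerivAt h).deriv

theorem d2_eq_fderiv (hf : DifferentiableAt ℝ f x) : d2 f x = fderiv ℝ f x (0, 1, 0) := by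
  have h : HasDerivAt (fun s : ℝ => ((x.1, s, x.2.2) : Pt)) (0, 1, 0) x.2.1 :=
    (hasDerivAt_const _ _).prodMk ((hasDerivAt_id _).prodMk (hasDerivAt_const _ _))
  exact (HasFDerivAt.comp_hasDerivAt (l := f) x.2.1 hf.hasFDerivAt h).deriv

theorem d3_eq_fderiv (hf : DifferentiableAt ℝ f x) : d3 f x = fderiv ℝ f x (0, 0, 1) := by
  have h : HasDerivAt (fun s : ℝ => ((x.1, x.2.1, s) : Pt)) (0, 0, 1) x.2.2 :=
    (hasDerivAt_const _ _).prodMk ((hasDerivAt_const _ _).prodMk (hasDerivAt_id _))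
  exact (HasFDerivAt.comp_hasDerivAt (l := f) x.2.2 hf.hasFDerivAt h).deriv

/-- The derivative along a differentiable curve. -/
theorem hasDerivAt_comp_curve (hf : DifferentiableAt ℝ f x) {a b c : ℝ → ℝ} {a' b' c' t : ℝ}
    (ha : HasDerivAt a a' t) (hb : HasDerivAt b b' t) (hc : HasDerivAt c c' t)
    (hx : (a t, b t, c t) = x) :
    HasDerivAt (fun s => f (a s, b s, c s)) (a' * d1 f x + b' * d2 f x + c' * d3 f x) t := by
  subst hx
  have h := HasFDerivAt.comp_hasDerivAt (l := f) t hf.hasFDerivAt (ha.prodMk (hb.prodMk hc))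
  have e : ((a', b', c') : Pt) = a' • ((1, 0, 0) : Pt) + b' • ((0, 1, 0) : Pt)
      + c' • ((0, 0, 1) : Pt) := by simp
  rw [e, map_add, map_add, map_smul, map_smul, map_smul, ← d1_eq_fderiv hf, ← d2_eq_fderiv hf,
    ← d3_eq_fderiv hf] at h
  exact h

theorem d1_congr (h : f =ᶠ[𝓝 x] g) : d1 f x = d1 g x := by
  have hc : Tendsto (fun s : ℝ => ((s, x.2.1, x.2.2) : Pt)) (𝓝 x.1) (𝓝 x) :=
    Continuous.tendsto' (by fun_prop) _ _ rfl
  exact Filter.EventuallyEq.deriv_eq (hc.eventually h)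

theorem d2_congr (h : f =ᶠ[𝓝 x] g) : d2 f x = d2 g x := by
  have hc : Tendsto (fun s : ℝ => ((x.1, s, x.2.2) : Pt)) (𝓝 x.2.1) (𝓝 x) :=
    Continuous.tendsto' (by fun_prop) _ _ rfl
  exact Filter.EventuallyEq.deriv_eq (hc.eventually h)

theorem d3_congr (h : f =ᶠ[𝓝 x] g) : d3 f x = d3 g x := by
  have hc : Tendsto (fun s : ℝ => ((x.1, x.2.1, s) : Pt)) (𝓝 x.2.2) (𝓝 x) :=
    Continuous.tendsto' (by fun_prop) _ _ rfl
  exact Filter.EventuallyEq.deriv_eq (hc.eventually h)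

theorem d1_sub (hf : DifferentiableAt ℝ f x) (hg : DifferentiableAt ℝ g x) :
    d1 (fun y => f y - g y) x = d1 f x - d1 g x :=
  ((hasDerivAt_d1 hf).sub (hasDerivAt_d1 hg)).deriv

theorem d1_add (hf : DifferentiableAt ℝ f x) (hg : DifferentiableAt ℝ g x) :
    d1 (fun y => f y + g y) x = d1 f x + d1 g x :=
  ((hasDerivAt_d1 hf).add (hasDerivAt_d1 hg)).deriv

theorem d1_mul (hf : DifferentiableAt ℝ f x) (hg : DifferentiableAt ℝ g x) :
    d1 (fun y => f y * g y) x = d1 f x * g x + f x * d1 g x :=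
  ((hasDerivAt_d1 hf).mul (hasDerivAt_d1 hg)).deriv

theorem d1_const_mul (c : ℂ) (hf : DifferentiableAt ℝ f x) :
    d1 (fun y => c * f y) x = c * d1 f x :=
  ((hasDerivAt_d1 hf).const_mul c).deriv

theorem d2_const_mul (c : ℂ) (hf : DifferentiableAt ℝ f x) :
    d2 (fun y => c * f y) x = c * d2 f x :=
  ((hasDerivAt_d2 hf).const_mul c).deriv

theorem d3_sub (hf : DifferentiableAt ℝ f x) (hg : DifferentiableAt ℝ g x) :
    d3 (fun y => f y - g y) x = d3 f x - d3 g x :=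
  ((hasDerivAt_d3 hf).sub (hasDerivAt_d3 hg)).deriv

theorem d3_add (hf : DifferentiableAt ℝ f x) (hg : DifferentiableAt ℝ g x) :
    d3 (fun y => f y + g y) x = d3 f x + d3 g x :=
  ((hasDerivAt_d3 hf).add (hasDerivAt_d3 hg)).deriv

theorem d3_mul (hf : DifferentiableAt ℝ f x) (hg : DifferentiableAt ℝ g x) :
    d3 (fun y => f y * g y) x = d3 f x * g x + f x * d3 g x :=
  ((hasDerivAt_d3 hf).mul (hasDerivAt_d3 hg)).deriv

theorem d3_const_mul (c : ℂ) (hf : DifferentiableAt ℝ f x) :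
    d3 (fun y => c * f y) x = c * d3 f x :=
  ((hasDerivAt_d3 hf).const_mul c).deriv

theorem d1_coord1 : d1 (fun y : Pt => (y.1 : ℂ)) x = 1 := (hasDerivAt_id x.1).ofReal_comp.deriv

theorem d1_coord2 : d1 (fun y : Pt => (y.2.1 : ℂ)) x = 0 := by simp [d1]

theorem d1_coord3 : d1 (fun y : Pt => (y.2.2 : ℂ)) x = 0 := by simp [d1]

theorem d3_coord1 : d3 (fun y : Pt => (y.1 : ℂ)) x = 0 := by simp [d3]

theorem d3_coord2 : d3 (fun y : Pt => (y.2.1 : ℂ)) x = 0 := by simp [d3]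

theorem d3_coord3 : d3 (fun y : Pt => (y.2.2 : ℂ)) x = 1 := (hasDerivAt_id x.2.2).ofReal_comp.deriv

theorem eventually_differentiableAt (hf : ContDiffAt ℝ 2 f x) :
    ∀ᶠ y in 𝓝 x, DifferentiableAt ℝ f y :=
  (hf.eventually (by simp)).mono fun _ hy => hy.differentiableAt (by simp)

theorem differentiableAt_fderiv_apply (hf : ContDiffAt ℝ 2 f x) (v : Pt) :
    DifferentiableAt ℝ (fun y => fderiv ℝ f y v) x := by
  have h : ContDiffAt ℝ 1 (fderiv ℝ f) x := hf.fderiv_right (by norm_num)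
  exact (h.differentiableAt (by simp)).clm_apply (differentiableAt_const v)

theorem d1_eventuallyEq_fderiv (hf : ContDiffAt ℝ 2 f x) :
    d1 f =ᶠ[𝓝 x] fun y => fderiv ℝ f y (1, 0, 0) :=
  (eventually_differentiableAt hf).mono fun _ => d1_eq_fderiv

theorem d3_eventuallyEq_fderiv (hf : ContDiffAt ℝ 2 f x) :
    d3 f =ᶠ[𝓝 x] fun y => fderiv ℝ f y (0, 0, 1) :=
  (eventually_differentiableAt hf).mono fun _ => d3_eq_fderiv

theorem differentiableAt_d1 (hf : ContDiffAt ℝ 2 f x) : DifferentiableAt ℝ (d1 f) x :=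
  (differentiableAt_fderiv_apply hf _).congr_of_eventuallyEq (d1_eventuallyEq_fderiv hf)

theorem differentiableAt_d3 (hf : ContDiffAt ℝ 2 f x) : DifferentiableAt ℝ (d3 f) x :=
  (differentiableAt_fderiv_apply hf _).congr_of_eventuallyEq (d3_eventuallyEq_fderiv hf)

theorem d1_d3_comm (hf : ContDiffAt ℝ 2 f x) : d1 (d3 f) x = d3 (d1 f) x := by
  have h : ContDiffAt ℝ 1 (fderiv ℝ f) x := hf.fderiv_right (by norm_num)
  have h' := h.differentiableAt (by simp)
  rw [d1_congr (d3_eventuallyEq_fderiv hf), d3_congr (d1_eventuallyEq_fderiv hf),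
    d1_eq_fderiv (differentiableAt_fderiv_apply hf _),
    d3_eq_fderiv (differentiableAt_fderiv_apply hf _),
    fderiv_clm_apply h' (differentiableAt_const _), fderiv_clm_apply h' (differentiableAt_const _)]
  have := (hf.isSymmSndFDerivAt (by simp)).eq (1, 0, 0) (0, 0, 1)
  simpa using this

end Partials

/-! ### The invariant fields, `C`, `S` and `H` in coordinates -/

section Operators

variable {f g : Pt → ℂ} {x : Pt} {h2 hb m ω E : ℝ}

theorem lieDeriv_exp1 : lieDeriv hb exp1 f x = d1 f x := by
  have : (fun t : ℝ => liftFn hb f (sec x * exp1 t))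
      = fun t : ℝ => (fun s : ℝ => f (s, x.2.1, x.2.2)) (x.1 + t) := by
    funext t; simp [liftFn, sec, exp1, gmul_def]
  rw [lieDeriv, this]
  have := deriv_comp_const_add (f := fun s : ℝ => f (s, x.2.1, x.2.2)) (a := x.1) (x := 0)
  rw [this, d1, add_zero]

theorem lieDeriv_exp4 : lieDeriv hb exp4 f x = -(2 * Real.pi * I * hb) * f x := by
  have : (fun t : ℝ => liftFn hb f (sec x * exp4 t))
      = fun t : ℝ => cexp (-(2 * Real.pi * I * hb * t)) * f x := by
    funext t; simp [liftFn, sec, exp4, gmul_def]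
  rw [lieDeriv, this]
  have h : HasDerivAt (fun t : ℝ => cexp (-(2 * Real.pi * I * hb * t)) * f x)
      (cexp (-(2 * Real.pi * I * hb * (0 : ℝ))) * (-(2 * Real.pi * I * hb * 1)) * f x) 0 :=
    ((((hasDerivAt_id (0 : ℝ)).ofReal_comp.const_mul (2 * Real.pi * I * hb : ℂ)).neg).cexp).mul_const
      _
  rw [h.deriv]
  simp

theorem lieDeriv_exp3 (hf : DifferentiableAt ℝ f x) :
    lieDeriv hb exp3 f x = d3 f x - 2 * Real.pi * I * hb * x.1 * f x := by
  have : (fun t : ℝ => liftFn hb f (sec x * exp3 t))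
      = fun t : ℝ => cexp (-(2 * Real.pi * I * hb * x.1 * t)) * f (x.1, x.2.1, x.2.2 + t) := by
    funext t; simp [liftFn, sec, exp3, gmul_def, mul_assoc]
  rw [lieDeriv, this]
  have h1 : HasDerivAt (fun t : ℝ => cexp (-(2 * Real.pi * I * hb * x.1 * t)))
      (cexp (-(2 * Real.pi * I * hb * x.1 * (0 : ℝ))) * (-(2 * Real.pi * I * hb * x.1 * 1))) 0 :=
    ((((hasDerivAt_id (0 : ℝ)).ofReal_comp.const_mul (2 * Real.pi * I * hb * x.1 : ℂ)).neg).cexp)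
  have h3 := hasDerivAt_comp_curve hf (hasDerivAt_const (0 : ℝ) x.1) (hasDerivAt_const (0 : ℝ) x.2.1)
    ((hasDerivAt_id (0 : ℝ)).const_add x.2.2) (by simp)
  have h := (h1.mul h3).deriv
  simp only [id] at h
  erw [h]
  simp
  ring

theorem lieDeriv_exp2 (hf : DifferentiableAt ℝ f x) :
    lieDeriv hb exp2 f x
      = d2 f x + x.1 * d3 f x - Real.pi * I * hb * x.1 ^ 2 * f x := by
  have : (fun t : ℝ => liftFn hb f (sec x * exp2 t))
      = fun t : ℝ => cexp (-(Real.pi * I * hb * x.1 ^ 2 * t))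
        * f (x.1, x.2.1 + t, x.2.2 + x.1 * t) := by
    funext t
    simp only [liftFn, sec, exp2, gmul_def]
    congr 2
    · push_cast; ring
    · simp
  rw [lieDeriv, this]
  have h1 : HasDerivAt (fun t : ℝ => cexp (-(Real.pi * I * hb * x.1 ^ 2 * t)))
      (cexp (-(Real.pi * I * hb * x.1 ^ 2 * (0 : ℝ))) * (-(Real.pi * I * hb * x.1 ^ 2 * 1))) 0 :=
    ((((hasDerivAt_id (0 : ℝ)).ofReal_comp.const_mul (Real.pi * I * hb * x.1 ^ 2 : ℂ)).neg).cexp)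
  have h3 := hasDerivAt_comp_curve hf (hasDerivAt_const (0 : ℝ) x.1)
    ((hasDerivAt_id (0 : ℝ)).const_add x.2.1)
    (((hasDerivAt_id (0 : ℝ)).const_mul x.1).const_add x.2.2) (by simp)
  have h := (h1.mul h3).deriv
  simp only [id] at h
  erw [h]
  simp
  ring

theorem derivedRep_exp1 (hf : DifferentiableAt ℝ f x) :
    derivedRep hb exp1 f x = 2 * Real.pi * I * hb * x.2.2 * f x - d1 f x - x.2.1 * d3 f x := by
  have : (fun t : ℝ => indRep hb (exp1 t) f x)
      = fun t : ℝ => cexp (2 * Real.pi * I * hb * (t * x.2.2 - t ^ 2 * x.2.1 / 2))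
        * f (x.1 - t, x.2.1, x.2.2 - t * x.2.1) := by
    funext t; simp [indRep, exp1]
  rw [derivedRep, this]
  have h0 := (hasDerivAt_id (0 : ℝ)).ofReal_comp
  have h1 := (((h0.mul_const (x.2.2 : ℂ)).sub (((h0.pow 2).mul_const (x.2.1 : ℂ)).div_const
    2)).const_mul (2 * Real.pi * I * hb : ℂ)).cexp
  have h3 := hasDerivAt_comp_curve hf ((hasDerivAt_id (0 : ℝ)).const_sub x.1)
    (hasDerivAt_const (0 : ℝ) x.2.1)
    (((hasDerivAt_id (0 : ℝ)).mul_const x.2.1).const_sub x.2.2) (by simp)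
  have h := (h1.mul h3).deriv
  simp only [id] at h
  erw [h]
  simp
  ring

theorem derivedRep_exp3 (hf : DifferentiableAt ℝ f x) :
    derivedRep hb exp3 f x = -d3 f x := by
  have : (fun t : ℝ => indRep hb (exp3 t) f x)
      = fun t : ℝ => f (x.1, x.2.1, x.2.2 - t) := by
    funext t; simp [indRep, exp3]
  rw [derivedRep, this]
  have h3 := hasDerivAt_comp_curve hf (hasDerivAt_const (0 : ℝ) x.1)
    (hasDerivAt_const (0 : ℝ) x.2.1)
    ((hasDerivAt_id (0 : ℝ)).const_sub x.2.2) (by simp)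
  simp only [id] at h3
  rw [h3.deriv]
  simp

theorem lieDeriv_exp3_congr (h : f =ᶠ[𝓝 x] g) : lieDeriv hb exp3 f x = lieDeriv hb exp3 g x := by
  have hc : Tendsto (fun t : ℝ => ((x.1 + 0, x.2.1 + 0, x.2.2 + t + x.1 * 0) : Pt)) (𝓝 0) (𝓝 x) :=
    Continuous.tendsto' (by fun_prop) _ _ (by simp)
  exact Filter.EventuallyEq.deriv_eq ((hc.eventually h).mono fun t ht => by
    simp only [liftFn, sec, exp3, gmul_def]; rw [ht])

theorem derivedRep_exp1_congr (h : f =ᶠ[𝓝 x] g) :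
    derivedRep hb exp1 f x = derivedRep hb exp1 g x := by
  have hc : Tendsto (fun t : ℝ => ((x.1 - t, x.2.1 - 0, x.2.2 - 0 - t * x.2.1 + t * 0) : Pt))
      (𝓝 0) (𝓝 x) := Continuous.tendsto' (by fun_prop) _ _ (by simp)
  exact Filter.EventuallyEq.deriv_eq ((hc.eventually h).mono fun t ht => by
    simp only [indRep, exp1]; rw [ht])

theorem derivedRep_exp3_congr (h : f =ᶠ[𝓝 x] g) :
    derivedRep hb exp3 f x = derivedRep hb exp3 g x := by
  have hc : Tendsto (fun t : ℝ => ((x.1 - 0, x.2.1 - 0, x.2.2 - t - 0 * x.2.1 + 0 * 0) : Pt))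
      (𝓝 0) (𝓝 x) := Continuous.tendsto' (by fun_prop) _ _ (by simp)
  exact Filter.EventuallyEq.deriv_eq ((hc.eventually h).mono fun t ht => by
    simp only [indRep, exp3]; rw [ht])

theorem opC_eq (hf : DifferentiableAt ℝ f x) :
    opC hb E f x = -I * d1 f x + E * (d3 f x - 2 * Real.pi * I * hb * x.1 * f x) := by
  rw [opC, lieDeriv_exp1, lieDeriv_exp3 hf]

theorem opS_eq (hf : ContDiffAt ℝ 2 f x) :
    opS h2 hb f x = d3 (d3 f) x + 4 * Real.pi * I * hb * d2 f x
      - 8 * Real.pi ^ 2 * h2 * hb * f x := by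
  have hf1 := hf.differentiableAt (by simp)
  have e : lieDeriv hb exp3 f =ᶠ[𝓝 x]
      fun y => d3 f y - 2 * Real.pi * I * hb * y.1 * f y :=
    (eventually_differentiableAt hf).mono fun y => lieDeriv_exp3
  have hx1 : DifferentiableAt ℝ (fun y : Pt => (y.1 : ℂ)) x := by fun_prop
  have hx : DifferentiableAt ℝ (fun y : Pt => 2 * Real.pi * I * hb * (y.1 : ℂ)) x :=
    hx1.const_mul _
  have hd3 := differentiableAt_d3 hf
  have hxf : DifferentiableAt ℝ (fun y : Pt => 2 * Real.pi * I * hb * (y.1 : ℂ) * f y) x :=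
    hx.mul hf1
  have hG : DifferentiableAt ℝ (fun y : Pt => d3 f y - 2 * Real.pi * I * hb * (y.1 : ℂ) * f y) x :=
    hd3.sub hxf
  have e4 : lieDeriv hb exp4 f = fun y => -(2 * Real.pi * I * hb) * f y := by
    funext y; exact lieDeriv_exp4
  rw [opS, lieDeriv_exp3_congr e, lieDeriv_exp3 hG, d3_sub hd3 hxf,
    d3_mul hx hf1, d3_const_mul _ hx1, d3_coord1, e4, lieDeriv_exp2 (hf1.const_mul _),
    d2_const_mul _ hf1, d3_const_mul _ hf1]
  ring

theorem I_div_sqrt_sq : (I / (Real.sqrt (2 * Real.pi) : ℂ)) * (I / (Real.sqrt (2 * Real.pi) : ℂ))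
    = -1 / (2 * Real.pi) := by
  rw [div_mul_div_comm, I_mul_I, ← ofReal_mul, Real.mul_self_sqrt (by positivity), ofReal_mul,
    ofReal_ofNat]

theorem ham_eq (hf : ContDiffAt ℝ 2 f x) :
    ham hb m ω f x = 1 / (2 * m) * (-1 / (2 * Real.pi) *
        (2 * Real.pi * I * hb * x.2.2 *
            (2 * Real.pi * I * hb * x.2.2 * f x - d1 f x - x.2.1 * d3 f x)
          - (2 * Real.pi * I * hb * x.2.2 * d1 f x - d1 (d1 f) x - x.2.1 * d1 (d3 f) x)
          - x.2.1 * (2 * Real.pi * I * hb * (f x + x.2.2 * d3 f x) - d1 (d3 f) x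
            - x.2.1 * d3 (d3 f) x)))
      + m * ω ^ 2 / 2 * (-1 / (2 * Real.pi) * d3 (d3 f) x) := by
  have hf1 := hf.differentiableAt (by simp)
  have hx2 : DifferentiableAt ℝ (fun y : Pt => (y.2.1 : ℂ)) x := by fun_prop
  have hx3 : DifferentiableAt ℝ (fun y : Pt => (y.2.2 : ℂ)) x := by fun_prop
  have hqq := I_div_sqrt_sq
  have hd1 := differentiableAt_d1 hf
  have hd3 := differentiableAt_d3 hf
  unfold ham observable
  -- The two layers of each observable contribute this constant only through its square, which `hqq`
  -- records.
  generalize I / (Real.sqrt (2 * Real.pi) : ℂ) = q at *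
  have o1 : (fun y => q * derivedRep hb exp1 f y) =ᶠ[𝓝 x]
      fun y => q * (2 * Real.pi * I * hb * y.2.2 * f y - d1 f y - y.2.1 * d3 f y) :=
    (eventually_differentiableAt hf).mono fun y hy => by
      simp only [derivedRep_exp1 hy]
  have o3 : (fun y => q * derivedRep hb exp3 f y) =ᶠ[𝓝 x] fun y => q * (-1 * d3 f y) :=
    (eventually_differentiableAt hf).mono fun y hy => by
      simp only [derivedRep_exp3 hy, neg_one_mul]
  have hx3' : DifferentiableAt ℝ (fun y : Pt => 2 * Real.pi * I * hb * (y.2.2 : ℂ)) x :=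
    hx3.const_mul _
  have hA : DifferentiableAt ℝ (fun y : Pt => 2 * Real.pi * I * hb * (y.2.2 : ℂ) * f y) x :=
    hx3'.mul hf1
  have hB : DifferentiableAt ℝ (fun y : Pt => (y.2.1 : ℂ) * d3 f y) x := hx2.mul hd3
  have hA1 : DifferentiableAt ℝ
      (fun y : Pt => 2 * Real.pi * I * hb * (y.2.2 : ℂ) * f y - d1 f y) x := hA.sub hd1
  have hG : DifferentiableAt ℝ
      (fun y : Pt => 2 * Real.pi * I * hb * (y.2.2 : ℂ) * f y - d1 f y - y.2.1 * d3 f y) x :=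
    hA1.sub hB
  have hGq := hG.const_mul q
  rw [derivedRep_exp1_congr o1, derivedRep_exp3_congr o3, derivedRep_exp1 hGq,
    derivedRep_exp3 ((hd3.const_mul (-1)).const_mul q), d1_const_mul q hG, d3_const_mul q hG,
    d1_sub hA1 hB, d1_sub hA hd1, d1_mul hx3' hf1, d1_mul hx2 hd3, d1_const_mul _ hx3,
    d3_sub hA1 hB, d3_sub hA hd1, d3_mul hx3' hf1, d3_mul hx2 hd3, d3_const_mul _ hx3,
    d1_coord2, d1_coord3, d3_coord2, d3_coord3, d3_const_mul _ (hd3.const_mul (-1)),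
    d3_const_mul _ hd3, ← d1_d3_comm hf, ← hqq]
  ring

/-- The reduced Hamiltonian differs from `H` by multiples of the operators `C` and `S`. -/
theorem redHam_eq (hm : m ≠ 0) (hf : ContDiffAt ℝ 2 f x) :
    redHam h2 hb m ω E f x =
        ham hb m ω f x
          + (I / (4 * Real.pi * m) * d1 (opC hb E f) x
            + I / (2 * Real.pi * m) * (-I / 2 * E + x.2.1) * d3 (opC hb E f) x
            + I * hb / (2 * m) * x.1 * (-E + 2 * I * x.2.1) * opC hb E f x)
          + (-(1 / (4 * Real.pi * m)) * (I * x.2.1 + E) ^ 2 + m * ω ^ 2 / (4 * Real.pi))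
            * opS h2 hb f x := by
  have hf1 := hf.differentiableAt (by simp)
  have hC : opC hb E f =ᶠ[𝓝 x]
      fun y => -I * d1 f y + E * (d3 f y - 2 * Real.pi * I * hb * y.1 * f y) :=
    (eventually_differentiableAt hf).mono fun y => opC_eq
  have hx1 : DifferentiableAt ℝ (fun y : Pt => (y.1 : ℂ)) x := by fun_prop
  have hx : DifferentiableAt ℝ (fun y : Pt => 2 * Real.pi * I * hb * (y.1 : ℂ)) x :=
    hx1.const_mul _
  have hd1 := differentiableAt_d1 hf
  have hd3 := differentiableAt_d3 hf
  have hxf : DifferentiableAt ℝ (fun y : Pt => 2 * Real.pi * I * hb * (y.1 : ℂ) * f y) x :=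
    hx.mul hf1
  have hG : DifferentiableAt ℝ (fun y : Pt => d3 f y - 2 * Real.pi * I * hb * (y.1 : ℂ) * f y) x :=
    hd3.sub hxf
  have c1 : d1 (opC hb E f) x = -I * d1 (d1 f) x + E * (d1 (d3 f) x
      - (2 * Real.pi * I * hb * 1 * f x + 2 * Real.pi * I * hb * x.1 * d1 f x)) := by
    rw [d1_congr hC, d1_add (hd1.const_mul _) (hG.const_mul _), d1_const_mul _ hd1,
      d1_const_mul _ hG, d1_sub hd3 hxf, d1_mul hx hf1, d1_const_mul _ hx1, d1_coord1]
  have c3 : d3 (opC hb E f) x = -I * d1 (d3 f) x + E * (d3 (d3 f) x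
      - 2 * Real.pi * I * hb * x.1 * d3 f x) := by
    rw [d3_congr hC, d3_add (hd1.const_mul _) (hG.const_mul _), d3_const_mul _ hd1,
      d3_const_mul _ hG, d3_sub hd3 hxf, d3_mul hx hf1, d3_const_mul _ hx1, d3_coord1,
      d1_d3_comm hf]
    ring
  rw [c1, c3, opC_eq hf1, opS_eq hf, ham_eq hf, redHam]
  have hpi : (Real.pi : ℂ) ≠ 0 := ofReal_ne_zero.2 Real.pi_ne_zero
  have hmc : (m : ℂ) ≠ 0 := ofReal_ne_zero.2 hm
  have hI2 := I_sq
  have hI3 : I ^ 3 = -I := I_pow_three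
  field_simp
  ring_nf
  simp only [I_sq, I_pow_three]
  ring

/-- The correction terms of `redHam_eq` differentiate `C f`, so `C f` has to vanish near the point
and not only at it. What survives is `S f`, with a coefficient that vanishes exactly where `w² =
m²ω²`. -/
theorem redHam_eq_ham_of_eventually (hm : m ≠ 0) (hf : ContDiffAt ℝ 2 f x)
    (hC : ∀ᶠ y in 𝓝 x, opC hb E f y = 0) :
    redHam h2 hb m ω E f x = ham hb m ω f x
      + (m ^ 2 * ω ^ 2 - (I * x.2.1 + E) ^ 2) / (4 * Real.pi * m) * opS h2 hb f x := by
  have hC' : opC hb E f =ᶠ[𝓝 x] fun _ => 0 := hC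
  have z1 : d1 (fun _ => (0 : ℂ)) x = 0 := by simp [d1]
  have z3 : d3 (fun _ => (0 : ℂ)) x = 0 := by simp [d3]
  rw [redHam_eq hm hf, d1_congr hC', d3_congr hC', z1, z3, hC'.self_of_nhds]
  have hpi : (Real.pi : ℂ) ≠ 0 := ofReal_ne_zero.2 Real.pi_ne_zero
  have hmc : (m : ℂ) ≠ 0 := ofReal_ne_zero.2 hm
  field_simp
  ring

end Operators

/-! ### Functions of two complex variables -/

/-- The partial derivative in the first variable of a function of two complex variables. -/
noncomputable def pd1 (F : ℂ × ℂ → ℂ) (p : ℂ × ℂ) : ℂ := deriv (fun ζ => F (ζ, p.2)) p.1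

/-- The partial derivative in the second variable. -/
noncomputable def pd2 (F : ℂ × ℂ → ℂ) (p : ℂ × ℂ) : ℂ := deriv (fun ζ => F (p.1, ζ)) p.2

section TwoVariables

variable {F G : ℂ × ℂ → ℂ} {p : ℂ × ℂ}

theorem hasDerivAt_pd1 (hF : DifferentiableAt ℂ F p) :
    HasDerivAt (fun ζ => F (ζ, p.2)) (pd1 F p) p.1 := by
  have h : DifferentiableAt ℂ (fun ζ : ℂ => (ζ, p.2)) p.1 := by fun_prop
  exact (DifferentiableAt.comp (g := F) p.1 hF h).hasDerivAt

theorem pd1_eq_fderiv (hF : DifferentiableAt ℂ F p) : pd1 F p = fderiv ℂ F p (1, 0) := by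
  have h : HasDerivAt (fun ζ : ℂ => (ζ, p.2)) (1, 0) p.1 :=
    (hasDerivAt_id _).prodMk (hasDerivAt_const _ _)
  exact (HasFDerivAt.comp_hasDerivAt (l := F) p.1 hF.hasFDerivAt h).deriv

theorem pd2_eq_fderiv (hF : DifferentiableAt ℂ F p) : pd2 F p = fderiv ℂ F p (0, 1) := by
  have h : HasDerivAt (fun ζ : ℂ => (p.1, ζ)) (0, 1) p.2 :=
    (hasDerivAt_const _ _).prodMk (hasDerivAt_id _)
  exact (HasFDerivAt.comp_hasDerivAt (l := F) p.2 hF.hasFDerivAt h).deriv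

theorem fderiv_apply_eq_pd (hF : DifferentiableAt ℂ F p) (a b : ℂ) :
    fderiv ℂ F p (a, b) = a * pd1 F p + b * pd2 F p := by
  have e : ((a, b) : ℂ × ℂ) = a • ((1, 0) : ℂ × ℂ) + b • ((0, 1) : ℂ × ℂ) := by simp
  rw [e, map_add, map_smul, map_smul, ← pd1_eq_fderiv hF, ← pd2_eq_fderiv hF]
  rfl

theorem hasDerivAt_comp_pair (hF : DifferentiableAt ℂ F p) {a b : ℂ → ℂ} {a' b' t : ℂ}
    (ha : HasDerivAt a a' t) (hb : HasDerivAt b b' t) (hp : (a t, b t) = p) :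
    HasDerivAt (fun s => F (a s, b s)) (a' * pd1 F p + b' * pd2 F p) t := by
  subst hp
  rw [← fderiv_apply_eq_pd hF]
  exact HasFDerivAt.comp_hasDerivAt (l := F) t hF.hasFDerivAt (ha.prodMk hb)

theorem hasDerivAt_comp_real_pair (hF : DifferentiableAt ℂ F p) {a b : ℝ → ℂ} {a' b' : ℂ} {t : ℝ}
    (ha : HasDerivAt a a' t) (hb : HasDerivAt b b' t) (hp : (a t, b t) = p) :
    HasDerivAt (fun s => F (a s, b s)) (a' * pd1 F p + b' * pd2 F p) t := by
  subst hp
  rw [← fderiv_apply_eq_pd hF]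
  exact HasFDerivAt.comp_hasDerivAt (l := F) t (hF.hasFDerivAt.restrictScalars ℝ) (ha.prodMk hb)

theorem pd1_eventuallyEq_fderiv (hF : AnalyticAt ℂ F p) :
    pd1 F =ᶠ[𝓝 p] fun q => fderiv ℂ F q (1, 0) :=
  hF.eventually_analyticAt.mono fun _ hq => pd1_eq_fderiv hq.differentiableAt

theorem pd2_eventuallyEq_fderiv (hF : AnalyticAt ℂ F p) :
    pd2 F =ᶠ[𝓝 p] fun q => fderiv ℂ F q (0, 1) :=
  hF.eventually_analyticAt.mono fun _ hq => pd2_eq_fderiv hq.differentiableAt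

theorem AnalyticAt.fderiv_apply (hF : AnalyticAt ℂ F p) (v : ℂ × ℂ) :
    AnalyticAt ℂ (fun q => fderiv ℂ F q v) p :=
  (ContinuousLinearMap.apply ℂ ℂ v).analyticAt _ |>.comp hF.fderiv

theorem AnalyticAt.pd1 (hF : AnalyticAt ℂ F p) : AnalyticAt ℂ (pd1 F) p :=
  (AnalyticAt.fderiv_apply hF _).congr (pd1_eventuallyEq_fderiv hF).symm

theorem AnalyticAt.pd2 (hF : AnalyticAt ℂ F p) : AnalyticAt ℂ (pd2 F) p :=
  (AnalyticAt.fderiv_apply hF _).congr (pd2_eventuallyEq_fderiv hF).symm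

theorem pd1_congr (h : F =ᶠ[𝓝 p] G) : pd1 F p = pd1 G p := by
  have hc : Tendsto (fun ζ : ℂ => (ζ, p.2)) (𝓝 p.1) (𝓝 p) :=
    Continuous.tendsto' (by fun_prop) _ _ rfl
  exact Filter.EventuallyEq.deriv_eq (hc.eventually h)

theorem pd2_congr (h : F =ᶠ[𝓝 p] G) : pd2 F p = pd2 G p := by
  have hc : Tendsto (fun ζ : ℂ => (p.1, ζ)) (𝓝 p.2) (𝓝 p) :=
    Continuous.tendsto' (by fun_prop) _ _ rfl
  exact Filter.EventuallyEq.deriv_eq (hc.eventually h)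

theorem pd1_pd2_comm (hF : AnalyticAt ℂ F p) : pd1 (pd2 F) p = pd2 (pd1 F) p := by
  have h' := hF.fderiv.differentiableAt
  rw [pd1_congr (pd2_eventuallyEq_fderiv hF), pd2_congr (pd1_eventuallyEq_fderiv hF),
    pd1_eq_fderiv (AnalyticAt.fderiv_apply hF _).differentiableAt,
    pd2_eq_fderiv (AnalyticAt.fderiv_apply hF _).differentiableAt,
    fderiv_clm_apply h' (differentiableAt_const _), fderiv_clm_apply h' (differentiableAt_const _)]
  have := (hF.contDiffAt (n := 2)).isSymmSndFDerivAt (by simp) |>.eq (1, 0) (0, 1)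
  simpa using this

theorem iteratedDeriv_two_eq_pd1 (z u : ℂ) :
    iteratedDeriv 2 (fun w : ℂ => F (w, u)) z = pd1 (pd1 F) (z, u) := by
  rw [iteratedDeriv_succ, iteratedDeriv_one]; rfl

end TwoVariables

/-! ### Functions in the kernel of the analyticity operator -/

/-- The complex coordinates `(x₃ - iEx₁, ix₂ + E)`. -/
noncomputable def cplx (E : ℝ) (x : Pt) : ℂ × ℂ := (x.2.2 - I * E * x.1, I * x.2.1 + E)

/-- The function on `G/Z` with the analytic profile `F`. -/
noncomputable def expand (hb E : ℝ) (F : ℂ × ℂ → ℂ) (x : Pt) : ℂ :=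
  cexp (-(Real.pi * hb * E * x.1 ^ 2)) * F (cplx E x)

section Expand

variable {F : ℂ × ℂ → ℂ} {x : Pt} {h2 hb m ω E : ℝ}

theorem contDiff_cplx {n : WithTop ℕ∞} : ContDiff ℝ n (cplx E) := by
  have h : ContDiff ℝ n (fun r : ℝ => (r : ℂ)) := ofRealCLM.contDiff
  unfold cplx
  fun_prop

theorem continuous_cplx : Continuous (cplx E) := (contDiff_cplx (n := 0)).continuous

theorem contDiffAt_expand {n : WithTop ℕ∞} (hF : AnalyticAt ℂ F (cplx E x)) :
    ContDiffAt ℝ n (expand hb E F) x := by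
  have h : ContDiff ℝ n (fun r : ℝ => (r : ℂ)) := ofRealCLM.contDiff
  have h1 : ContDiff ℝ n (fun y : Pt => cexp (-(Real.pi * hb * E * (y.1 : ℂ) ^ 2))) := by fun_prop
  have h2 : ContDiffAt ℝ n F (cplx E x) := hF.contDiffAt.restrict_scalars ℝ
  exact h1.contDiffAt.mul (h2.comp x contDiff_cplx.contDiffAt)

theorem d1_expand (hF : AnalyticAt ℂ F (cplx E x)) :
    d1 (expand hb E F) x = cexp (-(Real.pi * hb * E * x.1 ^ 2)) *
      (-(2 * Real.pi * hb * E * x.1) * F (cplx E x) - I * E * pd1 F (cplx E x)) := by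
  have hid := (hasDerivAt_id x.1).ofReal_comp
  have h1 : HasDerivAt (fun s : ℝ => cexp (-(Real.pi * hb * E * (s : ℂ) ^ 2)))
      (cexp (-(Real.pi * hb * E * (x.1 : ℂ) ^ 2)) *
        -(Real.pi * hb * E * ((2 : ℕ) * (x.1 : ℂ) ^ (2 - 1) * 1))) x.1 :=
    ((hid.pow 2).const_mul _).neg.cexp
  have ha : HasDerivAt (fun s : ℝ => (x.2.2 : ℂ) - I * E * s) (-(I * E * 1)) x.1 :=
    (hid.const_mul (I * E : ℂ)).const_sub (x.2.2 : ℂ)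
  have h := h1.mul (hasDerivAt_comp_real_pair hF.differentiableAt ha
    (hasDerivAt_const x.1 (I * x.2.1 + E : ℂ)) rfl)
  refine (HasDerivAt.deriv (f := fun s : ℝ => expand hb E F (s, x.2.1, x.2.2)) h).trans ?_
  simp only [cplx]
  push_cast
  ring

theorem d2_expand (hF : AnalyticAt ℂ F (cplx E x)) :
    d2 (expand hb E F) x = cexp (-(Real.pi * hb * E * x.1 ^ 2)) * (I * pd2 F (cplx E x)) := by
  have hid := (hasDerivAt_id x.2.1).ofReal_comp
  have ha : HasDerivAt (fun s : ℝ => I * (s : ℂ) + E) (I * 1) x.2.1 :=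
    (hid.const_mul I).add_const (E : ℂ)
  have h := (hasDerivAt_comp_real_pair hF.differentiableAt
    (hasDerivAt_const x.2.1 (x.2.2 - I * E * x.1 : ℂ)) ha rfl).const_mul
    (cexp (-(Real.pi * hb * E * x.1 ^ 2)))
  refine (HasDerivAt.deriv (f := fun s : ℝ => expand hb E F (x.1, s, x.2.2)) h).trans ?_
  ring

theorem d3_expand (hF : AnalyticAt ℂ F (cplx E x)) :
    d3 (expand hb E F) x = expand hb E (pd1 F) x := by
  have hid := (hasDerivAt_id x.2.2).ofReal_comp
  have ha : HasDerivAt (fun s : ℝ => (s : ℂ) - I * E * x.1) 1 x.2.2 :=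
    hid.sub_const (I * E * x.1 : ℂ)
  have h := (hasDerivAt_comp_real_pair hF.differentiableAt ha
    (hasDerivAt_const x.2.2 (I * x.2.1 + E : ℂ)) rfl).const_mul
    (cexp (-(Real.pi * hb * E * x.1 ^ 2)))
  refine (HasDerivAt.deriv (f := fun s : ℝ => expand hb E F (x.1, x.2.1, s)) h).trans ?_
  rw [expand]
  ring

/-- In `s = x₃ - iEx₁` the fields `-i∂₁` and `E∂₃` cancel, and the derivative of the Gaussian in
`x₁` cancels the multiplication term of `𝔏^{X₃}`. -/
theorem opC_expand (hF : AnalyticAt ℂ F (cplx E x)) : opC hb E (expand hb E F) x = 0 := by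
  rw [opC_eq ((contDiffAt_expand (n := 1) hF).differentiableAt (by simp)), d1_expand hF,
    d3_expand hF]
  simp only [expand]
  linear_combination cexp (-(Real.pi * hb * E * x.1 ^ 2)) * E * pd1 F (cplx E x) * I_sq

/-- Since `w = ix₂ + E`, the derivative `∂₂` acts as `i∂_w`. The condition `SF = 0` is thus already
a heat equation in `(s, w)`, with `w` as the time variable. -/
theorem opS_expand (hF : AnalyticAt ℂ F (cplx E x)) :
    opS h2 hb (expand hb E F) x = cexp (-(Real.pi * hb * E * x.1 ^ 2)) *
      (pd1 (pd1 F) (cplx E x) - 4 * Real.pi * hb * pd2 F (cplx E x)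
        - 8 * Real.pi ^ 2 * h2 * hb * F (cplx E x)) := by
  have hev : d3 (expand hb E F) =ᶠ[𝓝 x] expand hb E (pd1 F) :=
    (continuous_cplx.continuousAt.eventually hF.eventually_analyticAt).mono fun y hy => d3_expand hy
  rw [opS_eq (contDiffAt_expand hF), d3_congr hev, d3_expand (AnalyticAt.pd1 hF), d2_expand hF]
  simp only [expand]
  linear_combination cexp (-(Real.pi * hb * E * x.1 ^ 2)) * 4 * Real.pi * hb
    * pd2 F (cplx E x) * I_sq

/-- The reduced Hamiltonian as an operator on profiles. -/
theorem redHam_expand (hm : m ≠ 0) (hF : AnalyticAt ℂ F (cplx E x)) {s w : ℂ}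
    (hsw : cplx E x = (s, w)) :
    redHam h2 hb m ω E (expand hb E F) x = cexp (-(Real.pi * hb * E * x.1 ^ 2)) *
      (hb / m * (w * s * pd1 F (s, w) + (w ^ 2 - m ^ 2 * ω ^ 2) * pd2 F (s, w))
        + hb / (2 * m) * (w + 4 * Real.pi * h2 * (w ^ 2 - m ^ 2 * ω ^ 2)
          + 2 * Real.pi * hb * s ^ 2) * F (s, w)) := by
  have hmc : (m : ℂ) ≠ 0 := ofReal_ne_zero.2 hm
  rw [redHam, d1_expand hF, d2_expand hF, d3_expand hF]
  simp only [expand]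
  rw [hsw]
  simp only [cplx, Prod.mk.injEq] at hsw
  obtain ⟨rfl, rfl⟩ := hsw
  field_simp
  ring_nf
  simp only [I_sq, I_pow_three, I_pow_four]
  ring

theorem redHam_congr {f g : Pt → ℂ} (h : f =ᶠ[𝓝 x] g) :
    redHam h2 hb m ω E f x = redHam h2 hb m ω E g x := by
  rw [redHam, redHam, d1_congr h, d2_congr h, d3_congr h, h.self_of_nhds]

end Expand

/-! ### The explicit formula -/

/-- The exponential prefactor of the explicit formula. -/
noncomputable def pref (h2 hb m ω E : ℝ) (t : ℝ) (p : ℂ × ℂ) : ℂ :=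
  (Real.sqrt (E + m * ω) : ℂ) / (p.2 + m * ω) ^ (1 / 2 : ℂ)
    * cexp (-(I * ω / 2 * t) - 2 * Real.pi * h2 * (p.2 - E)
        - Real.pi * hb * p.1 ^ 2 / (p.2 + m * ω))

/-- The variables `(z, u)` of the explicit formula, rotated by the evolution. -/
noncomputable def zuMap (m ω : ℝ) (t : ℝ) (p : ℂ × ℂ) : ℂ × ℂ :=
  (cexp (-(I * ω * t)) * (p.1 / (p.2 + m * ω)), cexp (-(2 * I * ω * t)) * cayley m ω p.2)

/-- The analytic profile of the explicit formula. -/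
noncomputable def profile (h2 hb m ω E : ℝ) (f2 : ℂ × ℂ → ℂ) (t : ℝ) (p : ℂ × ℂ) : ℂ :=
  pref h2 hb m ω E t p * f2 (zuMap m ω t p)

section Profile

variable {h2 hb m ω E : ℝ} {f2 : ℂ × ℂ → ℂ} {t : ℝ} {s w : ℂ}

theorem geomSol_eq_expand : geomSol h2 hb m ω E f2 t = expand hb E (profile h2 hb m ω E f2 t) := by
  funext x
  simp only [geomSol, expand, profile, pref, zuMap, cplx, zVar, uVar]
  have h : cexp (-(I * ω / 2 * t) - Real.pi * hb * E * x.1 ^ 2 - 2 * Real.pi * I * h2 * x.2.1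
        - Real.pi * hb * (x.2.2 - I * E * x.1) ^ 2 / (I * x.2.1 + E + m * ω))
      = cexp (-(Real.pi * hb * E * x.1 ^ 2)) * cexp (-(I * ω / 2 * t)
        - 2 * Real.pi * h2 * (I * x.2.1 + E - E)
        - Real.pi * hb * (x.2.2 - I * E * x.1) ^ 2 / (I * x.2.1 + E + m * ω)) := by
    rw [← Complex.exp_add]; congr 1; ring
  rw [h]; ring

theorem add_mul_mem_slitPlane (hmω : 0 < m * ω) (hw : 0 < w.re) : w + m * ω ∈ slitPlane := by
  left
  rw [← ofReal_mul, add_re, ofReal_re]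
  linarith

/-- Writing both rotations with a single exponential reduces the later verifications to rational
identities. -/
theorem cexp_two_mul (t ω : ℝ) : cexp (-(2 * I * ω * t)) = cexp (-(I * ω * t)) ^ 2 := by
  rw [← Complex.exp_nat_mul]; congr 1; push_cast; ring

theorem hasDerivAt_cayley (hmω : 0 < m * ω) (hw : 0 < w.re) :
    HasDerivAt (cayley m ω) (-(2 * m * ω) / (w + m * ω) ^ 2) w := by
  have h0 : (m * ω + w : ℂ) ≠ 0 := by
    rw [add_comm]; exact slitPlane_ne_zero (add_mul_mem_slitPlane hmω hw)
  have h := ((hasDerivAt_id w).const_sub (m * ω : ℂ)).div ((hasDerivAt_id w).const_add (m * ω : ℂ)) h0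
  refine h.congr_deriv ?_
  simp only [id]
  rw [add_comm w]
  field_simp
  ring

theorem hasDerivAt_pref_fst (s w : ℂ) :
    HasDerivAt (fun ζ => pref h2 hb m ω E t (ζ, w))
      (pref h2 hb m ω E t (s, w) * (-(2 * Real.pi * hb) / (w + m * ω) * s)) s := by
  have h := (((((hasDerivAt_id s).pow 2).const_mul (Real.pi * hb : ℂ)).div_const
    (w + m * ω)).const_sub (-(I * ω / 2 * t) - 2 * Real.pi * h2 * (w - E))).cexp.const_mul
    ((Real.sqrt (E + m * ω) : ℂ) / (w + m * ω) ^ (1 / 2 : ℂ))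
  refine h.congr_deriv ?_
  simp only [pref, id, Pi.pow_apply]
  push_cast
  ring

theorem hasDerivAt_pref_snd (hmω : 0 < m * ω) (s : ℂ) (hw : 0 < w.re) :
    HasDerivAt (fun ζ => pref h2 hb m ω E t (s, ζ))
      (pref h2 hb m ω E t (s, w) * (-1 / (2 * (w + m * ω)) - 2 * Real.pi * h2
        + Real.pi * hb * s ^ 2 / (w + m * ω) ^ 2)) w := by
  have hs := add_mul_mem_slitPlane hmω hw
  have h0 := slitPlane_ne_zero hs
  have hid := (hasDerivAt_id w).add_const (m * ω : ℂ)
  have hX0 : (w + m * ω) ^ (1 / 2 : ℂ) ≠ 0 := by simp [cpow_eq_zero_iff, h0]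
  have hX : HasDerivAt (fun ζ : ℂ => (ζ + m * ω) ^ (1 / 2 : ℂ))
      ((1 / 2 : ℂ) * ((w + m * ω) ^ (1 / 2 : ℂ) / (w + m * ω))) w := by
    have h := hid.cpow_const (c := (1 / 2 : ℂ)) hs
    refine h.congr_deriv ?_
    simp only [id]
    rw [cpow_sub _ _ h0, cpow_one]; ring
  have h := ((hasDerivAt_const w (Real.sqrt (E + m * ω) : ℂ)).div hX hX0).mul
    (((((hasDerivAt_id w).sub_const (E : ℂ)).const_mul (2 * Real.pi * h2 : ℂ)).const_sub
      (-(I * ω / 2 * t))).sub ((hasDerivAt_const w (Real.pi * hb * s ^ 2 : ℂ)).div hid h0)).cexp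
  refine h.congr_deriv ?_
  simp only [pref, id, Pi.sub_apply, Pi.div_apply]
  field_simp
  ring

theorem hasDerivAt_pref_time (s w : ℂ) :
    HasDerivAt (fun τ : ℝ => pref h2 hb m ω E τ (s, w))
      (pref h2 hb m ω E t (s, w) * (-(I * ω / 2))) t := by
  have h := ((((hasDerivAt_id t).ofReal_comp.const_mul (I * ω / 2)).neg.sub_const
    (2 * Real.pi * h2 * (w - E) : ℂ)).sub_const (Real.pi * hb * s ^ 2 / (w + m * ω))).cexp.const_mul
    ((Real.sqrt (E + m * ω) : ℂ) / (w + m * ω) ^ (1 / 2 : ℂ))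
  refine h.congr_deriv ?_
  simp only [pref, id, Pi.neg_apply]
  push_cast
  ring

/-- The condition `Re w > 0` keeps `w + mω` off the branch cut of the principal square root. -/
theorem analyticAt_pref (hmω : 0 < m * ω) {p : ℂ × ℂ} (hw : 0 < p.2.re) :
    AnalyticAt ℂ (pref h2 hb m ω E t) p := by
  have hs := add_mul_mem_slitPlane hmω hw
  have h0 := slitPlane_ne_zero hs
  have hX0 : (p.2 + m * ω) ^ (1 / 2 : ℂ) ≠ 0 := by simp [cpow_eq_zero_iff, h0]
  have h2 : AnalyticAt ℂ (fun q : ℂ × ℂ => q.2 + m * ω) p := analyticAt_snd.add analyticAt_const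
  have h3 : AnalyticAt ℂ (fun q : ℂ × ℂ => (q.2 + m * ω) ^ (1 / 2 : ℂ)) p :=
    h2.cpow analyticAt_const hs
  refine (analyticAt_const.div h3 hX0).mul (AnalyticAt.cexp ?_)
  exact (analyticAt_const.sub (analyticAt_const.mul (analyticAt_snd.sub analyticAt_const))).sub
    ((analyticAt_const.mul (analyticAt_fst.pow 2)).div h2 h0)

theorem pref_ne_zero (hmω : 0 < m * ω) (hE : 0 < E) {p : ℂ × ℂ} (hw : 0 < p.2.re) :
    pref h2 hb m ω E t p ≠ 0 := by
  have h0 := slitPlane_ne_zero (add_mul_mem_slitPlane hmω hw)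
  have h1 : Real.sqrt (E + m * ω) ≠ 0 := (Real.sqrt_pos.2 (by linarith)).ne'
  simp [pref, cpow_eq_zero_iff, h0, h1, Complex.exp_ne_zero]

theorem analyticAt_zuMap (hmω : 0 < m * ω) {p : ℂ × ℂ} (hw : 0 < p.2.re) :
    AnalyticAt ℂ (zuMap m ω t) p := by
  have h0 := slitPlane_ne_zero (add_mul_mem_slitPlane hmω hw)
  have h0' : (m * ω + p.2 : ℂ) ≠ 0 := by rwa [add_comm]
  refine (analyticAt_const.mul (analyticAt_fst.div (analyticAt_snd.add analyticAt_const) h0)).prod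
    (analyticAt_const.mul ?_)
  exact (analyticAt_const.sub analyticAt_snd).div (analyticAt_const.add analyticAt_snd) h0'

theorem analyticAt_profile (hmω : 0 < m * ω) {p : ℂ × ℂ} (hw : 0 < p.2.re)
    (hf : AnalyticAt ℂ f2 (zuMap m ω t p)) :
    AnalyticAt ℂ (profile h2 hb m ω E f2 t) p :=
  (analyticAt_pref hmω hw).mul (hf.comp (analyticAt_zuMap hmω hw))

theorem hasDerivAt_profile_fst (s w : ℂ)
    (hf : DifferentiableAt ℂ f2 (zuMap m ω t (s, w))) :
    HasDerivAt (fun ζ => profile h2 hb m ω E f2 t (ζ, w))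
      (pref h2 hb m ω E t (s, w) * (-(2 * Real.pi * hb) / (w + m * ω) * s * f2 (zuMap m ω t (s, w))
        + cexp (-(I * ω * t)) / (w + m * ω) * pd1 f2 (zuMap m ω t (s, w)))) s := by
  have h1 : HasDerivAt (fun ζ : ℂ => cexp (-(I * ω * t)) * (ζ / (w + m * ω)))
      (cexp (-(I * ω * t)) * (1 / (w + m * ω))) s := ((hasDerivAt_id s).div_const _).const_mul _
  have h := (hasDerivAt_pref_fst (h2 := h2) (hb := hb) (m := m) (ω := ω) (E := E) (t := t) s w).mul
    (hasDerivAt_comp_pair hf h1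
      (hasDerivAt_const s (cexp (-(2 * I * ω * t)) * cayley m ω w)) rfl)
  refine h.congr_deriv ?_
  simp only [zuMap]
  ring

theorem hasDerivAt_profile_snd (hmω : 0 < m * ω) (s : ℂ) (hw : 0 < w.re)
    (hf : DifferentiableAt ℂ f2 (zuMap m ω t (s, w))) :
    HasDerivAt (fun ζ => profile h2 hb m ω E f2 t (s, ζ))
      (pref h2 hb m ω E t (s, w) * ((-1 / (2 * (w + m * ω)) - 2 * Real.pi * h2
          + Real.pi * hb * s ^ 2 / (w + m * ω) ^ 2) * f2 (zuMap m ω t (s, w))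
        - cexp (-(I * ω * t)) * s / (w + m * ω) ^ 2 * pd1 f2 (zuMap m ω t (s, w))
        - cexp (-(I * ω * t)) ^ 2 * (2 * m * ω) / (w + m * ω) ^ 2
          * pd2 f2 (zuMap m ω t (s, w)))) w := by
  have h0 := slitPlane_ne_zero (add_mul_mem_slitPlane hmω hw)
  have h1 : HasDerivAt (fun ζ => cexp (-(I * ω * t)) * (s / (ζ + m * ω)))
      (cexp (-(I * ω * t)) * ((0 * (w + m * ω) - s * 1) / (w + m * ω) ^ 2)) w :=
    ((hasDerivAt_const w s).div ((hasDerivAt_id w).add_const (m * ω : ℂ)) h0).const_mul _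
  have hc := (hasDerivAt_cayley hmω hw).const_mul (cexp (-(2 * I * ω * t)))
  have h := (hasDerivAt_pref_snd (h2 := h2) (hb := hb) (E := E) (t := t) hmω s hw).mul
    (hasDerivAt_comp_pair hf h1 hc rfl)
  refine h.congr_deriv ?_
  simp only [zuMap, cexp_two_mul]
  field_simp
  ring

/-- Time enters through the phase `exp(-iωt/2)` and the rotations of `z` and `u`, so `∂ₜ` acts on
`f₂` as `-iω` times the weighted Euler field `z∂_z + 2u∂_u`. -/
theorem hasDerivAt_profile_time
    (hf : DifferentiableAt ℂ f2 (zuMap m ω t (s, w))) :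
    HasDerivAt (fun τ : ℝ => profile h2 hb m ω E f2 τ (s, w))
      (pref h2 hb m ω E t (s, w) * (-(I * ω / 2) * f2 (zuMap m ω t (s, w))
        - I * ω * ((zuMap m ω t (s, w)).1 * pd1 f2 (zuMap m ω t (s, w))
          + 2 * (zuMap m ω t (s, w)).2 * pd2 f2 (zuMap m ω t (s, w))))) t := by
  have e1 : HasDerivAt (fun τ : ℝ => cexp (-(I * ω * τ)))
      (cexp (-(I * ω * t)) * -(I * ω * 1)) t :=
    ((hasDerivAt_id t).ofReal_comp.const_mul (I * ω : ℂ)).neg.cexp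
  have e2 : HasDerivAt (fun τ : ℝ => cexp (-(2 * I * ω * τ)))
      (cexp (-(2 * I * ω * t)) * -(2 * I * ω * 1)) t :=
    ((hasDerivAt_id t).ofReal_comp.const_mul (2 * I * ω : ℂ)).neg.cexp
  have h := (hasDerivAt_pref_time (h2 := h2) (hb := hb) (m := m) (ω := ω) (E := E) (t := t) s w).mul
    (hasDerivAt_comp_real_pair hf (e1.mul_const (s / (w + m * ω)))
      (e2.mul_const (cayley m ω w)) rfl)
  refine h.congr_deriv ?_
  simp only [zuMap]
  ring

theorem pd1_pd1_profile (s w : ℂ)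
    (hf : ∀ ζ, AnalyticAt ℂ f2 (zuMap m ω t (ζ, w))) :
    pd1 (pd1 (profile h2 hb m ω E f2 t)) (s, w) =
      pref h2 hb m ω E t (s, w) *
        (((2 * Real.pi * hb) ^ 2 / (w + m * ω) ^ 2 * s ^ 2 - 2 * Real.pi * hb / (w + m * ω))
            * f2 (zuMap m ω t (s, w))
          - 4 * Real.pi * hb * s / (w + m * ω) ^ 2 * cexp (-(I * ω * t))
            * pd1 f2 (zuMap m ω t (s, w))
          + cexp (-(I * ω * t)) ^ 2 / (w + m * ω) ^ 2 * pd1 (pd1 f2) (zuMap m ω t (s, w))) := by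
  have e : (fun ζ => pd1 (profile h2 hb m ω E f2 t) (ζ, w)) = fun ζ =>
      pref h2 hb m ω E t (ζ, w) * (-(2 * Real.pi * hb) / (w + m * ω) * ζ * f2 (zuMap m ω t (ζ, w))
        + cexp (-(I * ω * t)) / (w + m * ω) * pd1 f2 (zuMap m ω t (ζ, w))) := by
    funext ζ
    exact (hasDerivAt_profile_fst ζ w (hf ζ).differentiableAt).deriv
  have h1 : HasDerivAt (fun ζ : ℂ => cexp (-(I * ω * t)) * (ζ / (w + m * ω)))
      (cexp (-(I * ω * t)) * (1 / (w + m * ω))) s := ((hasDerivAt_id s).div_const _).const_mul _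
  have hc := hasDerivAt_const s (cexp (-(2 * I * ω * t)) * cayley m ω w)
  have hg := hasDerivAt_comp_pair (hf s).differentiableAt h1 hc rfl
  have hg1 := hasDerivAt_comp_pair (AnalyticAt.pd1 (hf s)).differentiableAt h1 hc rfl
  have h := (hasDerivAt_pref_fst (h2 := h2) (hb := hb) (m := m) (ω := ω) (E := E) (t := t) s w).mul
    ((((hasDerivAt_id s).const_mul (-(2 * Real.pi * hb) / (w + m * ω) : ℂ)).mul hg).add
      (hg1.const_mul (cexp (-(I * ω * t)) / (w + m * ω))))
  show deriv (fun ζ => pd1 (profile h2 hb m ω E f2 t) (ζ, w)) s = _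
  rw [e]
  refine (HasDerivAt.deriv h).trans ?_
  simp only [zuMap, id, Pi.add_apply, Pi.mul_apply]
  generalize (w + m * ω : ℂ) = d
  ring

end Profile

/-! ### The explicit formula as a function on `G/Z`, and the heat equation -/

section Geometric

variable {h2 hb m ω E : ℝ} {f2 : ℂ × ℂ → ℂ} {V : Set ℂ} {t : ℝ} {x : Pt}

theorem cplx_snd_re : (cplx E x).2.re = E := by simp [cplx]

/-- The pair `(x₁, x₃)` supplies the imaginary and real parts of `s`, so `s` is arbitrary; `w` is
confined to the line `Re w = E`. This asymmetry is why arguments in `z` are direct while those in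
`u` need the identity theorem. -/
theorem exists_cplx_eq (hE : E ≠ 0) (s : ℂ) (r : ℝ) :
    ∃ x : Pt, cplx E x = (s, I * r + E) := by
  refine ⟨(-(s.im / E), r, s.re), ?_⟩
  have hEc : (E : ℂ) ≠ 0 := ofReal_ne_zero.2 hE
  simp only [cplx, Prod.mk.injEq, and_true]
  push_cast
  field_simp
  linear_combination re_add_im s

theorem rotate_time_mem (hrot : ∀ u ∈ V, ∀ θ : ℝ, cexp (I * θ) * u ∈ V) (t : ℝ) {u : ℂ}
    (hu : u ∈ V) : cexp (-(2 * I * ω * t)) * u ∈ V := by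
  have := hrot u hu (-(2 * ω * t))
  convert this using 3
  push_cast; ring

theorem AnalyticOver.analyticAt_zuMap (hf : AnalyticOver V f2)
    (hrot : ∀ u ∈ V, ∀ θ : ℝ, cexp (I * θ) * u ∈ V) (t : ℝ) (s : ℂ) {w : ℂ}
    (hw : cayley m ω w ∈ V) : AnalyticAt ℂ f2 (zuMap m ω t (s, w)) :=
  hf _ ⟨trivial, rotate_time_mem hrot t hw⟩

theorem AnalyticOver.analyticAt_profile (hmω : 0 < m * ω) (hE : 0 < E) (hf : AnalyticOver V f2)
    (hrot : ∀ u ∈ V, ∀ θ : ℝ, cexp (I * θ) * u ∈ V) (t : ℝ) (hx : x ∈ region m ω E V) :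
    AnalyticAt ℂ (profile h2 hb m ω E f2 t) (cplx E x) :=
  ShearOsc.analyticAt_profile hmω (cplx_snd_re.symm ▸ hE) (hf.analyticAt_zuMap hrot t _ hx)

theorem pref_time (p : ℂ × ℂ) :
    pref h2 hb m ω E t p = cexp (-(I * ω / 2 * t)) * pref h2 hb m ω E 0 p := by
  have : cexp (-(I * ω / 2 * t) - 2 * Real.pi * h2 * (p.2 - E)
        - Real.pi * hb * p.1 ^ 2 / (p.2 + m * ω))
      = cexp (-(I * ω / 2 * t)) * cexp (-(I * ω / 2 * (0 : ℝ)) - 2 * Real.pi * h2 * (p.2 - E)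
        - Real.pi * hb * p.1 ^ 2 / (p.2 + m * ω)) := by
    rw [← Complex.exp_add]; congr 1; push_cast; ring
  rw [pref, this, pref]; ring

theorem contDiffOn_geomSol (hmω : 0 < m * ω) (hE : 0 < E) (hf : AnalyticOver V f2)
    (hrot : ∀ u ∈ V, ∀ θ : ℝ, cexp (I * θ) * u ∈ V) :
    ContDiffOn ℝ ((⊤ : ℕ∞) : WithTop ℕ∞) (fun p : ℝ × Pt => geomSol h2 hb m ω E f2 p.1 p.2)
      (Set.univ ×ˢ region m ω E V) := by
  rintro ⟨t, x⟩ ⟨-, hx⟩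
  have hre : 0 < (cplx E x).2.re := cplx_snd_re.symm ▸ hE
  have hR : ContDiff ℝ ((⊤ : ℕ∞) : WithTop ℕ∞) (fun r : ℝ => (r : ℂ)) := ofRealCLM.contDiff
  have hc : ContDiff ℝ ((⊤ : ℕ∞) : WithTop ℕ∞) (fun p : ℝ × Pt => cplx E p.2) :=
    contDiff_cplx.comp contDiff_snd
  have h1 : ContDiff ℝ ((⊤ : ℕ∞) : WithTop ℕ∞)
      (fun p : ℝ × Pt => cexp (-(Real.pi * hb * E * (p.2.1 : ℂ) ^ 2))
        * cexp (-(I * ω / 2 * (p.1 : ℂ)))) := by fun_prop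
  have h3 : ContDiffAt ℝ ((⊤ : ℕ∞) : WithTop ℕ∞)
      (fun p : ℝ × Pt => pref h2 hb m ω E 0 (cplx E p.2)) (t, x) :=
    ContDiffAt.comp (g := pref h2 hb m ω E 0) (t, x)
      ((analyticAt_pref hmω hre).contDiffAt.restrict_scalars ℝ) hc.contDiffAt
  have h4 : ContDiffAt ℝ ((⊤ : ℕ∞) : WithTop ℕ∞)
      (fun p : ℝ × Pt => zuMap m ω 0 (cplx E p.2)) (t, x) :=
    ContDiffAt.comp (g := zuMap m ω 0) (t, x)
      ((analyticAt_zuMap hmω hre).contDiffAt.restrict_scalars ℝ) hc.contDiffAt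
  have h5 : ContDiff ℝ ((⊤ : ℕ∞) : WithTop ℕ∞)
      (fun p : ℝ × Pt => cexp (-(I * ω * (p.1 : ℂ)))) := by fun_prop
  have h6 : ContDiff ℝ ((⊤ : ℕ∞) : WithTop ℕ∞)
      (fun p : ℝ × Pt => cexp (-(2 * I * ω * (p.1 : ℂ)))) := by fun_prop
  -- Factoring time out of the rotations reduces joint smoothness in `(t, x)` to analyticity of the
  -- maps at time `0`.
  have e : ∀ p : ℝ × Pt, zuMap m ω p.1 (cplx E p.2)
      = (cexp (-(I * ω * (p.1 : ℂ))) * (zuMap m ω 0 (cplx E p.2)).1,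
        cexp (-(2 * I * ω * (p.1 : ℂ))) * (zuMap m ω 0 (cplx E p.2)).2) := by
    intro p; simp [zuMap]
  have h7 : ContDiffAt ℝ ((⊤ : ℕ∞) : WithTop ℕ∞)
      (fun p : ℝ × Pt => zuMap m ω p.1 (cplx E p.2)) (t, x) := by
    simp only [e]
    exact (h5.contDiffAt.mul h4.fst).prodMk (h6.contDiffAt.mul h4.snd)
  have h8 : ContDiffAt ℝ ((⊤ : ℕ∞) : WithTop ℕ∞)
      (fun p : ℝ × Pt => f2 (zuMap m ω p.1 (cplx E p.2))) (t, x) :=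
    ContDiffAt.comp (g := f2) (t, x)
      ((hf.analyticAt_zuMap hrot t _ hx).contDiffAt.restrict_scalars ℝ) h7
  refine ContDiffAt.contDiffWithinAt (((h1.contDiffAt.mul h3).mul h8).congr_of_eventuallyEq
    (Eventually.of_forall fun p => ?_))
  simp only [geomSol_eq_expand, expand, profile]
  rw [pref_time]
  ring

theorem opC_geomSol (hmω : 0 < m * ω) (hE : 0 < E) (hf : AnalyticOver V f2)
    (hrot : ∀ u ∈ V, ∀ θ : ℝ, cexp (I * θ) * u ∈ V) (t : ℝ) (hx : x ∈ region m ω E V) :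
    opC hb E (geomSol h2 hb m ω E f2 t) x = 0 := by
  rw [geomSol_eq_expand]
  exact opC_expand (hf.analyticAt_profile hmω hE hrot t hx)

/-- The prefactor itself satisfies `SF = 0`, so the terms without derivatives of `f₂` cancel. The
cross term of `∂_s²` cancels the contribution of `∂_w z`, and only `∂_z²` and `∂_u` remain, with the
common factor `exp(-iωt)² / (w + mω)²`. -/
theorem opS_geomSol (hmω : 0 < m * ω) (hE : 0 < E) (hf : AnalyticOver V f2)
    (hrot : ∀ u ∈ V, ∀ θ : ℝ, cexp (I * θ) * u ∈ V) (t : ℝ) (hx : x ∈ region m ω E V) :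
    opS h2 hb (geomSol h2 hb m ω E f2 t) x = cexp (-(Real.pi * hb * E * x.1 ^ 2))
      * pref h2 hb m ω E t (cplx E x) * cexp (-(I * ω * t)) ^ 2 / ((cplx E x).2 + m * ω) ^ 2
      * (pd1 (pd1 f2) (zuMap m ω t (cplx E x))
        + 8 * Real.pi * hb * m * ω * pd2 f2 (zuMap m ω t (cplx E x))) := by
  have hre : 0 < (cplx E x).2.re := cplx_snd_re.symm ▸ hE
  have hu : cayley m ω (cplx E x).2 ∈ V := hx
  rw [geomSol_eq_expand, opS_expand (hf.analyticAt_profile hmω hE hrot t hx)]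
  generalize hp : cplx E x = p at *
  obtain ⟨s, w⟩ := p
  have h0 : (w + m * ω : ℂ) ≠ 0 := slitPlane_ne_zero (add_mul_mem_slitPlane hmω hre)
  rw [pd1_pd1_profile s w (fun ζ => hf.analyticAt_zuMap hrot t ζ hu), pd2,
    (hasDerivAt_profile_snd hmω s hre (hf.analyticAt_zuMap hrot t s hu).differentiableAt).deriv,
    profile]
  generalize (w + m * ω : ℂ) = d at *
  field_simp
  ring

/-- The field `w s ∂_s + (w² - m²ω²) ∂_w` sends `z = s/(w + mω)` to `mω z` and `u` to `2mω u`.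
Multiplied by `ħ/m` it is `ħω(z∂_z + 2u∂_u)`, which is what `iħ∂ₜ` produces from the rotation; the
zero-order terms acting on the prefactor leave the zero-point energy `ħω/2`. -/
theorem solves_redHam_geomSol (hm : 0 < m) (hω : 0 < ω) (hE : 0 < E) (hf : AnalyticOver V f2)
    (hrot : ∀ u ∈ V, ∀ θ : ℝ, cexp (I * θ) * u ∈ V) :
    Solves hb (redHam h2 hb m ω E) (region m ω E V) (geomSol h2 hb m ω E f2) := by
  intro t x hx
  have hmω : 0 < m * ω := mul_pos hm hω
  have hre : 0 < (cplx E x).2.re := cplx_snd_re.symm ▸ hE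
  have hu : cayley m ω (cplx E x).2 ∈ V := hx
  have hF := hf.analyticAt_profile (h2 := h2) (hb := hb) hmω hE hrot t hx
  have hd := (hasDerivAt_profile_time (h2 := h2) (hb := hb) (E := E) (s := (cplx E x).1)
    (w := (cplx E x).2) (hf.analyticAt_zuMap hrot t _ hu).differentiableAt).const_mul
    (cexp (-(Real.pi * hb * E * x.1 ^ 2)))
  have hfun : (fun τ : ℝ => geomSol h2 hb m ω E f2 τ x) = fun τ : ℝ =>
      cexp (-(Real.pi * hb * E * x.1 ^ 2)) * profile h2 hb m ω E f2 τ (cplx E x) := by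
    funext τ; rw [geomSol_eq_expand]; rfl
  rw [hfun]
  refine ⟨hd.differentiableAt, ?_⟩
  rw [hd.deriv, geomSol_eq_expand, redHam_expand hm.ne' hF (s := (cplx E x).1)
    (w := (cplx E x).2) rfl]
  generalize hp : cplx E x = p at *
  obtain ⟨s, w⟩ := p
  have h0 : (w + m * ω : ℂ) ≠ 0 := slitPlane_ne_zero (add_mul_mem_slitPlane hmω hre)
  have hdf := (hf.analyticAt_zuMap hrot t s hu).differentiableAt
  have hmc : (m : ℂ) ≠ 0 := ofReal_ne_zero.2 hm.ne'
  have h0' : (m * ω + w : ℂ) ≠ 0 := by rwa [add_comm]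
  have e1 : pd1 (profile h2 hb m ω E f2 t) (s, w) = _ := (hasDerivAt_profile_fst s w hdf).deriv
  have e2 : pd2 (profile h2 hb m ω E f2 t) (s, w) = _ :=
    (hasDerivAt_profile_snd hmω s hre hdf).deriv
  simp only [e1, e2, profile]
  clear hd hfun e1 e2
  have hz : (zuMap m ω t (s, w)).1 = cexp (-(I * ω * t)) * s / (w + m * ω) := by
    simp only [zuMap]; ring
  have hu : (zuMap m ω t (s, w)).2
      = cexp (-(I * ω * t)) ^ 2 * (m * ω - w) / (w + m * ω) := by
    simp only [zuMap, cayley, cexp_two_mul]; rw [add_comm w]; ring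
  simp only [hz, hu]
  generalize pd1 f2 (zuMap m ω t (s, w)) = A
  generalize pd2 f2 (zuMap m ω t (s, w)) = B
  generalize f2 (zuMap m ω t (s, w)) = C
  generalize cexp (-(I * ω * t)) = q
  generalize pref h2 hb m ω E t (s, w) = P
  -- With `d = w + mω` as the variable, every denominator is a power of `d`.
  obtain ⟨d, rfl⟩ : ∃ d, w = d - m * ω := ⟨w + m * ω, by ring⟩
  simp only [sub_add_cancel] at h0 ⊢
  field_simp
  ring_nf
  simp only [I_sq]
  ring

theorem heatLike_iff (hhb : 0 < hb) (hm : 0 < m) (hω : 0 < ω) :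
    HeatLike hb m ω V f2 ↔ ∀ z : ℂ, ∀ u ∈ V,
      pd1 (pd1 f2) (z, u) + 8 * Real.pi * hb * m * ω * pd2 f2 (z, u) = 0 := by
  have hpi : (Real.pi : ℂ) ≠ 0 := ofReal_ne_zero.2 Real.pi_ne_zero
  have hmc : (m : ℂ) ≠ 0 := ofReal_ne_zero.2 hm.ne'
  have hωc : (ω : ℂ) ≠ 0 := ofReal_ne_zero.2 hω.ne'
  have hhc : (hb : ℂ) ≠ 0 := ofReal_ne_zero.2 hhb.ne'
  refine forall_congr' fun z => forall₂_congr fun u _ => ?_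
  rw [iteratedDeriv_two_eq_pd1]
  change pd2 f2 (z, u) = _ ↔ _
  constructor
  · intro h
    rw [h]; field_simp; ring
  · intro h
    field_simp
    linear_combination h

theorem cayley_line_injective (hmω : 0 < m * ω) (hE : 0 < E) {r r' : ℝ}
    (h : cayley m ω (I * r + E) = cayley m ω (I * r' + E)) : r = r' := by
  have h1 : (m * ω + (I * r + E) : ℂ) ≠ 0 := by
    rw [add_comm]; exact slitPlane_ne_zero (add_mul_mem_slitPlane hmω (by simpa using hE))
  have h2 : (m * ω + (I * r' + E) : ℂ) ≠ 0 := by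
    rw [add_comm]; exact slitPlane_ne_zero (add_mul_mem_slitPlane hmω (by simpa using hE))
  have h3 : (m * ω : ℂ) ≠ 0 := by exact_mod_cast hmω.ne'
  rw [cayley, cayley, div_eq_div_iff h1 h2] at h
  have : 2 * (m * ω : ℂ) * I * r = 2 * (m * ω : ℂ) * I * r' := by linear_combination -h
  exact_mod_cast mul_left_cancel₀ (mul_ne_zero (mul_ne_zero two_ne_zero h3) I_ne_zero) this

theorem continuous_cayley_line (hmω : 0 < m * ω) (hE : 0 < E) :
    Continuous fun r : ℝ => cayley m ω (I * r + E) := by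
  unfold cayley
  refine Continuous.div (by fun_prop) (by fun_prop) fun r => ?_
  rw [add_comm]; exact slitPlane_ne_zero (add_mul_mem_slitPlane hmω (by simpa using hE))

/-- Injectivity along the line makes the arc accumulate at each of its points without repeating
values, as the identity theorem requires. -/
theorem tendsto_cayley_line (hmω : 0 < m * ω) (hE : 0 < E) (r : ℝ) :
    Tendsto (fun r : ℝ => cayley m ω (I * r + E)) (𝓝[≠] r) (𝓝[≠] cayley m ω (I * r + E)) :=
  tendsto_nhdsWithin_iff.2 ⟨((continuous_cayley_line hmω hE).tendsto r).mono_left inf_le_left,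
    eventually_mem_nhdsWithin.mono fun _ h h' => h (cayley_line_injective hmω hE h')⟩

theorem isOpen_region (hmω : 0 < m * ω) (hE : 0 < E) (hV : IsOpen V) :
    IsOpen (region m ω E V) :=
  hV.preimage ((continuous_cayley_line hmω hE).comp (continuous_fst.comp continuous_snd))

/-- If a property holds at the points of an arc `u(x₂)`, outside of the origin, then it holds at
points accumulating in the domain. -/
theorem eventually_cayley_line (hmω : 0 < m * ω) (hE : 0 < E) (hV : IsOpen V) {r : ℝ}
    (hr : cayley m ω (I * r + E) ∈ V) :
    ∀ᶠ r' : ℝ in 𝓝[≠] r, cayley m ω (I * r' + E) ∈ V ∧ cayley m ω (I * r' + E) ≠ 0 := by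
  have h := tendsto_cayley_line hmω hE r
  refine Eventually.and ((h.mono_right inf_le_left).eventually (hV.mem_nhds hr)) ?_
  by_cases h0 : cayley m ω (I * r + E) = 0
  · rw [h0] at h
    exact h.eventually eventually_mem_nhdsWithin
  · exact (h.mono_right inf_le_left).eventually (isOpen_ne.mem_nhds h0)

theorem AnalyticOver.analyticOnNhd_slice (hf : AnalyticOver V f2) (z : ℂ) :
    AnalyticOnNhd ℂ (fun u => f2 (z, u)) V := fun u hu =>
  AnalyticAt.fun_comp (hf (z, u) ⟨trivial, hu⟩) (analyticAt_const.prod analyticAt_id)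

theorem AnalyticOver.heat_expr (hf : AnalyticOver V f2) (c : ℂ) :
    AnalyticOver V (fun p => pd1 (pd1 f2) p + c * pd2 f2 p) := fun p hp =>
  (AnalyticAt.pd1 (AnalyticAt.pd1 (hf p hp))).add (analyticAt_const.mul (AnalyticAt.pd2 (hf p hp)))

/-- The structural condition at one time implies the heat equation. -/
theorem heatLike_of_opS (hhb : 0 < hb) (hm : 0 < m) (hω : 0 < ω) (hE : 0 < E)
    (hV : IsRotDomain V) (hne : (region m ω E V).Nonempty) (hf : AnalyticOver V f2)
    (hS : ∀ x ∈ region m ω E V, uVar m ω E x ≠ 0 → opS h2 hb (geomSol h2 hb m ω E f2 0) x = 0) :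
    HeatLike hb m ω V f2 := by
  have hmω : 0 < m * ω := mul_pos hm hω
  rw [heatLike_iff hhb hm hω]
  intro z
  obtain ⟨x₀, hx₀⟩ := hne
  have hev : ∀ᶠ r : ℝ in 𝓝[≠] x₀.2.1,
      pd1 (pd1 f2) (z, cayley m ω (I * r + E))
        + 8 * Real.pi * hb * m * ω * pd2 f2 (z, cayley m ω (I * r + E)) = 0 := by
    refine (eventually_cayley_line hmω hE hV.isOpen hx₀).mono fun r hr => ?_
    have h0 := slitPlane_ne_zero
      (add_mul_mem_slitPlane hmω (show 0 < (I * r + E : ℂ).re by simpa using hE))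
    -- The value of `s` is the one that gives the prescribed `z` at `w = ir + E`.
    obtain ⟨x, hx⟩ := exists_cplx_eq hE.ne' (z * (I * r + E + m * ω)) r
    have hx2 : (I * x.2.1 + E : ℂ) = I * r + E := congrArg Prod.snd hx
    have hxr : x ∈ region m ω E V := by
      show cayley m ω (I * x.2.1 + E) ∈ V
      rw [hx2]; exact hr.1
    have hx0 : uVar m ω E x ≠ 0 := by
      show cayley m ω (I * x.2.1 + E) ≠ 0
      rw [hx2]; exact hr.2
    have h := hS x hxr hx0
    have hzu : zuMap m ω 0 (cplx E x) = (z, cayley m ω (I * r + E)) := by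
      rw [hx]
      simp [zuMap, mul_div_cancel_right₀ _ h0]
    have hre : 0 < (cplx E x).2.re := cplx_snd_re.symm ▸ hE
    rw [opS_geomSol hmω hE hf hV.rotate 0 hxr, hzu] at h
    refine (mul_eq_zero.1 h).resolve_left (div_ne_zero (mul_ne_zero (mul_ne_zero
      (Complex.exp_ne_zero _) (pref_ne_zero hmω hE hre)) (pow_ne_zero _ (Complex.exp_ne_zero _)))
      (pow_ne_zero _ (slitPlane_ne_zero (add_mul_mem_slitPlane hmω hre))))
  -- For fixed `z` the heat expression is analytic in `u` on the connected set `V` and vanishes on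
  -- points of the arc that accumulate in `V`.
  exact fun u hu => ((hf.heat_expr _).analyticOnNhd_slice z).eqOn_zero_of_preconnected_of_frequently_eq_zero
    hV.isConnected.isPreconnected hx₀
    ((tendsto_cayley_line hmω hE x₀.2.1).frequently hev.frequently) hu

theorem opS_geomSol_eq_zero (hhb : 0 < hb) (hm : 0 < m) (hω : 0 < ω) (hE : 0 < E)
    (hf : AnalyticOver V f2) (hrot : ∀ u ∈ V, ∀ θ : ℝ, cexp (I * θ) * u ∈ V)
    (hheat : HeatLike hb m ω V f2) (t : ℝ) (hx : x ∈ region m ω E V) :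
    opS h2 hb (geomSol h2 hb m ω E f2 t) x = 0 := by
  rw [opS_geomSol (mul_pos hm hω) hE hf hrot t hx]
  rw [heatLike_iff hhb hm hω] at hheat
  have h : pd1 (pd1 f2) (zuMap m ω t (cplx E x))
      + 8 * Real.pi * hb * m * ω * pd2 f2 (zuMap m ω t (cplx E x)) = 0 :=
    hheat _ _ (rotate_time_mem hrot t hx)
  rw [h, mul_zero]

theorem redHam_geomSol (hm : 0 < m) (hω : 0 < ω) (hE : 0 < E) (hV : IsOpen V)
    (hf : AnalyticOver V f2) (hrot : ∀ u ∈ V, ∀ θ : ℝ, cexp (I * θ) * u ∈ V) (t : ℝ)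
    (hx : x ∈ region m ω E V) :
    redHam h2 hb m ω E (geomSol h2 hb m ω E f2 t) x = ham hb m ω (geomSol h2 hb m ω E f2 t) x
      + (m ^ 2 * ω ^ 2 - (I * x.2.1 + E) ^ 2) / (4 * Real.pi * m)
        * opS h2 hb (geomSol h2 hb m ω E f2 t) x := by
  have hmω : 0 < m * ω := mul_pos hm hω
  refine redHam_eq_ham_of_eventually hm.ne' ?_
    (Filter.mem_of_superset ((isOpen_region hmω hE hV).mem_nhds hx)
      fun y hy => opC_geomSol hmω hE hf hrot t hy)
  rw [geomSol_eq_expand]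
  exact contDiffAt_expand (hf.analyticAt_profile hmω hE hrot t hx)

theorem solves_ham_geomSol (hhb : 0 < hb) (hm : 0 < m) (hω : 0 < ω) (hE : 0 < E)
    (hV : IsOpen V) (hf : AnalyticOver V f2) (hrot : ∀ u ∈ V, ∀ θ : ℝ, cexp (I * θ) * u ∈ V)
    (hheat : HeatLike hb m ω V f2) :
    Solves hb (ham hb m ω) (region m ω E V) (geomSol h2 hb m ω E f2) := by
  intro t x hx
  obtain ⟨hd, he⟩ := solves_redHam_geomSol (h2 := h2) (hb := hb) hm hω hE hf hrot t x hx
  rw [redHam_geomSol hm hω hE hV hf hrot t hx,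
    opS_geomSol_eq_zero hhb hm hω hE hf hrot hheat t hx, mul_zero, add_zero] at he
  exact ⟨hd, he⟩

/-- The equations with `H` and `H₁` differ by a multiple of `S f`, whose coefficient contains `m²ω²
- w²`. It vanishes where `u = 0`, so nothing is learnt about `S f` there; this is why
`heatLike_of_opS` asks for the condition only at `u ≠ 0`. -/
theorem heatLike_of_solves_ham (hhb : 0 < hb) (hm : 0 < m) (hω : 0 < ω) (hE : 0 < E)
    (hV : IsRotDomain V) (hne : (region m ω E V).Nonempty) (hf : AnalyticOver V f2)
    (h : Solves hb (ham hb m ω) (region m ω E V) (geomSol h2 hb m ω E f2)) :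
    HeatLike hb m ω V f2 := by
  refine heatLike_of_opS (h2 := h2) hhb hm hω hE hV hne hf fun x hx hu => ?_
  have h1 := (solves_redHam_geomSol (h2 := h2) (hb := hb) hm hω hE hf hV.rotate 0 x hx).2
  have h2' := (h 0 x hx).2
  rw [redHam_geomSol hm hω hE hV.isOpen hf hV.rotate 0 hx] at h1
  have hmul : (m ^ 2 * ω ^ 2 - (I * x.2.1 + E) ^ 2) / (4 * Real.pi * m)
        * opS h2 hb (geomSol h2 hb m ω E f2 0) x = 0 := by linear_combination h2' - h1
  refine (mul_eq_zero.1 hmul).resolve_left ?_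
  have hpi : (Real.pi : ℂ) ≠ 0 := ofReal_ne_zero.2 Real.pi_ne_zero
  have hmc : (m : ℂ) ≠ 0 := ofReal_ne_zero.2 hm.ne'
  have h0 := slitPlane_ne_zero (add_mul_mem_slitPlane (mul_pos hm hω)
    (show 0 < (I * x.2.1 + E : ℂ).re by simpa using hE))
  have hu' : (m * ω - (I * x.2.1 + E) : ℂ) ≠ 0 := fun h => hu (by simp [uVar, cayley, h])
  refine div_ne_zero ?_ (by simp [hpi, hmc])
  have : (m ^ 2 * ω ^ 2 - (I * x.2.1 + E) ^ 2 : ℂ)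
      = (m * ω - (I * x.2.1 + E)) * (I * x.2.1 + E + m * ω) := by ring
  rw [this]
  exact mul_ne_zero hu' h0

end Geometric

/-! ### Separately holomorphic functions -/

section Osgood

open scoped BoundedContinuousFunction

/-- The double integral over `[0, 2π]²` as a continuous linear functional. -/
noncomputable def torusFunctional : ((ℝ × ℝ) →ᵇ ℂ) →L[ℂ] ℂ :=
  LinearMap.mkContinuous
    { toFun := fun g => ∫ β in (0 : ℝ)..2 * Real.pi, ∫ α in (0 : ℝ)..2 * Real.pi, g (α, β)
      map_add' := fun g h => by
        have hg : ∀ k : (ℝ × ℝ) →ᵇ ℂ, Continuous fun β : ℝ =>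
            ∫ α in (0 : ℝ)..2 * Real.pi, k (α, β) := fun k =>
          intervalIntegral.continuous_parametric_intervalIntegral_of_continuous'
            (f := fun β α => k (α, β)) (by simp only [Function.uncurry_def]; fun_prop) _ _
        rw [← intervalIntegral.integral_add ((hg g).intervalIntegrable _ _)
          ((hg h).intervalIntegrable _ _)]
        refine intervalIntegral.integral_congr fun β _ => ?_
        exact intervalIntegral.integral_add
          (Continuous.intervalIntegrable (by fun_prop) _ _)
          (Continuous.intervalIntegrable (by fun_prop) _ _)
      map_smul' := fun c g => by simp }
    ((2 * Real.pi) * (2 * Real.pi)) fun g => by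
      have hpi : (0 : ℝ) ≤ 2 * Real.pi := by positivity
      have h1 : ∀ β : ℝ, ‖∫ α in (0 : ℝ)..2 * Real.pi, g (α, β)‖ ≤ ‖g‖ * (2 * Real.pi) := fun β => by
        have := intervalIntegral.norm_integral_le_of_norm_le_const (a := 0) (b := 2 * Real.pi)
          (f := fun α => g (α, β)) (C := ‖g‖) fun α _ => g.norm_coe_le_norm _
        simpa [abs_of_nonneg hpi, abs_of_pos Real.pi_pos] using this
      have h2 := intervalIntegral.norm_integral_le_of_norm_le_const (a := 0) (b := 2 * Real.pi)
          (f := fun β => ∫ α in (0 : ℝ)..2 * Real.pi, g (α, β)) (C := ‖g‖ * (2 * Real.pi))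
          fun β _ => h1 β
      rw [sub_zero, abs_of_nonneg hpi] at h2
      refine h2.trans (le_of_eq (by ring))

theorem torusFunctional_apply (g : (ℝ × ℝ) →ᵇ ℂ) : torusFunctional g
    = ∫ β in (0 : ℝ)..2 * Real.pi, ∫ α in (0 : ℝ)..2 * Real.pi, g (α, β) := rfl

/-- A continuous function of two angles, `2π`-periodic in both, as a bounded function. -/
theorem exists_bcf_of_circleMap {G : ℂ × ℂ → ℂ} {c : ℂ × ℂ} {r : ℝ} (hr : 0 ≤ r)
    (hG : ContinuousOn G (Metric.sphere c.1 r ×ˢ Metric.sphere c.2 r)) :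
    ∃ g : (ℝ × ℝ) →ᵇ ℂ, ∀ α β, g (α, β) = G (circleMap c.1 r α, circleMap c.2 r β) := by
  have hK : IsCompact (Metric.sphere c.1 r ×ˢ Metric.sphere c.2 r) :=
    (isCompact_sphere _ _).prod (isCompact_sphere _ _)
  obtain ⟨C, hC⟩ := hK.exists_bound_of_continuousOn hG
  have hmem : ∀ p : ℝ × ℝ, (circleMap c.1 r p.1, circleMap c.2 r p.2) ∈
      Metric.sphere c.1 r ×ˢ Metric.sphere c.2 r := fun p =>
    ⟨circleMap_mem_sphere _ hr _, circleMap_mem_sphere _ hr _⟩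
  refine ⟨BoundedContinuousFunction.ofNormedAddCommGroup
    (fun p : ℝ × ℝ => G (circleMap c.1 r p.1, circleMap c.2 r p.2)) ?_ C
    fun p => hC _ (hmem p), fun α β => rfl⟩
  refine hG.comp_continuous ?_ hmem
  exact ((continuous_circleMap _ _).comp continuous_fst).prodMk
    ((continuous_circleMap _ _).comp continuous_snd)

/-- Inversion is analytic on the units of a complete normed algebra. Applied to bounded continuous
functions of the two angles, this makes the Cauchy kernel an analytic Banach-valued function of its
pole. -/
theorem analyticAt_inverse_sub {A : Type*} [NormedRing A] [NormedAlgebra ℂ A]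
    [CompleteSpace A] (a : A) {f : ℂ × ℂ → ℂ} {p : ℂ × ℂ} (hf : AnalyticAt ℂ f p)
    (hu : IsUnit (a - algebraMap ℂ A (f p))) :
    AnalyticAt ℂ (fun q => Ring.inverse (a - algebraMap ℂ A (f q))) p := by
  obtain ⟨u, hu⟩ := hu
  have h1 : AnalyticAt ℂ (fun q => a - algebraMap ℂ A (f q)) p :=
    analyticAt_const.sub ((Algebra.linearMap ℂ A).toContinuousLinearMap.analyticAt _ |>.comp hf)
  have h2 : AnalyticAt ℂ Ring.inverse (a - algebraMap ℂ A (f p)) := hu ▸ analyticAt_inverse u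
  exact AnalyticAt.fun_comp (g := Ring.inverse) h2 h1

/-- A continuous, separately holomorphic function of two variables is analytic. -/
theorem analyticAt_of_separately {F : ℂ × ℂ → ℂ} {p : ℂ × ℂ} {r : ℝ} (hr : 0 < r)
    (hc : ContinuousOn F (Metric.closedBall p.1 r ×ˢ Metric.closedBall p.2 r))
    (h1 : ∀ w ∈ Metric.closedBall p.2 r,
      DifferentiableOn ℂ (fun ζ => F (ζ, w)) (Metric.closedBall p.1 r))
    (h2 : ∀ s ∈ Metric.closedBall p.1 r,
      DifferentiableOn ℂ (fun ζ => F (s, ζ)) (Metric.closedBall p.2 r)) :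
    AnalyticAt ℂ F p := by
  have hsub : ∀ c : ℂ, Metric.sphere c r ⊆ Metric.closedBall c r :=
    fun c => Metric.sphere_subset_closedBall
  obtain ⟨Fh, hFh⟩ := exists_bcf_of_circleMap (c := p) hr.le
    (hc.mono (Set.prod_mono (hsub _) (hsub _)))
  -- `D` is the product of the derivatives of the two circle parametrisations.
  obtain ⟨D, hD⟩ := exists_bcf_of_circleMap (c := p)
    (G := fun q => (q.1 - p.1) * I * ((q.2 - p.2) * I)) hr.le (by fun_prop)
  obtain ⟨Z1, hZ1⟩ := exists_bcf_of_circleMap (c := p) (G := fun q => q.1) hr.le (by fun_prop)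
  obtain ⟨Z2, hZ2⟩ := exists_bcf_of_circleMap (c := p) (G := fun q => q.2) hr.le (by fun_prop)
  have hinv1 : ∀ s ∈ Metric.ball p.1 r, IsUnit (Z1 - algebraMap ℂ _ s) ∧
      ∀ α β, Ring.inverse (Z1 - algebraMap ℂ _ s) (α, β) = (circleMap p.1 r α - s)⁻¹ := by
    intro s hs
    have hne : ∀ α, circleMap p.1 r α - s ≠ 0 := fun α h =>
      circleMap_ne_mem_ball hs α (sub_eq_zero.1 h)
    obtain ⟨g, hg⟩ := exists_bcf_of_circleMap (c := p) (G := fun q => (q.1 - s)⁻¹) hr.le (by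
      refine ContinuousOn.inv₀ (by fun_prop) fun q hq h => ?_
      have h' := hq.1
      rw [sub_eq_zero.1 h] at h'
      exact (Metric.mem_ball.1 hs).ne h')
    have e : (Z1 - algebraMap ℂ _ s) * g = 1 := by
      ext ⟨α, β⟩
      simp only [BoundedContinuousFunction.coe_mul, Pi.mul_apply, BoundedContinuousFunction.coe_sub,
        Pi.sub_apply, BoundedContinuousFunction.algebraMap_apply, hZ1, hg,
        BoundedContinuousFunction.coe_one, Pi.one_apply]
      simpa using mul_inv_cancel₀ (hne α)
    have hU : IsUnit (Z1 - algebraMap ℂ _ s) := .of_mul_eq_one _ e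
    refine ⟨hU, fun α β => ?_⟩
    have : Ring.inverse (Z1 - algebraMap ℂ _ s) = g := by
      rw [← one_mul g, ← Ring.inverse_mul_cancel _ hU, mul_assoc, e, mul_one]
    rw [this, hg]
  have hinv2 : ∀ w ∈ Metric.ball p.2 r, IsUnit (Z2 - algebraMap ℂ _ w) ∧
      ∀ α β, Ring.inverse (Z2 - algebraMap ℂ _ w) (α, β) = (circleMap p.2 r β - w)⁻¹ := by
    intro w hw
    have hne : ∀ β, circleMap p.2 r β - w ≠ 0 := fun β h =>
      circleMap_ne_mem_ball hw β (sub_eq_zero.1 h)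
    obtain ⟨g, hg⟩ := exists_bcf_of_circleMap (c := p) (G := fun q => (q.2 - w)⁻¹) hr.le (by
      refine ContinuousOn.inv₀ (by fun_prop) fun q hq h => ?_
      have h' := hq.2
      rw [sub_eq_zero.1 h] at h'
      exact (Metric.mem_ball.1 hw).ne h')
    have e : (Z2 - algebraMap ℂ _ w) * g = 1 := by
      ext ⟨α, β⟩
      simp only [BoundedContinuousFunction.coe_mul, Pi.mul_apply, BoundedContinuousFunction.coe_sub,
        Pi.sub_apply, BoundedContinuousFunction.algebraMap_apply, hZ2, hg,
        BoundedContinuousFunction.coe_one, Pi.one_apply]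
      simpa using mul_inv_cancel₀ (hne β)
    have hU : IsUnit (Z2 - algebraMap ℂ _ w) := .of_mul_eq_one _ e
    refine ⟨hU, fun α β => ?_⟩
    have : Ring.inverse (Z2 - algebraMap ℂ _ w) = g := by
      rw [← one_mul g, ← Ring.inverse_mul_cancel _ hU, mul_assoc, e, mul_one]
    rw [this, hg]
  have hpi : (2 * Real.pi * I : ℂ) ≠ 0 := two_pi_I_ne_zero
  -- Cauchy's formula, applied in each variable, presents `F` as a continuous linear functional of a
  -- product of two resolvents; analyticity in both variables jointly follows at once.
  have key : ∀ q ∈ Metric.ball p.1 r ×ˢ Metric.ball p.2 r, F q = (2 * Real.pi * I : ℂ)⁻¹ ^ 2 *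
      torusFunctional (D * Fh * Ring.inverse (Z1 - algebraMap ℂ _ q.1)
        * Ring.inverse (Z2 - algebraMap ℂ _ q.2)) := by
    rintro ⟨s, w⟩ ⟨hs, hw⟩
    have c2 := (h2 s (Metric.ball_subset_closedBall hs)).circleIntegral_sub_inv_smul hw
    have c1 : ∀ β, ∮ z in C(p.1, r), (z - s)⁻¹ • F (z, circleMap p.2 r β)
        = (2 * Real.pi * I : ℂ) • F (s, circleMap p.2 r β) := fun β =>
      (h1 _ (hsub _ (circleMap_mem_sphere _ hr.le β))).circleIntegral_sub_inv_smul hs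
    have : torusFunctional (D * Fh * Ring.inverse (Z1 - algebraMap ℂ _ s)
        * Ring.inverse (Z2 - algebraMap ℂ _ w)) = (2 * Real.pi * I : ℂ) *
        ∮ z in C(p.2, r), (z - w)⁻¹ • F (s, z) := by
      rw [torusFunctional_apply, circleIntegral, ← intervalIntegral.integral_const_mul]
      refine intervalIntegral.integral_congr fun β _ => ?_
      have e := c1 β
      rw [circleIntegral, smul_eq_mul] at e
      simp only [smul_eq_mul] at e ⊢
      have : deriv (circleMap p.2 r) β * ((circleMap p.2 r β - w)⁻¹ * F (s, circleMap p.2 r β))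
          * (2 * Real.pi * I) = deriv (circleMap p.2 r) β * (circleMap p.2 r β - w)⁻¹ *
          ((2 * Real.pi * I) * F (s, circleMap p.2 r β)) := by ring
      rw [mul_comm (2 * Real.pi * I : ℂ), this, ← e, ← intervalIntegral.integral_const_mul]
      refine intervalIntegral.integral_congr fun α _ => ?_
      simp only [BoundedContinuousFunction.coe_mul, Pi.mul_apply, hD, hFh, (hinv1 s hs).2,
        (hinv2 w hw).2, deriv_circleMap, circleMap_sub_center]
      ring
    simp only
    rw [this, c2, smul_eq_mul]
    field_simp
  have hpm : p ∈ Metric.ball p.1 r ×ˢ Metric.ball p.2 r :=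
    ⟨Metric.mem_ball_self hr, Metric.mem_ball_self hr⟩
  have hopen : Metric.ball p.1 r ×ˢ Metric.ball p.2 r ∈ 𝓝 p :=
    (Metric.isOpen_ball.prod Metric.isOpen_ball).mem_nhds hpm
  refine AnalyticAt.congr ?_ (eventuallyEq_of_mem hopen key).symm
  refine analyticAt_const.mul ((torusFunctional.analyticAt _).comp ?_)
  exact (analyticAt_const.mul (analyticAt_inverse_sub Z1 analyticAt_fst (hinv1 _ hpm.1).1)).mul
    (analyticAt_inverse_sub Z2 analyticAt_snd (hinv2 _ hpm.2).1)

/-- A continuous, separately holomorphic function on an open set is analytic. -/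
theorem analyticOnNhd_of_separately {F : ℂ × ℂ → ℂ} {U : Set (ℂ × ℂ)} (hU : IsOpen U)
    (hc : ContinuousOn F U)
    (h1 : ∀ p ∈ U, DifferentiableAt ℂ (fun ζ => F (ζ, p.2)) p.1)
    (h2 : ∀ p ∈ U, DifferentiableAt ℂ (fun ζ => F (p.1, ζ)) p.2) :
    AnalyticOnNhd ℂ F U := by
  intro p hp
  obtain ⟨r, hr, hsub⟩ := Metric.nhds_basis_closedBall.mem_iff.1 (hU.mem_nhds hp)
  rw [← Prod.mk.eta (p := p), ← closedBall_prod_same] at hsub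
  exact analyticAt_of_separately hr (hc.mono hsub)
    (fun w hw s hs => (h1 (s, w) (hsub ⟨hs, hw⟩)).differentiableWithinAt)
    (fun s hs w hw => (h2 (s, w) (hsub ⟨hs, hw⟩)).differentiableWithinAt)

end Osgood

/-! ### The Laplace-Gauss transform -/

/-- Functions `k` such that `k e^{-βy²}` is integrable for all `β > α`. -/
structure GaussClass (α : ℝ) (k : ℝ → ℂ) : Prop where
  aesm : AEStronglyMeasurable k volume
  integrable : ∀ β, α < β → Integrable fun y : ℝ => ‖k y‖ * Real.exp (-β * y ^ 2)

/-- The transform `∫ k(y) exp(-wy² + sy) dy`. -/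
noncomputable def lap (k : ℝ → ℂ) (s w : ℂ) : ℂ := ∫ y : ℝ, k y * cexp (-(w * y ^ 2) + s * y)

section Lap

variable {α : ℝ} {k : ℝ → ℂ}

theorem exp_mul_abs_le (M : ℝ) {ε : ℝ} (hε : 0 < ε) (y : ℝ) :
    Real.exp (M * |y|) ≤ Real.exp (M ^ 2 / (4 * ε)) * Real.exp (ε * y ^ 2) := by
  rw [← Real.exp_add]
  refine Real.exp_le_exp.2 ?_
  have h : M ^ 2 / (4 * ε) + ε * y ^ 2 - M * |y| = (M - 2 * ε * |y|) ^ 2 / (4 * ε) := by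
    rw [← sq_abs y]; field_simp; ring
  have h2 : 0 ≤ (M - 2 * ε * |y|) ^ 2 / (4 * ε) := by positivity
  linarith

theorem norm_cexp_kernel (s w : ℂ) (y : ℝ) :
    ‖cexp (-(w * y ^ 2) + s * y)‖ = Real.exp (-w.re * y ^ 2 + s.re * y) := by
  rw [Complex.norm_exp]
  congr 1
  simp [← ofReal_pow, Complex.mul_re]

/-- Giving up a part `β - γ` of the Gaussian decay absorbs the linear exponent, uniformly for `‖s‖ ≤
M`. -/
theorem norm_cexp_kernel_le {s w : ℂ} {M β γ : ℝ} (hs : ‖s‖ ≤ M) (hw : β ≤ w.re) (hγ : γ < β)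
    (y : ℝ) : ‖cexp (-(w * y ^ 2) + s * y)‖
      ≤ Real.exp (M ^ 2 / (4 * (β - γ))) * Real.exp (-γ * y ^ 2) := by
  rw [norm_cexp_kernel]
  have h1 := exp_mul_abs_le M (sub_pos.2 hγ) y
  have h2 : s.re * y ≤ M * |y| := by
    calc s.re * y ≤ |s.re * y| := le_abs_self _
      _ = |s.re| * |y| := abs_mul _ _
      _ ≤ M * |y| := by gcongr; exact (abs_re_le_norm s).trans hs
  calc Real.exp (-w.re * y ^ 2 + s.re * y) ≤ Real.exp (-β * y ^ 2 + M * |y|) := by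
        refine Real.exp_le_exp.2 (add_le_add ?_ h2)
        nlinarith [sq_nonneg y]
    _ = Real.exp (-β * y ^ 2) * Real.exp (M * |y|) := Real.exp_add _ _
    _ ≤ Real.exp (-β * y ^ 2) * (Real.exp (M ^ 2 / (4 * (β - γ))) * Real.exp ((β - γ) * y ^ 2)) := by
        gcongr
    _ = _ := by
        rw [mul_left_comm, ← Real.exp_add]; congr 2; ring

/-- The class asks only for `β > α`, so any loss of decay is affordable and the factor `|y| ≤ exp
|y|` can be absorbed. Hence derivatives of `lap` are again transforms of functions of the same
class. -/
theorem GaussClass.mul_id (hk : GaussClass α k) : GaussClass α fun y => (y : ℂ) * k y := by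
  refine ⟨(by fun_prop : AEStronglyMeasurable (fun y : ℝ => (y : ℂ)) volume).mul hk.aesm,
    fun β hβ => ?_⟩
  set γ := (α + β) / 2 with hγ
  have h1 : α < γ := by rw [hγ]; linarith
  have h2 : 0 < β - γ := by rw [hγ]; linarith
  refine Integrable.mono' ((hk.integrable γ h1).const_mul (Real.exp (1 ^ 2 / (4 * (β - γ))))) ?_ ?_
  · exact (((by fun_prop : AEStronglyMeasurable (fun y : ℝ => (y : ℂ)) volume).mul hk.aesm).norm).mul
      (by fun_prop)
  · refine Eventually.of_forall fun y => ?_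
    have h3 : |y| ≤ Real.exp (1 * |y|) := by
      rw [one_mul]; linarith [Real.add_one_le_exp |y|]
    have h4 := h3.trans (exp_mul_abs_le 1 h2 y)
    have h5 : Real.exp ((β - γ) * y ^ 2) * Real.exp (-β * y ^ 2) = Real.exp (-γ * y ^ 2) := by
      rw [← Real.exp_add]; congr 1; ring
    rw [Real.norm_of_nonneg (by positivity), norm_mul, norm_real, Real.norm_eq_abs]
    calc |y| * ‖k y‖ * Real.exp (-β * y ^ 2)
        ≤ (Real.exp (1 ^ 2 / (4 * (β - γ))) * Real.exp ((β - γ) * y ^ 2)) * ‖k y‖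
          * Real.exp (-β * y ^ 2) := by gcongr
      _ = Real.exp (1 ^ 2 / (4 * (β - γ))) * (‖k y‖
          * (Real.exp ((β - γ) * y ^ 2) * Real.exp (-β * y ^ 2))) := by ring
      _ = _ := by rw [h5]

theorem GaussClass.aesm_integrand (hk : GaussClass α k) (s w : ℂ) :
    AEStronglyMeasurable (fun y : ℝ => k y * cexp (-(w * y ^ 2) + s * y)) volume :=
  hk.aesm.mul (Continuous.aestronglyMeasurable (by fun_prop))

/-- An integrable majorant of the integrands, locally uniform in the parameters. -/
theorem GaussClass.exists_bound (hk : GaussClass α k) (M : ℝ) {β : ℝ} (hβ : α < β) :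
    ∃ g : ℝ → ℝ, Integrable g ∧ ∀ s w : ℂ, ‖s‖ ≤ M → β ≤ w.re →
      ∀ y : ℝ, ‖k y * cexp (-(w * y ^ 2) + s * y)‖ ≤ g y := by
  set γ := (α + β) / 2 with hγ
  have h1 : α < γ := by rw [hγ]; linarith
  have h2 : γ < β := by rw [hγ]; linarith
  refine ⟨_, (hk.integrable γ h1).const_mul (Real.exp (M ^ 2 / (4 * (β - γ)))), ?_⟩
  intro s w hs hw y
  rw [norm_mul, mul_left_comm]
  gcongr
  exact norm_cexp_kernel_le hs hw h2 y

theorem GaussClass.integrable_integrand (hk : GaussClass α k) (s : ℂ) {w : ℂ} (hw : α < w.re) :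
    Integrable fun y : ℝ => k y * cexp (-(w * y ^ 2) + s * y) := by
  obtain ⟨g, hg, h⟩ := hk.exists_bound ‖s‖ hw
  exact hg.mono' (hk.aesm_integrand s w) (Eventually.of_forall (h s w le_rfl le_rfl))

theorem GaussClass.hasDerivAt_lap_fst (hk : GaussClass α k) (s : ℂ) {w : ℂ} (hw : α < w.re) :
    HasDerivAt (fun ζ => lap k ζ w) (lap (fun y => (y : ℂ) * k y) s w) s := by
  obtain ⟨g, hg, h⟩ := hk.mul_id.exists_bound (‖s‖ + 1) hw
  refine (hasDerivAt_integral_of_dominated_loc_of_deriv_le (s := Metric.ball s 1)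
    (bound := g) (F' := fun ζ (y : ℝ) => (y : ℂ) * k y * cexp (-(w * y ^ 2) + ζ * y))
    (Metric.ball_mem_nhds s one_pos)
    (Eventually.of_forall fun ζ => hk.aesm_integrand ζ w) (hk.integrable_integrand s hw)
    (hk.mul_id.aesm_integrand s w) (Eventually.of_forall fun y ζ hζ => ?_) hg
    (Eventually.of_forall fun y ζ _ => ?_)).2
  · refine h ζ w ?_ le_rfl y
    have := norm_le_norm_add_norm_sub' ζ s
    rw [← dist_eq_norm] at this
    linarith [Metric.mem_ball.1 hζ]
  · have := ((((hasDerivAt_id ζ).mul_const (y : ℂ)).const_add (-(w * y ^ 2))).cexp).const_mul (k y)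
    refine this.congr_deriv ?_
    simp only [id]; ring

theorem GaussClass.hasDerivAt_lap_snd (hk : GaussClass α k) (s : ℂ) {w : ℂ} (hw : α < w.re) :
    HasDerivAt (fun ζ => lap k s ζ) (-lap (fun y => (y : ℂ) * ((y : ℂ) * k y)) s w) w := by
  set β := (α + w.re) / 2 with hβ
  have h1 : α < β := by rw [hβ]; linarith
  have h2 : β < w.re := by rw [hβ]; linarith
  -- Differentiation in `w` brings down `-y²`; `β` lies strictly between `α` and `Re w`, so one
  -- majorant serves the neighbourhood `Re ζ > β`.
  obtain ⟨g, hg, h⟩ := hk.mul_id.mul_id.exists_bound ‖s‖ h1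
  rw [lap, ← integral_neg]
  refine (hasDerivAt_integral_of_dominated_loc_of_deriv_le (s := {ζ : ℂ | β < ζ.re})
    (bound := g)
    (F' := fun ζ (y : ℝ) => -((y : ℂ) * ((y : ℂ) * k y) * cexp (-(ζ * y ^ 2) + s * y)))
    ((isOpen_lt continuous_const continuous_re).mem_nhds h2)
    (Eventually.of_forall fun ζ => hk.aesm_integrand s ζ) (hk.integrable_integrand s hw)
    (hk.mul_id.mul_id.aesm_integrand s w).neg (Eventually.of_forall fun y ζ hζ => ?_) hg
    (Eventually.of_forall fun y ζ _ => ?_)).2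
  · rw [norm_neg]
    exact h s ζ le_rfl (le_of_lt hζ) y
  · have := (((hasDerivAt_id ζ).mul_const ((y : ℂ) ^ 2)).neg.add_const (s * y : ℂ)).cexp.const_mul
      (k y)
    refine this.congr_deriv ?_
    simp only [id, Pi.neg_apply]; ring

theorem GaussClass.continuousOn_lap (hk : GaussClass α k) :
    ContinuousOn (fun p : ℂ × ℂ => lap k p.1 p.2) {p | α < p.2.re} := by
  intro p hp
  refine ContinuousAt.continuousWithinAt ?_
  set β := (α + p.2.re) / 2 with hβ
  have h1 : α < β := by rw [hβ]; linarith [show α < p.2.re from hp]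
  have h2 : β < p.2.re := by rw [hβ]; linarith [show α < p.2.re from hp]
  obtain ⟨g, hg, h⟩ := hk.exists_bound (‖p.1‖ + 1) h1
  have e1 : ∀ᶠ q : ℂ × ℂ in 𝓝 p, ‖q.1‖ < ‖p.1‖ + 1 :=
    (isOpen_lt (by fun_prop) continuous_const).mem_nhds (show ‖p.1‖ < ‖p.1‖ + 1 by linarith)
  have e2 : ∀ᶠ q : ℂ × ℂ in 𝓝 p, β < q.2.re :=
    (isOpen_lt continuous_const (continuous_re.comp continuous_snd)).mem_nhds h2
  refine continuousAt_of_dominated (bound := g)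
    (Eventually.of_forall fun q => hk.aesm_integrand q.1 q.2) ?_ hg
    (Eventually.of_forall fun y => ?_)
  · filter_upwards [e1, e2] with q hq1 hq2
    exact Eventually.of_forall (h q.1 q.2 hq1.le hq2.le)
  · exact Continuous.continuousAt (by fun_prop)

theorem isOpen_snd_re_gt (α : ℝ) : IsOpen {p : ℂ × ℂ | α < p.2.re} :=
  isOpen_lt continuous_const (continuous_re.comp continuous_snd)

/-- Differentiation under the integral gives holomorphy in each variable, dominated convergence
gives joint continuity, and the Osgood lemma combines them. -/
theorem GaussClass.analyticOnNhd_lap (hk : GaussClass α k) :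
    AnalyticOnNhd ℂ (fun p : ℂ × ℂ => lap k p.1 p.2) {p | α < p.2.re} :=
  analyticOnNhd_of_separately (isOpen_snd_re_gt α) hk.continuousOn_lap
    (fun p hp => (hk.hasDerivAt_lap_fst p.1 hp).differentiableAt)
    (fun p hp => (hk.hasDerivAt_lap_snd p.1 hp).differentiableAt)

theorem GaussClass.analyticAt_lap_comp (hk : GaussClass α k) {f g : ℂ × ℂ → ℂ} {p : ℂ × ℂ}
    (hf : AnalyticAt ℂ f p) (hg : AnalyticAt ℂ g p) (hp : α < (g p).re) :
    AnalyticAt ℂ (fun q => lap k (f q) (g q)) p :=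
  AnalyticAt.comp (g := fun p : ℂ × ℂ => lap k p.1 p.2) (f := fun q => (f q, g q))
    (hk.analyticOnNhd_lap (f p, g p) hp) (hf.prod hg)

end Lap

/-! ### The coherent state transform -/

section CoherentStates

variable {h2 hb m ω E : ℝ} {c : ℂ}

theorem memLp_two_gaussian {β : ℝ} (hβ : 0 < β) :
    MemLp (fun y : ℝ => Real.exp (-β * y ^ 2)) 2 volume := by
  rw [memLp_two_iff_integrable_sq (by fun_prop)]
  have := integrable_exp_neg_mul_sq (b := 2 * β) (by positivity)
  refine this.congr (Eventually.of_forall fun y => ?_)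
  simp only
  rw [← Real.exp_nat_mul]
  congr 1; push_cast; ring

/-- A Gaussian with any positive exponent is square integrable, so Hölder's inequality applies. -/
theorem gaussClass_of_memLp {k : ℝ → ℂ} (hk : MemLp k 2 volume) : GaussClass 0 k :=
  ⟨hk.1, fun _ hβ => hk.norm.integrable_mul (memLp_two_gaussian hβ)⟩

/-- The analytic profile of the coherent state transform of `k`. -/
noncomputable def cstProfile (h2 hb E : ℝ) (c : ℂ) (k : ℝ → ℂ) (p : ℂ × ℂ) : ℂ :=
  starRingEnd ℂ c * cexp (-(2 * Real.pi * h2 * (p.2 - E)))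
    * lap k (2 * Real.pi * I * hb * p.1) (Real.pi * hb * p.2)

/-- Expanding `(y - x₁)²` groups the exponent by powers of `y`: the quadratic terms with `E` and
`x₂` combine into `w`, the linear ones with `x₃` and `x₁` into `s`. -/
theorem cst_eq_expand (k : Lp ℂ 2 (volume : Measure ℝ)) :
    cst h2 hb (gaussianVec hb E c) k = expand hb E (cstProfile h2 hb E c k) := by
  funext x
  simp only [cst, expand, cstProfile, lap]
  rw [← integral_const_mul, ← integral_const_mul]
  congr 1
  funext y
  have e : starRingEnd ℂ (rep h2 hb (sec x) (gaussianVec hb E c) y) = starRingEnd ℂ c *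
      (cexp (-(2 * Real.pi * I * (h2 * x.2.1 + hb * (0 - x.2.2 * y + x.2.1 * y ^ 2 / 2))))
        * cexp (-(Real.pi * hb * E * (y - x.1) ^ 2))) := by
    simp only [rep, sec, gaussianVec, map_mul, ← Complex.exp_conj, ofReal_exp]
    have h2c : starRingEnd ℂ 2 = 2 := map_ofNat _ 2
    simp [h2c]
    ring
  have e2 : cexp (-(2 * Real.pi * I * (h2 * x.2.1 + hb * (0 - x.2.2 * y + x.2.1 * y ^ 2 / 2))))
        * cexp (-(Real.pi * hb * E * (y - x.1) ^ 2))
      = cexp (-(Real.pi * hb * E * x.1 ^ 2)) * (cexp (-(2 * Real.pi * h2 * ((cplx E x).2 - E)))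
        * cexp (-(Real.pi * hb * (cplx E x).2 * y ^ 2)
          + 2 * Real.pi * I * hb * (cplx E x).1 * y)) := by
    simp only [← Complex.exp_add, cplx]
    congr 1
    linear_combination (2 * Real.pi * hb * E * x.1 * y) * I_sq
  rw [e, e2]
  ring

theorem re_mul_pos (hhb : 0 < hb) {w : ℂ} (hw : 0 < w.re) : 0 < (Real.pi * hb * w : ℂ).re := by
  rw [← ofReal_mul, re_ofReal_mul]; exact mul_pos (mul_pos Real.pi_pos hhb) hw

theorem analyticAt_cstProfile (hhb : 0 < hb) {k : ℝ → ℂ} (hk : GaussClass 0 k) {p : ℂ × ℂ}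
    (hp : 0 < p.2.re) : AnalyticAt ℂ (cstProfile h2 hb E c k) p := by
  have h1 : AnalyticAt ℂ (fun q : ℂ × ℂ =>
      lap k (2 * Real.pi * I * hb * q.1) (Real.pi * hb * q.2)) p :=
    hk.analyticAt_lap_comp (analyticAt_const.mul analyticAt_fst)
      (analyticAt_const.mul analyticAt_snd) (re_mul_pos hhb hp)
  have h3 : AnalyticAt ℂ (fun q : ℂ × ℂ => -(2 * Real.pi * h2 * (q.2 - E))) p :=
    (analyticAt_const.mul (analyticAt_snd.sub analyticAt_const)).neg
  have h4 : AnalyticAt ℂ (fun q : ℂ × ℂ => starRingEnd ℂ c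
      * cexp (-(2 * Real.pi * h2 * (q.2 - E)))) p := analyticAt_const.mul h3.cexp
  exact h4.mul h1

theorem hasDerivAt_cstProfile_fst (hhb : 0 < hb) {k : ℝ → ℂ} (hk : GaussClass 0 k) (s : ℂ) {w : ℂ}
    (hw : 0 < w.re) : HasDerivAt (fun ζ => cstProfile h2 hb E c k (ζ, w))
      (2 * Real.pi * I * hb * cstProfile h2 hb E c (fun y => (y : ℂ) * k y) (s, w)) s := by
  have h := ((hk.hasDerivAt_lap_fst (2 * Real.pi * I * hb * s) (re_mul_pos hhb hw)).comp s
    ((hasDerivAt_id s).const_mul (2 * Real.pi * I * hb : ℂ))).const_mul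
    (starRingEnd ℂ c * cexp (-(2 * Real.pi * h2 * (w - E))))
  refine h.congr_deriv ?_
  simp only [cstProfile]
  ring

theorem hasDerivAt_cstProfile_snd (hhb : 0 < hb) {k : ℝ → ℂ} (hk : GaussClass 0 k) (s : ℂ) {w : ℂ}
    (hw : 0 < w.re) : HasDerivAt (fun ζ => cstProfile h2 hb E c k (s, ζ))
      (-(2 * Real.pi * h2) * cstProfile h2 hb E c k (s, w) - Real.pi * hb
        * cstProfile h2 hb E c (fun y => (y : ℂ) * ((y : ℂ) * k y)) (s, w)) w := by
  have h := ((((hasDerivAt_id w).sub_const (E : ℂ)).const_mul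
    (2 * Real.pi * h2 : ℂ)).neg.cexp.const_mul (starRingEnd ℂ c)).mul
    ((hk.hasDerivAt_lap_snd (2 * Real.pi * I * hb * s) (re_mul_pos hhb hw)).comp w
    ((hasDerivAt_id w).const_mul (Real.pi * hb : ℂ)))
  refine h.congr_deriv ?_
  simp only [cstProfile, id, Pi.neg_apply, Function.comp]
  ring

theorem contDiff_expand_cstProfile (hhb : 0 < hb) (hE : 0 < E) {k : ℝ → ℂ} (hk : GaussClass 0 k)
    {n : WithTop ℕ∞} : ContDiff ℝ n (expand hb E (cstProfile h2 hb E c k)) :=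
  contDiff_iff_contDiffAt.2 fun _ =>
    contDiffAt_expand (analyticAt_cstProfile hhb hk (cplx_snd_re.symm ▸ hE))

/-- Two `s`-derivatives bring down `(2πiħ)² y²` and `-4πħ ∂_w` brings down `4π²ħ² y²`, which cancel
under the integral; the factor `exp(-2πh₂(w - E))` accounts for the constant term of `S`. -/
theorem opS_expand_cstProfile (hhb : 0 < hb) (hE : 0 < E) {k : ℝ → ℂ} (hk : GaussClass 0 k)
    (x : Pt) : opS h2 hb (expand hb E (cstProfile h2 hb E c k)) x = 0 := by
  have hre : 0 < (cplx E x).2.re := cplx_snd_re.symm ▸ hE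
  rw [opS_expand (analyticAt_cstProfile hhb hk hre)]
  generalize cplx E x = p at *
  obtain ⟨s, w⟩ := p
  have hw : 0 < w.re := hre
  have e1 : (fun ζ => pd1 (cstProfile h2 hb E c k) (ζ, w)) = fun ζ =>
      2 * Real.pi * I * hb * cstProfile h2 hb E c (fun y => (y : ℂ) * k y) (ζ, w) := by
    funext ζ; exact (hasDerivAt_cstProfile_fst hhb hk ζ hw).deriv
  have e2 : pd1 (pd1 (cstProfile h2 hb E c k)) (s, w) = 2 * Real.pi * I * hb *
      (2 * Real.pi * I * hb
        * cstProfile h2 hb E c (fun y => (y : ℂ) * ((y : ℂ) * k y)) (s, w)) := by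
    show deriv (fun ζ => pd1 (cstProfile h2 hb E c k) (ζ, w)) s = _
    rw [e1]
    exact ((hasDerivAt_cstProfile_fst hhb hk.mul_id s hw).const_mul _).deriv
  have e3 : pd2 (cstProfile h2 hb E c k) (s, w) = _ := (hasDerivAt_cstProfile_snd hhb hk s hw).deriv
  rw [e2, e3]
  linear_combination (cexp (-(Real.pi * hb * E * x.1 ^ 2)) * (4 * Real.pi ^ 2 * hb ^ 2
    * cstProfile h2 hb E c (fun y => (y : ℂ) * ((y : ℂ) * k y)) (s, w))) * I_sq

theorem imageSpace_properties (hhb : 0 < hb) (hE : 0 < E) {F : Pt → ℂ}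
    (hF : F ∈ imageSpace h2 hb (gaussianVec hb E c)) :
    ContDiff ℝ ((⊤ : ℕ∞) : WithTop ℕ∞) F ∧ (∀ x, opC hb E F x = 0) ∧ (∀ x, opS h2 hb F x = 0) := by
  obtain ⟨k, rfl⟩ := hF
  have hk := gaussClass_of_memLp (Lp.memLp k)
  rw [cst_eq_expand]
  exact ⟨contDiff_expand_cstProfile hhb hE hk,
    fun x => opC_expand (analyticAt_cstProfile hhb hk (cplx_snd_re.symm ▸ hE)),
    opS_expand_cstProfile hhb hE hk⟩

theorem redHam_eq_ham_of_mem_imageSpace (hhb : 0 < hb) (hm : 0 < m) (hE : 0 < E) {F : Pt → ℂ}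
    (hF : F ∈ imageSpace h2 hb (gaussianVec hb E c)) (x : Pt) :
    redHam h2 hb m ω E F x = ham hb m ω F x := by
  obtain ⟨h1, hC, hS⟩ := imageSpace_properties hhb hE hF
  rw [redHam_eq_ham_of_eventually hm.ne' (h1.contDiffAt.of_le (WithTop.coe_le_coe.2 (le_top : (2 : ℕ∞) ≤ ⊤)))
    (Eventually.of_forall hC), hS, mul_zero, add_zero]

theorem solves_ham_iff_solves_redHam (hhb : 0 < hb) (hm : 0 < m) (hE : 0 < E) {f : ℝ → Pt → ℂ}
    (hf : ∀ t, f t ∈ imageSpace h2 hb (gaussianVec hb E c)) (Ω : Set Pt) :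
    Solves hb (ham hb m ω) Ω f ↔ Solves hb (redHam h2 hb m ω E) Ω f := by
  simp only [Solves, redHam_eq_ham_of_mem_imageSpace hhb hm hE (hf _)]

end CoherentStates

/-! ### Transport along holomorphic families -/

section Transport

variable {S : Set ℂ} {K : ℝ → ℂ → ℂ}

theorem continuousAt_family (hS : IsOpen S)
    (hK : ContinuousOn (fun p : ℝ × ℂ => K p.1 p.2) (Set.univ ×ˢ S)) (t : ℝ) {θ : ℂ} (hθ : θ ∈ S) :
    ContinuousAt (fun p : ℝ × ℂ => K p.1 p.2) (t, θ) :=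
  hK.continuousAt ((isOpen_univ.prod hS).mem_nhds ⟨trivial, hθ⟩)

/-- The derivatives of a jointly continuous family of holomorphic functions are jointly
continuous. -/
theorem continuousOn_deriv_family (hS : IsOpen S)
    (hK : ContinuousOn (fun p : ℝ × ℂ => K p.1 p.2) (Set.univ ×ˢ S))
    (hd : ∀ t, DifferentiableOn ℂ (K t) S) :
    ContinuousOn (fun p : ℝ × ℂ => deriv (K p.1) p.2) (Set.univ ×ˢ S) := by
  rintro ⟨t, θ⟩ ⟨-, hθ⟩
  refine ContinuousAt.continuousWithinAt ?_
  -- Joint continuity makes the holomorphic functions `K t` vary locally uniformly with `t`, and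
  -- locally uniform limits may be differentiated. The filter is taken at `(t, θ)` so that the base
  -- point can move together with `t`.
  have hunif : TendstoLocallyUniformlyOn (fun p : ℝ × ℂ => K p.1) (K t) (𝓝 (t, θ)) S := by
    rw [Metric.tendstoLocallyUniformlyOn_iff]
    intro ε hε η hη
    have h1 := continuousAt_family hS hK t hη
    have h2 : ∀ᶠ p : ℝ × ℂ in 𝓝 (t, η), dist (K p.1 p.2) (K t η) < ε / 2 :=
      Metric.tendsto_nhds.1 h1 _ (half_pos hε)
    rw [nhds_prod_eq] at h2
    obtain ⟨U, hU, W, hW, hUW⟩ := Filter.eventually_prod_iff.1 h2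
    refine ⟨{y | W y}, mem_nhdsWithin_of_mem_nhds hW, ?_⟩
    have hUt : U t := hU.self_of_nhds
    have hfst : Tendsto Prod.fst (𝓝 (t, θ)) (𝓝 t) := continuous_fst.tendsto' _ _ rfl
    refine (hfst.eventually hU).mono fun p hp y hy => ?_
    calc dist (K t y) (K p.1 y) ≤ dist (K t y) (K t η) + dist (K p.1 y) (K t η) :=
          dist_triangle_right _ _ _
      _ < ε / 2 + ε / 2 := add_lt_add (hUW hUt hy) (hUW hp hy)
      _ = ε := add_halves ε
  have h1 := hunif.deriv (Eventually.of_forall fun p => hd p.1) hS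
  have h2 : ContinuousAt (deriv (K t)) θ :=
    (((hd t).analyticAt (hS.mem_nhds hθ)).deriv).continuousAt
  exact tendsto_comp_of_locally_uniform_limit (F := fun p : ℝ × ℂ => deriv (K p.1))
    (g := Prod.snd) h2 (continuous_snd.tendsto' _ _ rfl) fun u hu => by
      obtain ⟨T, hT, h⟩ := h1 u hu θ hθ
      rw [hS.nhdsWithin_eq hθ] at hT
      exact ⟨T, hT, h⟩

theorem continuous_slice (hK : ContinuousOn (fun p : ℝ × ℂ => K p.1 p.2) (Set.univ ×ˢ S))
    {θ : ℂ} (hθ : θ ∈ S) : Continuous fun t => K t θ :=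
  hK.comp_continuous (f := fun t : ℝ => (t, θ)) (by fun_prop) fun _ => ⟨trivial, hθ⟩

/-- Integrals over the parameter of a jointly continuous family of holomorphic functions are
holomorphic. -/
theorem differentiableOn_integral_family (hS : IsOpen S)
    (hK : ContinuousOn (fun p : ℝ × ℂ => K p.1 p.2) (Set.univ ×ˢ S))
    (hd : ∀ t, DifferentiableOn ℂ (K t) S) (a b : ℝ) :
    DifferentiableOn ℂ (fun θ => ∫ τ in a..b, K τ θ) S := by
  intro θ hθ
  have hK' := continuousOn_deriv_family hS hK hd
  obtain ⟨r, hr, hsub⟩ := Metric.nhds_basis_closedBall.mem_iff.1 (hS.mem_nhds hθ)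
  obtain ⟨C, hC⟩ := (isCompact_uIcc (a := a) (b := b)).prod (isCompact_closedBall θ r)
    |>.exists_bound_of_continuousOn (hK'.mono (Set.prod_mono (Set.subset_univ _) hsub))
  have hmem : ∀ η ∈ Metric.ball θ r, η ∈ S := fun η hη => hsub (Metric.ball_subset_closedBall hη)
  refine (intervalIntegral.hasDerivAt_integral_of_dominated_loc_of_deriv_le
    (F := fun η τ => K τ η) (F' := fun η τ => deriv (K τ) η) (bound := fun _ => C)
    (Metric.ball_mem_nhds θ hr) ?_ ((continuous_slice hK hθ).intervalIntegrable _ _)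
    (continuous_slice hK' hθ).aestronglyMeasurable ?_ (by simp) ?_).2.differentiableAt.differentiableWithinAt
  · exact eventually_of_mem (Metric.ball_mem_nhds θ hr) fun η hη =>
      (continuous_slice hK (hmem η hη)).aestronglyMeasurable
  · exact Eventually.of_forall fun τ hτ η hη =>
      hC (τ, η) ⟨Set.uIoc_subset_uIcc hτ, Metric.ball_subset_closedBall hη⟩
  · exact Eventually.of_forall fun τ _ η hη =>
      ((hd τ).differentiableAt (hS.mem_nhds (hmem η hη))).hasDerivAt

/-- If a family of holomorphic functions satisfies the transport equation on an accumulating set of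
points, then it satisfies the equation everywhere. -/
theorem hasDerivAt_family_of_frequently (hS : IsOpen S) (hSc : IsPreconnected S)
    (hK : ContinuousOn (fun p : ℝ × ℂ => K p.1 p.2) (Set.univ ×ˢ S))
    (hd : ∀ t, DifferentiableOn ℂ (K t) S) {θ₀ : ℂ} (hθ₀ : θ₀ ∈ S)
    (hΓ : ∃ᶠ θ in 𝓝[≠] θ₀, θ ∈ S ∧ ∀ t, HasDerivAt (fun τ : ℝ => K τ θ) (-deriv (K t) θ) t)
    {θ : ℂ} (hθ : θ ∈ S) (t : ℝ) : HasDerivAt (fun τ : ℝ => K τ θ) (-deriv (K t) θ) t := by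
  have hK' := continuousOn_deriv_family hS hK hd
  have hd' : ∀ t, DifferentiableOn ℂ (deriv (K t)) S := fun t => (hd t).deriv hS
  -- Away from the given points no differentiability in time is known. The time-integrated equation
  -- needs none, and it is holomorphic in `η`, so the identity theorem applies; the differential
  -- form is recovered from it afterwards.
  have key : ∀ T : ℝ, ∀ η ∈ S, K T η - K 0 η + ∫ τ in (0 : ℝ)..T, deriv (K τ) η = 0 := by
    intro T
    have hA : DifferentiableOn ℂ
        (fun η => K T η - K 0 η + ∫ τ in (0 : ℝ)..T, deriv (K τ) η) S :=
      ((hd T).sub (hd 0)).add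
        (differentiableOn_integral_family (K := fun t => deriv (K t)) hS hK' hd' 0 T)
    refine fun η hη => (hA.analyticOnNhd hS).eqOn_zero_of_preconnected_of_frequently_eq_zero
      hSc hθ₀ (hΓ.mono fun ξ hξ => ?_) hη
    have hc : Continuous fun τ => -deriv (K τ) ξ :=
      (continuous_slice (K := fun t => deriv (K t)) hK' hξ.1).neg
    have := intervalIntegral.integral_eq_sub_of_hasDerivAt (a := 0) (b := T)
      (fun τ _ => hξ.2 τ) (hc.intervalIntegrable _ _)
    rw [intervalIntegral.integral_neg] at this
    linear_combination -this
  have hc : Continuous fun τ => deriv (K τ) θ :=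
    continuous_slice (K := fun t => deriv (K t)) hK' hθ
  have h := ((intervalIntegral.integral_hasDerivAt_right (hc.intervalIntegrable 0 t)
    (hc.stronglyMeasurableAtFilter _ _) hc.continuousAt).fun_neg).const_add (K 0 θ)
  refine h.congr_of_eventuallyEq (Eventually.of_forall fun τ => ?_)
  linear_combination key τ θ hθ

/-- The solution of the transport equation. -/
theorem transport_family (hS : IsOpen S)
    (hSt : ∀ θ ∈ S, ∀ t : ℝ, θ + t ∈ S)
    (hK : ContinuousOn (fun p : ℝ × ℂ => K p.1 p.2) (Set.univ ×ˢ S))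
    (hd : ∀ t, DifferentiableOn ℂ (K t) S)
    (hΓ : ∀ θ ∈ S, ∀ t, HasDerivAt (fun τ : ℝ => K τ θ) (-deriv (K t) θ) t)
    {θ : ℂ} (hθ : θ ∈ S) (t : ℝ) : K t (θ + t) = K 0 θ := by
  have hK' := continuousOn_deriv_family hS hK hd
  have hder : ∀ τ : ℝ, HasDerivAt (fun τ : ℝ => K τ (θ + τ)) 0 τ := by
    intro τ
    have hmem := hSt θ hθ τ
    have hn : ∀ᶠ v : ℝ × ℂ in 𝓝 (τ, θ + τ), v.2 ∈ S :=
      (continuous_snd.tendsto' (τ, θ + (τ : ℂ)) _ rfl).eventually (hS.mem_nhds hmem)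
    have hcd : ContinuousAt (fun p : ℝ × ℂ => deriv (K p.1) p.2) (τ, θ + τ) :=
      continuousAt_family (K := fun t => deriv (K t)) hS hK' τ hmem
    -- Both partial derivatives, real in `t` and complex in `θ`, are jointly continuous, so the
    -- family is differentiable in the pair. Along the characteristic `τ ↦ (τ, θ + τ)` the two
    -- contributions cancel.
    have h := hasStrictFDerivAt_uncurry_coprod (𝕜 := ℝ) (u := (τ, θ + (τ : ℂ))) (f := K)
      (f₁ := fun t η => ContinuousLinearMap.toSpanSingleton ℝ (-deriv (K t) η))
      (f₂ := fun t η => (ContinuousLinearMap.toSpanSingleton ℂ (deriv (K t) η)).restrictScalars ℝ)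
      (hn.mono fun v hv => (hΓ v.2 hv v.1).hasFDerivAt)
      (hn.mono fun v hv =>
        (((hd v.1).differentiableAt (hS.mem_nhds hv)).hasDerivAt.hasFDerivAt).restrictScalars ℝ)
      (((ContinuousLinearMap.toSpanSingletonCLE (𝕜 := ℝ) (E := ℂ)).continuous.continuousAt).comp
        hcd.neg)
      (((ContinuousLinearMap.restrictScalarsL ℂ ℂ ℂ ℝ ℝ).continuous.comp
        (ContinuousLinearMap.toSpanSingletonCLE (𝕜 := ℂ) (E := ℂ)).continuous).continuousAt.comp
        hcd)
    have hcurve : HasDerivAt (fun τ : ℝ => (τ, θ + (τ : ℂ))) ((1 : ℝ), (1 : ℂ)) τ :=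
      (hasDerivAt_id τ).prodMk ((hasDerivAt_id τ).ofReal_comp.const_add θ)
    have := HasFDerivAt.comp_hasDerivAt τ h.hasFDerivAt hcurve
    refine this.congr_deriv ?_
    simp [Function.HasUncurry.uncurry]
  have h := is_const_of_deriv_eq_zero (f := fun τ : ℝ => K τ (θ + τ))
    (fun τ => (hder τ).differentiableAt) (fun τ => (hder τ).deriv) t 0
  simpa using h

end Transport

/-! ### The general solution of the reduced equation -/

/-- The inverse of the map `(s, w) ↦ (z, u)`. -/
noncomputable def psi (m ω : ℝ) (q : ℂ × ℂ) : ℂ × ℂ :=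
  (q.1 * (m * ω * (1 - q.2) / (1 + q.2) + m * ω), m * ω * (1 - q.2) / (1 + q.2))

/-- The function of `(z, u)` associated with a profile. -/
noncomputable def unprofile (h2 hb m ω E : ℝ) (F : ℝ → ℂ × ℂ → ℂ) (t : ℝ) (q : ℂ × ℂ) : ℂ :=
  F t (psi m ω q) / pref h2 hb m ω E t (psi m ω q)

section General

variable {h2 hb m ω E : ℝ} {V : Set ℂ} {F : ℝ → ℂ × ℂ → ℂ}

theorem one_add_ne_zero_of_norm_lt {u : ℂ} (hu : ‖u‖ < 1) : 1 + u ≠ 0 := by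
  intro h
  rw [eq_neg_of_add_eq_zero_right h] at hu
  simp at hu

theorem psi_snd_re_pos (hmω : 0 < m * ω) {q : ℂ × ℂ} (hu : ‖q.2‖ < 1) : 0 < (psi m ω q).2.re := by
  have h0 := one_add_ne_zero_of_norm_lt hu
  have h1 : (psi m ω q).2 = ((m * ω : ℝ) : ℂ) * ((1 - q.2) / (1 + q.2)) := by
    simp only [psi]; push_cast; ring
  rw [h1, re_ofReal_mul]
  refine mul_pos hmω ?_
  rw [div_re, ← add_div]
  refine div_pos ?_ (normSq_pos.2 h0)
  have h2 : normSq q.2 < 1 := by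
    rw [normSq_eq_norm_sq]; nlinarith [norm_nonneg q.2]
  rw [normSq_apply] at h2
  simp
  nlinarith

theorem cayley_psi (hmω : 0 < m * ω) {q : ℂ × ℂ} (hu : ‖q.2‖ < 1) :
    cayley m ω (psi m ω q).2 = q.2 := by
  have h0 := one_add_ne_zero_of_norm_lt hu
  have h1 := slitPlane_ne_zero (add_mul_mem_slitPlane hmω (psi_snd_re_pos hmω hu))
  rw [add_comm] at h1
  rw [cayley, div_eq_iff h1]
  simp only [psi]
  field_simp
  ring

theorem norm_cayley_lt (hmω : 0 < m * ω) {w : ℂ} (hw : 0 < w.re) : ‖cayley m ω w‖ < 1 := by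
  have h1 := slitPlane_ne_zero (add_mul_mem_slitPlane hmω hw)
  rw [add_comm] at h1
  rw [cayley, norm_div, div_lt_one (norm_pos_iff.2 h1), ← ofReal_mul,
    ← sq_lt_sq₀ (norm_nonneg _) (norm_nonneg _), ← normSq_eq_norm_sq, ← normSq_eq_norm_sq,
    normSq_apply, normSq_apply]
  simp only [sub_re, sub_im, add_re, add_im, ofReal_re, ofReal_im]
  nlinarith

theorem psi_zuMap (hmω : 0 < m * ω) {p : ℂ × ℂ} (hw : 0 < p.2.re) :
    psi m ω (zuMap m ω 0 p) = p := by
  have h1 := slitPlane_ne_zero (add_mul_mem_slitPlane hmω hw)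
  have h1' : (m * ω + p.2 : ℂ) ≠ 0 := by rwa [add_comm]
  have h2 : (1 : ℂ) + cayley m ω p.2 ≠ 0 := one_add_ne_zero_of_norm_lt (norm_cayley_lt hmω hw)
  have h3 : (m * ω : ℂ) ≠ 0 := by exact_mod_cast hmω.ne'
  have e : m * ω * (1 - cayley m ω p.2) / (1 + cayley m ω p.2) = p.2 := by
    rw [div_eq_iff h2, cayley]
    field_simp
    ring
  ext
  · simp only [psi, zuMap, ofReal_zero, mul_zero, neg_zero, Complex.exp_zero, one_mul]
    rw [e, div_mul_cancel₀ _ h1]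
  · simp only [psi, zuMap, ofReal_zero, mul_zero, neg_zero, Complex.exp_zero, one_mul]
    exact e

theorem analyticAt_psi {q : ℂ × ℂ} (hu : ‖q.2‖ < 1) : AnalyticAt ℂ (psi m ω) q := by
  have h0 := one_add_ne_zero_of_norm_lt hu
  have h1 : AnalyticAt ℂ (fun q : ℂ × ℂ => m * ω * (1 - q.2) / (1 + q.2)) q :=
    (analyticAt_const.mul (analyticAt_const.sub analyticAt_snd)).div
      (analyticAt_const.add analyticAt_snd) h0
  exact (analyticAt_fst.mul (h1.add analyticAt_const)).prod h1

/-- The domain of the profiles over `V`. -/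
def profileDomain (m ω : ℝ) (V : Set ℂ) : Set (ℂ × ℂ) :=
  Set.univ ×ˢ {w : ℂ | 0 < w.re ∧ cayley m ω w ∈ V}

theorem psi_mem_profileDomain (hmω : 0 < m * ω) (hV : V ⊆ Metric.ball 0 1) {q : ℂ × ℂ}
    (hq : q.2 ∈ V) : psi m ω q ∈ profileDomain m ω V := by
  have hu : ‖q.2‖ < 1 := by simpa using hV hq
  refine ⟨trivial, psi_snd_re_pos hmω hu, ?_⟩
  rw [cayley_psi hmω hu]
  exact hq

theorem analyticOver_unprofile (hmω : 0 < m * ω) (hE : 0 < E) (hV : V ⊆ Metric.ball 0 1) {t : ℝ}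
    (hF : AnalyticOnNhd ℂ (F t) (profileDomain m ω V)) :
    AnalyticOver V (unprofile h2 hb m ω E F t) := by
  rintro q ⟨-, hq⟩
  have hu : ‖q.2‖ < 1 := by simpa using hV hq
  have h1 := analyticAt_psi (m := m) (ω := ω) hu
  have hre := psi_snd_re_pos hmω hu
  exact (AnalyticAt.comp (hF _ (psi_mem_profileDomain hmω hV hq)) h1).div
    (AnalyticAt.comp (analyticAt_pref hmω hre) h1) (pref_ne_zero hmω hE hre)

theorem continuousOn_unprofile (hmω : 0 < m * ω) (hE : 0 < E) (hV : V ⊆ Metric.ball 0 1)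
    (hF : ContinuousOn (fun p : ℝ × (ℂ × ℂ) => F p.1 p.2)
      (Set.univ ×ˢ profileDomain m ω V)) :
    ContinuousOn (fun p : ℝ × (ℂ × ℂ) => unprofile h2 hb m ω E F p.1 p.2)
      (Set.univ ×ˢ (Set.univ ×ˢ V)) := by
  have hnorm : ∀ p ∈ (Set.univ : Set ℝ) ×ˢ ((Set.univ : Set ℂ) ×ˢ V), ‖p.2.2‖ < 1 :=
    fun p hp => by simpa using hV hp.2.2
  have hpsi : ContinuousOn (fun p : ℝ × (ℂ × ℂ) => psi m ω p.2) (Set.univ ×ˢ (Set.univ ×ˢ V)) :=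
    fun p hp => (ContinuousAt.comp (g := psi m ω) (analyticAt_psi (hnorm p hp)).continuousAt
      continuous_snd.continuousAt).continuousWithinAt
  have hpref : ContinuousOn (fun p : ℝ × (ℂ × ℂ) => pref h2 hb m ω E p.1 (psi m ω p.2))
      (Set.univ ×ˢ (Set.univ ×ˢ V)) := by
    have e : (fun p : ℝ × (ℂ × ℂ) => pref h2 hb m ω E p.1 (psi m ω p.2)) = fun p =>
        cexp (-(I * ω / 2 * p.1)) * pref h2 hb m ω E 0 (psi m ω p.2) := by
      funext p; exact pref_time _
    rw [e]
    refine ContinuousOn.mul (by fun_prop) fun p hp => ?_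
    exact ContinuousAt.comp_continuousWithinAt (g := pref h2 hb m ω E 0)
      (analyticAt_pref hmω (psi_snd_re_pos hmω (hnorm p hp))).continuousAt (hpsi p hp)
  refine ContinuousOn.div ?_ hpref fun p hp =>
    pref_ne_zero hmω hE (psi_snd_re_pos hmω (hnorm p hp))
  exact hF.comp (f := fun p : ℝ × (ℂ × ℂ) => (p.1, psi m ω p.2)) (continuousOn_fst.prodMk hpsi)
    fun p hp => ⟨trivial, psi_mem_profileDomain hmω hV hp.2.2⟩

theorem profile_unprofile (hmω : 0 < m * ω) (hE : 0 < E) {p : ℂ × ℂ} (hw : 0 < p.2.re) (t : ℝ) :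
    F t p = pref h2 hb m ω E t p * unprofile h2 hb m ω E F t (zuMap m ω 0 p) := by
  rw [unprofile, psi_zuMap hmω hw, mul_div_cancel₀ _ (pref_ne_zero hmω hE hw)]

/-- At a frozen time any profile is the explicit formula at time `0` for its own `unprofile`, up to
a phase. The action of `H₁` on it can therefore be read off from the known solution. -/
theorem expand_eq_geomSol (hmω : 0 < m * ω) (hE : 0 < E) (t : ℝ) (x : Pt) :
    expand hb E (F t) x
      = cexp (-(I * ω / 2 * t)) * geomSol h2 hb m ω E (unprofile h2 hb m ω E F t) 0 x := by
  have hre : 0 < (cplx E x).2.re := cplx_snd_re.symm ▸ hE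
  rw [geomSol_eq_expand, expand, expand, profile,
    profile_unprofile (F := F) (h2 := h2) (hb := hb) hmω hE hre t, pref_time]
  ring

theorem redHam_const_mul {f : Pt → ℂ} {x : Pt} (a : ℂ) (hf : DifferentiableAt ℝ f x) :
    redHam h2 hb m ω E (fun y => a * f y) x = a * redHam h2 hb m ω E f x := by
  rw [redHam, redHam, d1_const_mul a hf, d2_const_mul a hf, d3_const_mul a hf]
  ring

/-- The transport equation satisfied by the transformed solution at the points of the region. -/
theorem hasDerivAt_unprofile (hhb : 0 < hb) (hm : 0 < m) (hω : 0 < ω) (hE : 0 < E)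
    (hV : IsRotDomain V) (hF : ∀ t, AnalyticOnNhd ℂ (F t) (profileDomain m ω V))
    {f : ℝ → Pt → ℂ} (hf : ∀ t, ∀ x ∈ region m ω E V, f t x = expand hb E (F t) x)
    (hsol : Solves hb (redHam h2 hb m ω E) (region m ω E V) f) {x : Pt} (hx : x ∈ region m ω E V)
    {q : ℂ × ℂ} (hq : zuMap m ω 0 (cplx E x) = q) (t : ℝ) :
    HasDerivAt (fun τ : ℝ => unprofile h2 hb m ω E F τ q)
      (-(I * ω * (q.1 * pd1 (unprofile h2 hb m ω E F t) q
        + 2 * q.2 * pd2 (unprofile h2 hb m ω E F t) q))) t := by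
  have hmω : 0 < m * ω := mul_pos hm hω
  have hre : 0 < (cplx E x).2.re := cplx_snd_re.symm ▸ hE
  have hhc : (hb : ℂ) ≠ 0 := ofReal_ne_zero.2 hhb.ne'
  set G := unprofile h2 hb m ω E F with hG
  have hGa : ∀ t, AnalyticOver V (G t) := fun t =>
    analyticOver_unprofile hmω hE hV.subset_disc (hF t)
  set A : ℂ := cexp (-(Real.pi * hb * E * x.1 ^ 2)) * pref h2 hb m ω E 0 (cplx E x) with hA
  have hA0 : A ≠ 0 := mul_ne_zero (Complex.exp_ne_zero _) (pref_ne_zero hmω hE hre)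
  have hAA : A⁻¹ * A = 1 := inv_mul_cancel₀ hA0
  have hgeo : ∀ τ, geomSol h2 hb m ω E (G τ) 0 x = A * G τ q := by
    intro τ
    rw [geomSol_eq_expand, expand, profile, hq, hA]; ring
  have hfx : ∀ τ, f τ x = cexp (-(I * ω / 2 * τ)) * (A * G τ q) := by
    intro τ
    rw [hf τ x hx, expand_eq_geomSol (h2 := h2) hmω hE, hgeo]
  obtain ⟨hd, he⟩ := hsol t x hx
  -- At a point of the region, `G τ q` is `f τ x` up to explicit non-zero factors, and thus inherits
  -- its differentiability in time.
  have hGτ : (fun τ : ℝ => G τ q) = fun τ : ℝ => A⁻¹ * (cexp (I * ω / 2 * τ) * f τ x) := by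
    funext τ
    have h1 : cexp (I * ω / 2 * τ) * cexp (-(I * ω / 2 * τ)) = 1 := by
      rw [← Complex.exp_add, add_neg_cancel, Complex.exp_zero]
    rw [hfx]
    linear_combination -(G τ q * A⁻¹ * A) * h1 - G τ q * hAA
  have hE1 : HasDerivAt (fun τ : ℝ => cexp (I * ω / 2 * τ))
      (cexp (I * ω / 2 * t) * (I * ω / 2 * 1)) t :=
    ((hasDerivAt_id t).ofReal_comp.const_mul (I * ω / 2)).cexp
  have hder := (hE1.mul hd.hasDerivAt).const_mul A⁻¹
  rw [hGτ]
  refine hder.congr_deriv ?_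
  have hev : f t =ᶠ[𝓝 x] fun y =>
      cexp (-(I * ω / 2 * t)) * geomSol h2 hb m ω E (G t) 0 y :=
    Filter.mem_of_superset ((isOpen_region hmω hE hV.isOpen).mem_nhds hx) fun y hy =>
      (hf t y hy).trans (expand_eq_geomSol hmω hE t y)
  have hgd : DifferentiableAt ℝ (geomSol h2 hb m ω E (G t) 0) x := by
    rw [geomSol_eq_expand]
    exact (contDiffAt_expand (n := 1)
      ((hGa t).analyticAt_profile hmω hE hV.rotate 0 hx)).differentiableAt (by simp)
  -- `H₁` applied to the frozen function is computed as `iħ` times the time derivative, at time `0`,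
  -- of the explicit solution with datum `G t`.
  have hs := (solves_redHam_geomSol (h2 := h2) (hb := hb) hm hω hE (hGa t) hV.rotate 0 x hx).2
  have hfun : (fun τ : ℝ => geomSol h2 hb m ω E (G t) τ x) = fun τ : ℝ =>
      cexp (-(Real.pi * hb * E * x.1 ^ 2)) * profile h2 hb m ω E (G t) τ (cplx E x) := by
    funext τ; rw [geomSol_eq_expand]; rfl
  have hdt := ((hasDerivAt_profile_time (h2 := h2) (hb := hb) (E := E) (t := 0)
    (s := (cplx E x).1) (w := (cplx E x).2)
    ((hGa t).analyticAt_zuMap hV.rotate 0 _ hx).differentiableAt).const_mul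
    (cexp (-(Real.pi * hb * E * x.1 ^ 2)))).deriv
  simp only [Prod.mk.eta] at hdt
  rw [hfun, hdt, hq] at hs
  rw [redHam_congr hev, redHam_const_mul _ hgd] at he
  have h1 : cexp (I * ω / 2 * t) * cexp (-(I * ω / 2 * t)) = 1 := by
    rw [← Complex.exp_add, add_neg_cancel, Complex.exp_zero]
  have hIh : I * hb ≠ 0 := mul_ne_zero I_ne_zero hhc
  have hdf : deriv (fun s => f s x) t = cexp (-(I * ω / 2 * t)) * (A * (-(I * ω / 2) * G t q
      - I * ω * (q.1 * pd1 (G t) q + 2 * q.2 * pd2 (G t) q))) := by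
    refine mul_left_cancel₀ hIh ?_
    linear_combination he - cexp (-(I * ω / 2 * t)) * hs
  rw [hdf, hfx]
  linear_combination (-(I * ω * (q.1 * pd1 (G t) q + 2 * q.2 * pd2 (G t) q))) * (A⁻¹ * A * h1 + hAA)

/-- The angular strip over a rotation invariant domain. -/
theorem isPreconnected_strip (hω : 0 < ω) (hV : IsRotDomain V) (u : ℂ) :
    IsPreconnected {θ : ℂ | cexp (2 * I * ω * θ) * u ∈ V} := by
  -- By rotation invariance, membership in `V` depends only on the modulus. The moduli form an
  -- interval, so the strip is the preimage of an interval under the imaginary part, hence convex.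
  have hmem : ∀ v : ℂ, v ∈ V ↔ ‖v‖ ∈ norm '' V := by
    intro v
    refine ⟨fun h => ⟨v, h, rfl⟩, ?_⟩
    rintro ⟨v', hv', h⟩
    have h1 := hV.rotate v' hv' (v.arg - v'.arg)
    have h2 : cexp (I * ((v.arg - v'.arg : ℝ) : ℂ)) * v' = v := by
      calc cexp (I * ((v.arg - v'.arg : ℝ) : ℂ)) * v'
          = cexp (I * ((v.arg - v'.arg : ℝ) : ℂ)) * (‖v'‖ * cexp (v'.arg * I)) := by
            rw [norm_mul_exp_arg_mul_I]
        _ = ‖v‖ * cexp (v.arg * I) := by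
            rw [h, mul_left_comm, ← Complex.exp_add]
            congr 2; push_cast; ring
        _ = v := norm_mul_exp_arg_mul_I v
    rwa [h2] at h1
  have hord : (norm '' V).OrdConnected :=
    (hV.isConnected.isPreconnected.image _ continuous_norm.continuousOn).ordConnected
  have hanti : Antitone fun y : ℝ => Real.exp (-(2 * ω * y)) * ‖u‖ := by
    intro a b hab
    have : -(2 * ω * b) ≤ -(2 * ω * a) := by nlinarith
    exact mul_le_mul_of_nonneg_right (Real.exp_le_exp.2 this) (norm_nonneg u)
  have e : {θ : ℂ | cexp (2 * I * ω * θ) * u ∈ V}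
      = imLm ⁻¹' ((fun y : ℝ => Real.exp (-(2 * ω * y)) * ‖u‖) ⁻¹' (norm '' V)) := by
    ext θ
    rw [Set.mem_ofPred_eq, hmem, norm_mul, Complex.norm_exp]
    have : (2 * I * ω * θ).re = -(2 * ω * θ.im) := by simp [mul_comm, mul_left_comm]
    rw [this]
    rfl
  rw [e]
  exact ((hord.preimage_anti hanti).convex.linear_preimage imLm).isPreconnected

/-- The angular coordinate along the arc `u(x₂)`. -/
theorem tendsto_angle (hmω : 0 < m * ω) (hω : ω ≠ 0) (hE : 0 < E) {r : ℝ}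
    (hu : cayley m ω (I * r + E) ≠ 0) :
    Tendsto (fun r' : ℝ => Complex.log (cayley m ω (I * r' + E) / cayley m ω (I * r + E))
      / (2 * I * ω)) (𝓝[≠] r) (𝓝[≠] 0) := by
  have hωc : (ω : ℂ) ≠ 0 := ofReal_ne_zero.2 hω
  have h2 : (2 * I * ω : ℂ) ≠ 0 := by simp [hωc]
  set u := cayley m ω (I * r + E) with hu_def
  have hq : Tendsto (fun r' : ℝ => cayley m ω (I * r' + E) / u) (𝓝 r) (𝓝 1) := by
    have := ((continuous_cayley_line hmω hE).tendsto r).div_const u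
    rwa [← hu_def, div_self hu] at this
  refine tendsto_nhdsWithin_iff.2 ⟨?_, ?_⟩
  · have h1 : Tendsto (fun r' : ℝ => Complex.log (cayley m ω (I * r' + E) / u) / (2 * I * ω)) (𝓝 r)
        (𝓝 (Complex.log 1 / (2 * I * ω))) :=
      ((continuousAt_clog one_mem_slitPlane).tendsto.comp hq).div_const _
    rw [Complex.log_one, zero_div] at h1
    exact h1.mono_left inf_le_left
  · have h3 : ∀ᶠ r' : ℝ in 𝓝[≠] r, cayley m ω (I * r' + E) / u ≠ 0 :=
      (hq.mono_left inf_le_left).eventually (isOpen_ne.mem_nhds one_ne_zero)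
    filter_upwards [h3, eventually_mem_nhdsWithin] with r' h3 h4 h5
    have h6 : Complex.log (cayley m ω (I * r' + E) / u) = 0 := by
      simpa [h2] using h5
    have h7 := Complex.exp_log h3
    rw [h6, Complex.exp_zero] at h7
    exact h4 (cayley_line_injective hmω hE ((div_eq_one_iff_eq hu).1 h7.symm))

/-- Along the complexified orbit `θ ↦ (exp(iωθ) z, exp(2iωθ) u)` the field `iω(z∂_z + 2u∂_u)` is
`d/dθ`, so the equation reads `∂ₜK = -∂_θK`. Nearby points of the arc correspond to complex angles
accumulating at `0`; this needs `u ≠ 0`, as the orbit of `u = 0` is constant in `u`. -/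
theorem unprofile_transport (hhb : 0 < hb) (hm : 0 < m) (hω : 0 < ω) (hE : 0 < E)
    (hV : IsRotDomain V)
    (hFc : ContinuousOn (fun p : ℝ × (ℂ × ℂ) => F p.1 p.2) (Set.univ ×ˢ profileDomain m ω V))
    (hF : ∀ t, AnalyticOnNhd ℂ (F t) (profileDomain m ω V))
    {f : ℝ → Pt → ℂ} (hf : ∀ t, ∀ x ∈ region m ω E V, f t x = expand hb E (F t) x)
    (hsol : Solves hb (redHam h2 hb m ω E) (region m ω E V) f) (z : ℂ) {r : ℝ}
    (hr : cayley m ω (I * r + E) ∈ V) (hr0 : cayley m ω (I * r + E) ≠ 0) (t : ℝ) :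
    unprofile h2 hb m ω E F t (z, cayley m ω (I * r + E))
      = unprofile h2 hb m ω E F 0 (cexp (-(I * ω * t)) * z,
        cexp (-(2 * I * ω * t)) * cayley m ω (I * r + E)) := by
  have hmω : 0 < m * ω := mul_pos hm hω
  have hωc : (ω : ℂ) ≠ 0 := ofReal_ne_zero.2 hω.ne'
  have h2I : (2 * I * ω : ℂ) ≠ 0 := by simp [hωc]
  set u := cayley m ω (I * r + E) with hu_def
  set G := unprofile h2 hb m ω E F with hG
  have hGa : ∀ t, AnalyticOver V (G t) := fun t =>
    analyticOver_unprofile hmω hE hV.subset_disc (hF t)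
  have hGc := continuousOn_unprofile (h2 := h2) (hb := hb) hmω hE hV.subset_disc hFc
  set S : Set ℂ := {θ : ℂ | cexp (2 * I * ω * θ) * u ∈ V} with hS_def
  let K : ℝ → ℂ → ℂ := fun t θ => G t (cexp (I * ω * θ) * z, cexp (2 * I * ω * θ) * u)
  have hS : IsOpen S := hV.isOpen.preimage (by fun_prop)
  have hSt : ∀ θ ∈ S, ∀ t : ℝ, θ + t ∈ S := by
    intro θ hθ t
    have := hV.rotate _ hθ (2 * ω * t)
    rw [← mul_assoc, ← Complex.exp_add] at this
    show cexp (2 * I * ω * (θ + t)) * u ∈ V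
    convert this using 3
    push_cast; ring
  have hKc : ContinuousOn (fun p : ℝ × ℂ => K p.1 p.2) (Set.univ ×ˢ S) :=
    hGc.comp (f := fun p : ℝ × ℂ => (p.1, (cexp (I * ω * p.2) * z, cexp (2 * I * ω * p.2) * u)))
      (by fun_prop) fun p hp => ⟨trivial, trivial, hp.2⟩
  have hKd : ∀ t, ∀ θ ∈ S, ∀ q : ℂ × ℂ, (cexp (I * ω * θ) * z, cexp (2 * I * ω * θ) * u) = q →
      HasDerivAt (K t) (I * ω * (q.1 * pd1 (G t) q + 2 * q.2 * pd2 (G t) q)) θ := by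
    intro t θ hθ q hq
    have ha : HasDerivAt (fun θ => cexp (I * ω * θ) * z) (cexp (I * ω * θ) * (I * ω * 1) * z) θ :=
      (((hasDerivAt_id θ).const_mul (I * ω : ℂ)).cexp).mul_const z
    have hb : HasDerivAt (fun θ => cexp (2 * I * ω * θ) * u)
        (cexp (2 * I * ω * θ) * (2 * I * ω * 1) * u) θ :=
      (((hasDerivAt_id θ).const_mul (2 * I * ω : ℂ)).cexp).mul_const u
    have hd : DifferentiableAt ℂ (G t) q := (hGa t q ⟨trivial, hq ▸ hθ⟩).differentiableAt
    refine (hasDerivAt_comp_pair hd ha hb hq).congr_deriv ?_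
    subst hq
    ring
  have hKdiff : ∀ t, DifferentiableOn ℂ (K t) S := fun t θ hθ =>
    (hKd t θ hθ _ rfl).differentiableAt.differentiableWithinAt
  have h0S : (0 : ℂ) ∈ S := by
    show cexp (2 * I * ω * 0) * u ∈ V
    simpa using hr
  have hΓ : ∃ᶠ θ in 𝓝[≠] (0 : ℂ), θ ∈ S ∧
      ∀ t, HasDerivAt (fun τ : ℝ => K τ θ) (-deriv (K t) θ) t := by
    refine (tendsto_angle hmω hω.ne' hE hr0).frequently
      ((eventually_cayley_line hmω hE hV.isOpen hr).mono fun r' hr' => ?_).frequently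
    set θ : ℂ := Complex.log (cayley m ω (I * r' + E) / u) / (2 * I * ω) with hθ
    have e : cexp (2 * I * ω * θ) * u = cayley m ω (I * r' + E) := by
      rw [hθ, mul_div_cancel₀ _ h2I, Complex.exp_log (div_ne_zero hr'.2 hr0), div_mul_cancel₀ _ hr0]
    have hθS : θ ∈ S := by
      show cexp (2 * I * ω * θ) * u ∈ V
      rw [e]; exact hr'.1
    refine ⟨hθS, fun t => ?_⟩
    -- A point of `G/Z` whose `(z, u)` is the orbit point with angle `θ`; there the equation for `f`
    -- can be used.
    obtain ⟨x, hx⟩ := exists_cplx_eq hE.ne' (cexp (I * ω * θ) * z * (I * r' + E + m * ω)) r'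
    have hx2 : (I * x.2.1 + E : ℂ) = I * r' + E := congrArg Prod.snd hx
    have hxr : x ∈ region m ω E V := by
      show cayley m ω (I * x.2.1 + E) ∈ V
      rw [hx2]; exact hr'.1
    have h0 := slitPlane_ne_zero
      (add_mul_mem_slitPlane hmω (show 0 < (I * r' + E : ℂ).re by simpa using hE))
    have hzu : zuMap m ω 0 (cplx E x) = (cexp (I * ω * θ) * z, cexp (2 * I * ω * θ) * u) := by
      rw [hx, e]
      simp [zuMap, mul_div_cancel_right₀ _ h0]
    have h := hasDerivAt_unprofile hhb hm hω hE hV hF hf hsol hxr hzu t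
    rw [(hKd t θ hθS _ rfl).deriv]
    exact h
  have htr : ∀ θ ∈ S, ∀ t, HasDerivAt (fun τ : ℝ => K τ θ) (-deriv (K t) θ) t := fun θ hθ t =>
    hasDerivAt_family_of_frequently hS (isPreconnected_strip hω hV u) hKc hKdiff h0S hΓ hθ t
  -- Starting the characteristic at `θ = -t` makes it reach the given point `θ = 0` at time `t`.
  have hmem : (-t : ℂ) ∈ S := by
    have := hSt 0 h0S (-t)
    simpa using this
  have h := transport_family hS hSt hKc hKdiff htr hmem t
  simp only [K, neg_add_cancel, mul_zero, Complex.exp_zero, one_mul, mul_neg] at h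
  exact h

/-- The explicit formula is the general solution of the reduced equation. -/
theorem exists_eq_geomSol (hhb : 0 < hb) (hm : 0 < m) (hω : 0 < ω) (hE : 0 < E)
    (hV : IsRotDomain V)
    (hFc : ContinuousOn (fun p : ℝ × (ℂ × ℂ) => F p.1 p.2) (Set.univ ×ˢ profileDomain m ω V))
    (hF : ∀ t, AnalyticOnNhd ℂ (F t) (profileDomain m ω V))
    {f : ℝ → Pt → ℂ} (hf : ∀ t, ∀ x ∈ region m ω E V, f t x = expand hb E (F t) x)
    (hsol : Solves hb (redHam h2 hb m ω E) (region m ω E V) f) :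
    ∃ f2 : ℂ × ℂ → ℂ, AnalyticOver V f2 ∧
      ∀ t : ℝ, ∀ x ∈ region m ω E V, f t x = geomSol h2 hb m ω E f2 t x := by
  have hmω : 0 < m * ω := mul_pos hm hω
  have hGa : ∀ t, AnalyticOver V (unprofile h2 hb m ω E F t) := fun t =>
    analyticOver_unprofile hmω hE hV.subset_disc (hF t)
  refine ⟨unprofile h2 hb m ω E F 0, hGa 0, fun t x hx => ?_⟩
  have key : ∀ z : ℂ, ∀ r : ℝ, cayley m ω (I * r + E) ∈ V →
      unprofile h2 hb m ω E F t (z, cayley m ω (I * r + E))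
      = unprofile h2 hb m ω E F 0 (cexp (-(I * ω * t)) * z,
        cexp (-(2 * I * ω * t)) * cayley m ω (I * r + E)) := by
    intro z r hr
    -- The value `u = 0`, where the angle is not available, is reached by continuity along the arc.
    have hc1 : ContinuousAt (fun u => unprofile h2 hb m ω E F t (z, u))
        (cayley m ω (I * r + E)) := ((hGa t).analyticOnNhd_slice z _ hr).continuousAt
    have hc2 : ContinuousAt (fun u => unprofile h2 hb m ω E F 0 (cexp (-(I * ω * t)) * z,
        cexp (-(2 * I * ω * t)) * u)) (cayley m ω (I * r + E)) :=
      ContinuousAt.comp (g := fun u => unprofile h2 hb m ω E F 0 (cexp (-(I * ω * t)) * z, u))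
        (((hGa 0).analyticOnNhd_slice _ _ (rotate_time_mem hV.rotate t hr)).continuousAt)
        (by fun_prop)
    have ht := (tendsto_cayley_line hmω hE r).mono_right inf_le_left
    refine tendsto_nhds_unique_of_eventuallyEq (hc1.tendsto.comp ht) (hc2.tendsto.comp ht) ?_
    exact (eventually_cayley_line hmω hE hV.isOpen hr).mono fun r' hr' =>
      unprofile_transport hhb hm hω hE hV hFc hF hf hsol z hr'.1 hr'.2 t
  have hre : 0 < (cplx E x).2.re := cplx_snd_re.symm ▸ hE
  have e0 : zuMap m ω 0 (cplx E x) = (zVar m ω E x, cayley m ω (I * x.2.1 + E)) := by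
    simp [zuMap, cplx, zVar]
  rw [hf t x hx, geomSol_eq_expand, expand, expand, profile,
    profile_unprofile (F := F) (h2 := h2) (hb := hb) hmω hE hre t, e0, key _ _ hx]
  rfl

end General

/-! ### The general solution on the image space -/

section ImageSpace

variable {h2 hb m ω E : ℝ} {c : ℂ}

/-- The transform is bounded on `L²`, locally uniformly in the parameters. -/
theorem exists_norm_lap_le (M : ℝ) {β : ℝ} (hβ : 0 < β) :
    ∃ C : ℝ, ∀ (k : Lp ℂ 2 (volume : Measure ℝ)) (s w : ℂ), ‖s‖ ≤ M → β ≤ w.re →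
      ‖lap k s w‖ ≤ C * ‖k‖ := by
  have hγ : MemLp (fun y : ℝ => Real.exp (-(β / 2) * y ^ 2)) 2 volume :=
    memLp_two_gaussian (half_pos hβ)
  set D := Real.exp (M ^ 2 / (4 * (β - β / 2))) with hD
  refine ⟨D * ‖hγ.toLp‖, fun k s w hs hw => ?_⟩
  have hbd : ∀ y : ℝ, ‖starRingEnd ℂ (cexp (-(w * y ^ 2) + s * y))‖
      ≤ D * ‖Real.exp (-(β / 2) * y ^ 2)‖ := fun y => by
    rw [RCLike.norm_conj, Real.norm_of_nonneg (Real.exp_nonneg _)]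
    exact norm_cexp_kernel_le hs hw (half_lt_self hβ) y
  have hκ : MemLp (fun y : ℝ => starRingEnd ℂ (cexp (-(w * y ^ 2) + s * y))) 2 volume :=
    hγ.of_le_mul (Continuous.aestronglyMeasurable (by fun_prop)) (Eventually.of_forall hbd)
  -- The transform is an inner product with the conjugate kernel, so the bound is Cauchy–Schwarz.
  have e : lap k s w = inner ℂ hκ.toLp k := by
    rw [L2.inner_def, lap]
    refine integral_congr_ae ?_
    filter_upwards [hκ.coeFn_toLp] with y hy
    rw [hy]
    simp
  have hn : ‖hκ.toLp‖ ≤ D * ‖hγ.toLp‖ := by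
    refine Lp.norm_le_mul_norm_of_ae_le_mul ?_
    filter_upwards [hκ.coeFn_toLp, hγ.coeFn_toLp] with y hy hy'
    rw [hy, hy']
    exact hbd y
  rw [e]
  exact (norm_inner_le_norm _ _).trans (mul_le_mul_of_nonneg_right hn (norm_nonneg _))

theorem lap_sub_of_lp (k k' : Lp ℂ 2 (volume : Measure ℝ)) (s : ℂ) {w : ℂ} (hw : 0 < w.re) :
    lap (k - k' : Lp ℂ 2 (volume : Measure ℝ)) s w = lap k s w - lap k' s w := by
  rw [lap, lap, lap, ← integral_sub
    ((gaussClass_of_memLp (Lp.memLp k)).integrable_integrand s hw)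
    ((gaussClass_of_memLp (Lp.memLp k')).integrable_integrand s hw)]
  refine integral_congr_ae ?_
  filter_upwards [Lp.coeFn_sub k k'] with y hy
  rw [hy, Pi.sub_apply, sub_mul]

/-- The difference `k q.1 - k p.1` contributes little, by the locally uniform bound in the `L²`
norm; what remains is the transform of the fixed function `k p.1`. -/
theorem continuousOn_lap_lp {k : ℝ → Lp ℂ 2 (volume : Measure ℝ)} (hk : Continuous k) :
    ContinuousOn (fun p : ℝ × (ℂ × ℂ) => lap (k p.1) p.2.1 p.2.2)
      {p | 0 < p.2.2.re} := by
  intro p hp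
  refine ContinuousAt.continuousWithinAt ?_
  have hp' : 0 < p.2.2.re := hp
  obtain ⟨C, hC⟩ := exists_norm_lap_le (‖p.2.1‖ + 1) (half_pos hp')
  have e1 : ∀ᶠ q : ℝ × (ℂ × ℂ) in 𝓝 p, ‖q.2.1‖ < ‖p.2.1‖ + 1 :=
    (isOpen_lt (by fun_prop) continuous_const).mem_nhds
      (show ‖p.2.1‖ < ‖p.2.1‖ + 1 by linarith)
  have e2 : ∀ᶠ q : ℝ × (ℂ × ℂ) in 𝓝 p, p.2.2.re / 2 < q.2.2.re :=
    (isOpen_lt continuous_const (continuous_re.comp (continuous_snd.comp continuous_snd))).mem_nhds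
      (half_lt_self hp')
  have h1 : Tendsto (fun q : ℝ × (ℂ × ℂ) => lap (k q.1 - k p.1 : Lp ℂ 2 (volume : Measure ℝ))
      q.2.1 q.2.2) (𝓝 p) (𝓝 0) := by
    have h0 : Tendsto (fun q : ℝ × (ℂ × ℂ) => C * ‖k q.1 - k p.1‖) (𝓝 p) (𝓝 0) := by
      have : Continuous fun q : ℝ × (ℂ × ℂ) => C * ‖k q.1 - k p.1‖ := by fun_prop
      simpa using this.tendsto p
    refine squeeze_zero_norm' ?_ h0
    filter_upwards [e1, e2] with q h3 h4
    exact hC _ _ _ h3.le h4.le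
  have h2 : ContinuousAt (fun q : ℝ × (ℂ × ℂ) => lap (k p.1) q.2.1 q.2.2) p :=
    ContinuousAt.comp (g := fun q : ℂ × ℂ => lap (k p.1) q.1 q.2)
      (((gaussClass_of_memLp (Lp.memLp (k p.1))).continuousOn_lap).continuousAt
        ((isOpen_snd_re_gt 0).mem_nhds hp')) continuous_snd.continuousAt
  have h3 := h1.add h2.tendsto
  rw [zero_add] at h3
  refine h3.congr' (e2.mono fun q hq => ?_)
  have hq' : 0 < q.2.2.re := (half_pos hp').trans hq
  simp only
  rw [lap_sub_of_lp _ _ _ hq', sub_add_cancel]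

theorem continuousOn_cstProfile (hhb : 0 < hb) {k : ℝ → Lp ℂ 2 (volume : Measure ℝ)}
    (hk : Continuous k) :
    ContinuousOn (fun p : ℝ × (ℂ × ℂ) => cstProfile h2 hb E c (k p.1) p.2) {p | 0 < p.2.2.re} := by
  have h1 : ContinuousOn (fun p : ℝ × (ℂ × ℂ) =>
      lap (k p.1) (2 * Real.pi * I * hb * p.2.1) (Real.pi * hb * p.2.2)) {p | 0 < p.2.2.re} :=
    (continuousOn_lap_lp hk).comp
      (f := fun p : ℝ × (ℂ × ℂ) => (p.1, 2 * Real.pi * I * hb * p.2.1, Real.pi * hb * p.2.2))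
      (by fun_prop) fun p hp => re_mul_pos hhb hp
  exact ContinuousOn.mul (by fun_prop) h1

theorem isRotDomain_ball {r : ℝ} (hr : 0 < r) (hr1 : r ≤ 1) : IsRotDomain (Metric.ball (0 : ℂ) r) where
  isOpen := Metric.isOpen_ball
  isConnected := ((convex_ball _ _).isConnected ⟨0, Metric.mem_ball_self hr⟩)
  subset_disc := Metric.ball_subset_ball hr1
  rotate := fun u hu θ => by
    rw [mem_ball_zero_iff] at hu ⊢
    rwa [norm_mul, mul_comm I, norm_exp_ofReal_mul_I, one_mul]

theorem mem_region_ball (hmω : 0 < m * ω) (hE : 0 < E) (x : Pt) :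
    x ∈ region m ω E (Metric.ball 0 1) := by
  show cayley m ω (I * x.2.1 + E) ∈ Metric.ball (0 : ℂ) 1
  rw [mem_ball_zero_iff]
  exact norm_cayley_lt hmω (by simpa using hE)

theorem region_ball_eq_univ (hmω : 0 < m * ω) (hE : 0 < E) :
    region m ω E (Metric.ball 0 1) = Set.univ :=
  Set.eq_univ_of_forall (mem_region_ball hmω hE)

/-- Every initial datum in the image space is attained by an explicit solution. -/
theorem exists_geomSol_initial (hhb : 0 < hb) (hm : 0 < m) (hω : 0 < ω) (hE : 0 < E)
    (k : Lp ℂ 2 (volume : Measure ℝ)) : ∃ f2 : ℂ × ℂ → ℂ,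
      AnalyticOver (Metric.ball 0 1) f2 ∧ HeatLike hb m ω (Metric.ball 0 1) f2 ∧
      (∀ x : Pt, geomSol h2 hb m ω E f2 0 x = cst h2 hb (gaussianVec hb E c) k x) ∧
      Solves hb (ham hb m ω) Set.univ (geomSol h2 hb m ω E f2) := by
  have hmω : 0 < m * ω := mul_pos hm hω
  have hk := gaussClass_of_memLp (Lp.memLp k)
  have hV := isRotDomain_ball one_pos le_rfl
  -- At time `0` the map from `f₂` to profiles is invertible, so `f₂` is forced by the datum; it
  -- satisfies the heat equation because the datum is annihilated by `S`.
  set f2 := unprofile h2 hb m ω E (fun _ => cstProfile h2 hb E c k) 0 with hf2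
  have ha : AnalyticOver (Metric.ball 0 1) f2 :=
    analyticOver_unprofile hmω hE hV.subset_disc fun p hp => analyticAt_cstProfile hhb hk hp.2.1
  have h0 : geomSol h2 hb m ω E f2 0 = cst h2 hb (gaussianVec hb E c) k := by
    rw [cst_eq_expand]
    funext x
    have := expand_eq_geomSol (h2 := h2) (hb := hb) (F := fun _ => cstProfile h2 hb E c k) hmω hE 0 x
    simpa using this.symm
  have hheat : HeatLike hb m ω (Metric.ball 0 1) f2 := by
    refine heatLike_of_opS (h2 := h2) hhb hm hω hE hV ⟨0, mem_region_ball hmω hE 0⟩ ha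
      fun x _ _ => ?_
    rw [h0]
    exact (imageSpace_properties hhb hE ⟨k, rfl⟩).2.2 x
  refine ⟨f2, ha, hheat, fun x => congrFun h0 x, ?_⟩
  rw [← region_ball_eq_univ hmω hE]
  exact solves_ham_geomSol hhb hm hω hE hV.isOpen ha hV.rotate hheat

/-- On the image space `H` and `H₁` agree, so the general solution of the reduced equation applies.
Continuity of `t ↦ k t` in `L²` supplies the joint continuity of profiles that it requires, and `S`
at time `0` gives the heat equation. -/
theorem solves_ham_cst_iff (hhb : 0 < hb) (hm : 0 < m) (hω : 0 < ω) (hE : 0 < E)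
    {k : ℝ → Lp ℂ 2 (volume : Measure ℝ)} (hk : Continuous k) :
    Solves hb (ham hb m ω) Set.univ (fun t => cst h2 hb (gaussianVec hb E c) (k t)) ↔
      ∃ f2 : ℂ × ℂ → ℂ,
        AnalyticOver (Metric.ball 0 1) f2 ∧ HeatLike hb m ω (Metric.ball 0 1) f2 ∧
        ∀ (t : ℝ) (x : Pt), cst h2 hb (gaussianVec hb E c) (k t) x
          = geomSol h2 hb m ω E f2 t x := by
  have hmω : 0 < m * ω := mul_pos hm hω
  have hV := isRotDomain_ball one_pos le_rfl
  constructor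
  · intro h
    rw [solves_ham_iff_solves_redHam (c := c) hhb hm hE (fun t => ⟨k t, rfl⟩),
      ← region_ball_eq_univ hmω hE] at h
    have hFc : ContinuousOn (fun p : ℝ × (ℂ × ℂ) => cstProfile h2 hb E c (k p.1) p.2)
        (Set.univ ×ˢ profileDomain m ω (Metric.ball 0 1)) :=
      (continuousOn_cstProfile hhb hk).mono fun p hp => hp.2.2.1
    obtain ⟨f2, ha, hf⟩ := exists_eq_geomSol hhb hm hω hE hV
      (F := fun t => cstProfile h2 hb E c (k t)) hFc
      (fun t p hp => analyticAt_cstProfile hhb (gaussClass_of_memLp (Lp.memLp (k t))) hp.2.1)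
      (fun t x _ => congrFun (cst_eq_expand (k t)) x) h
    refine ⟨f2, ha, ?_, fun t x => hf t x (mem_region_ball hmω hE x)⟩
    refine heatLike_of_opS (h2 := h2) hhb hm hω hE hV ⟨0, mem_region_ball hmω hE 0⟩ ha
      fun x _ _ => ?_
    have : geomSol h2 hb m ω E f2 0 = cst h2 hb (gaussianVec hb E c) (k 0) :=
      funext fun x => (hf 0 x (mem_region_ball hmω hE x)).symm
    rw [this]
    exact (imageSpace_properties hhb hE ⟨k 0, rfl⟩).2.2 x
  · rintro ⟨f2, ha, hheat, hf⟩
    have : (fun t => cst h2 hb (gaussianVec hb E c) (k t)) = geomSol h2 hb m ω E f2 :=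
      funext fun t => funext fun x => hf t x
    rw [this, ← region_ball_eq_univ hmω hE]
    exact solves_ham_geomSol hhb hm hω hE hV.isOpen ha hV.rotate hheat

end ImageSpace

/-! ### Gaussian moments -/

section Moments

theorem gaussClass_pow (n : ℕ) : GaussClass 0 fun y : ℝ => (y : ℂ) ^ n := by
  induction n with
  | zero =>
    refine ⟨Continuous.aestronglyMeasurable (by fun_prop), fun β hβ => ?_⟩
    simpa using integrable_exp_neg_mul_sq hβ
  | succ n ih => simpa only [pow_succ'] using ih.mul_id

/-- The coefficients `(2n)! / (4ⁿ n!)` of the Gaussian moments of even order. -/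
noncomputable def momentCoeff (n : ℕ) : ℝ := (2 * n).factorial / (4 ^ n * n.factorial)

theorem momentCoeff_pos (n : ℕ) : 0 < momentCoeff n := by
  unfold momentCoeff; positivity

theorem momentCoeff_succ (n : ℕ) : momentCoeff (n + 1) = (n + 1 / 2) * momentCoeff n := by
  unfold momentCoeff
  rw [show 2 * (n + 1) = 2 * n + 1 + 1 by ring, Nat.factorial_succ, Nat.factorial_succ,
    Nat.factorial_succ]
  push_cast
  field_simp
  ring

theorem re_pos_mem_slitPlane {w : ℂ} (hw : 0 < w.re) : w ∈ slitPlane := Or.inl hw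

theorem ofReal_mul_cpow {r : ℝ} (hr : 0 < r) {w : ℂ} (hw : w ≠ 0) (s : ℂ) :
    ((r : ℂ) * w) ^ s = (r : ℂ) ^ s * w ^ s := by
  have hr' : (r : ℂ) ≠ 0 := ofReal_ne_zero.2 hr.ne'
  rw [cpow_def_of_ne_zero (mul_ne_zero hr' hw), cpow_def_of_ne_zero hr', cpow_def_of_ne_zero hw,
    log_ofReal_mul hr hw, ← Complex.exp_add, ofReal_log hr.le, add_mul]

theorem div_cpow_half {w : ℂ} (hw : 0 < w.re) {r : ℝ} (hr : 0 < r) :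
    ((r : ℂ) / w) ^ (1 / 2 : ℂ) = (Real.sqrt r : ℂ) * w ^ (-(1 / 2) : ℂ) := by
  have harg : w.arg ≠ Real.pi := (mem_slitPlane_iff_arg.1 (re_pos_mem_slitPlane hw)).1
  rw [div_eq_mul_inv, ofReal_mul_cpow hr (inv_ne_zero (slitPlane_ne_zero (re_pos_mem_slitPlane hw))),
    cpow_neg, inv_cpow _ _ harg,
    Real.sqrt_eq_rpow, ofReal_cpow hr.le]
  norm_num

/-- Each `-d/dw` multiplies the integrand by `y²`, so the moments follow by induction from the
Gaussian integral; for this the identity is carried on the half-plane `Re w > 0` and not at a single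
`w`. -/
theorem lap_pow_even (n : ℕ) {w : ℂ} (hw : 0 < w.re) :
    lap (fun y => (y : ℂ) ^ (2 * n)) 0 w
      = momentCoeff n * ((Real.sqrt Real.pi : ℂ) * w ^ (-(n : ℂ) - 1 / 2)) := by
  induction n generalizing w with
  | zero =>
    have h := integral_gaussian_complex hw
    rw [div_cpow_half hw Real.pi_pos] at h
    simpa [lap, momentCoeff] using h
  | succ n ih =>
    have h1 := (gaussClass_pow (2 * n)).hasDerivAt_lap_snd 0 hw
    have h2 : HasDerivAt (fun ζ : ℂ => momentCoeff n * ((Real.sqrt Real.pi : ℂ)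
        * ζ ^ (-(n : ℂ) - 1 / 2))) _ w :=
      (((hasDerivAt_id w).cpow_const (re_pos_mem_slitPlane hw)).const_mul _).const_mul _
    have h3 := h1.unique (h2.congr_of_eventuallyEq
      ((continuous_re.continuousAt.eventually (lt_mem_nhds hw)).mono fun ζ hζ => ih hζ))
    have h4 : (fun y : ℝ => (y : ℂ) ^ (2 * (n + 1)))
        = fun y : ℝ => (y : ℂ) * ((y : ℂ) * (y : ℂ) ^ (2 * n)) := by
      funext y; ring
    rw [h4, neg_eq_iff_eq_neg.1 h3, momentCoeff_succ]
    push_cast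
    rw [show -(n + 1 : ℂ) - 1 / 2 = -n - 1 / 2 - 1 by ring]
    simp only [id]
    ring

theorem lap_pow_even' (n : ℕ) {w : ℂ} (hw : 0 < w.re) :
    lap (fun y => (y : ℂ) ^ (2 * n)) 0 w
      = momentCoeff n * w⁻¹ ^ n * (Real.pi / w) ^ (1 / 2 : ℂ) := by
  have h0 : w ≠ 0 := slitPlane_ne_zero (re_pos_mem_slitPlane hw)
  rw [lap_pow_even n hw, div_cpow_half hw Real.pi_pos, sub_eq_add_neg, cpow_add _ _ h0, cpow_neg,
    cpow_natCast, inv_pow]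
  ring

end Moments

/-! ### Termwise integration of even power series against Gaussians -/

section TermwiseIntegration

theorem integrable_of_hasSum {F : ℕ → ℝ → ℂ} {f : ℝ → ℂ} (hF : ∀ n, Integrable (F n))
    (hs : Summable fun n => ∫ y, ‖F n y‖) (hf : ∀ y, HasSum (F · y) (f y)) : Integrable f := by
  have hm : AEStronglyMeasurable f volume :=
    aestronglyMeasurable_of_tendsto_ae (f := fun (N : ℕ) y => ∑ n ∈ Finset.range N, F n y) atTop
      (fun N => Finset.aestronglyMeasurable_fun_sum _ fun n _ => (hF n).1)
      (Eventually.of_forall fun y => (hf y).tendsto_sum_nat)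
  refine ⟨hm, ?_⟩
  rw [hasFiniteIntegral_iff_enorm]
  calc ∫⁻ y, ‖f y‖ₑ ≤ ∫⁻ y, ∑' n, ‖F n y‖ₑ := by
        refine lintegral_mono fun y => ?_
        rw [← (hf y).tsum_eq]
        exact enorm_tsum_le_tsum_enorm
    _ = ∑' n, ∫⁻ y, ‖F n y‖ₑ := lintegral_tsum fun n => (hF n).1.enorm
    _ = ∑' n, ENNReal.ofReal (∫ y, ‖F n y‖) :=
        tsum_congr fun n => (ofReal_integral_norm_eq_lintegral_enorm (hF n)).symm
    _ < ⊤ := hs.tsum_ofReal_lt_top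

variable {a : ℕ → ℂ} {S : ℝ → ℂ}

/-- Even powers of a real variable are non-negative, so the `L¹` norm of each term is again a
Gaussian moment, with `b` replaced by `Re b`. The summability hypothesis is thus precisely absolute
convergence. -/
theorem integrable_and_hasSum_lap (hS : ∀ y : ℝ, HasSum (fun n => a n * (y : ℂ) ^ (2 * n)) (S y))
    {b : ℂ} (hb : 0 < b.re) (hs : Summable fun n => ‖a n‖ * momentCoeff n * b.re⁻¹ ^ n) :
    Integrable (fun y : ℝ => S y * cexp (-(b * y ^ 2) + 0 * y)) ∧
    HasSum (fun n => a n * momentCoeff n * b⁻¹ ^ n * (Real.pi / b) ^ (1 / 2 : ℂ))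
      (lap S 0 b) := by
  set F : ℕ → ℝ → ℂ := fun n y => a n * ((y : ℂ) ^ (2 * n) * cexp (-(b * y ^ 2) + 0 * y)) with hF
  have hint : ∀ n, Integrable (F n) := fun n =>
    ((gaussClass_pow (2 * n)).integrable_integrand 0 hb).const_mul _
  have hnorm : ∀ n, ∫ y, ‖F n y‖
      = ‖a n‖ * momentCoeff n * b.re⁻¹ ^ n * ‖((Real.pi / b.re : ℂ)) ^ (1 / 2 : ℂ)‖ := fun n => by
    have hre : 0 < (b.re : ℂ).re := hb
    have e : ∀ y : ℝ, ((‖F n y‖ : ℝ) : ℂ)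
        = ‖a n‖ * ((y : ℂ) ^ (2 * n) * cexp (-((b.re : ℂ) * y ^ 2) + 0 * y)) := fun y => by
      have h1 : ‖(y : ℂ) ^ (2 * n)‖ = y ^ (2 * n) := by
        rw [norm_pow, norm_real, Real.norm_eq_abs, pow_mul, sq_abs, ← pow_mul]
      rw [hF, norm_mul, norm_mul, h1, norm_cexp_kernel]
      push_cast
      simp
    have h2 : ((∫ y, ‖F n y‖ : ℝ) : ℂ) = ‖a n‖ * lap (fun y => (y : ℂ) ^ (2 * n)) 0 b.re := by
      rw [← integral_complex_ofReal, lap, ← integral_const_mul]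
      exact integral_congr_ae (Eventually.of_forall e)
    rw [lap_pow_even' n hre] at h2
    have h3 := congrArg norm h2
    rw [norm_real, Real.norm_of_nonneg (integral_nonneg fun y => norm_nonneg _)] at h3
    rw [h3]
    simp only [norm_mul, norm_pow, norm_inv, norm_real, Real.norm_eq_abs, abs_norm,
      abs_of_pos (momentCoeff_pos n), abs_of_pos hb]
    ring
  have hsum : Summable fun n => ∫ y, ‖F n y‖ := by
    simp only [hnorm]
    exact hs.mul_right _
  have hpt : ∀ y : ℝ, HasSum (F · y) (S y * cexp (-(b * y ^ 2) + 0 * y)) := fun y => by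
    have := (hS y).mul_right (cexp (-(b * y ^ 2) + 0 * y))
    simpa only [hF, mul_assoc] using this
  refine ⟨integrable_of_hasSum hint hsum hpt, ?_⟩
  have h := hasSum_integral_of_summable_integral_norm hint hsum
  simp only [fun y => (hpt y).tsum_eq] at h
  have e : ∀ n, ∫ y, F n y = a n * momentCoeff n * b⁻¹ ^ n * (Real.pi / b) ^ (1 / 2 : ℂ) :=
    fun n => by
      rw [mul_assoc, mul_assoc, ← mul_assoc (momentCoeff n : ℂ), ← lap_pow_even' n hb, lap,
        ← integral_const_mul]
  simp only [e] at h
  exact h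

theorem gaussClass_of_hasSum {α : ℝ} (hα : 0 ≤ α)
    (hS : ∀ y : ℝ, HasSum (fun n => a n * (y : ℂ) ^ (2 * n)) (S y))
    (hs : ∀ β, α < β → Summable fun n => ‖a n‖ * momentCoeff n * β⁻¹ ^ n) : GaussClass α S := by
  refine ⟨aestronglyMeasurable_of_tendsto_ae
      (f := fun (N : ℕ) (y : ℝ) => ∑ n ∈ Finset.range N, a n * (y : ℂ) ^ (2 * n)) atTop
      (fun N => Continuous.aestronglyMeasurable (by fun_prop))
      (Eventually.of_forall fun y => (hS y).tendsto_sum_nat), fun β hβ => ?_⟩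
  have h := (integrable_and_hasSum_lap hS (b := β) (by simpa using hα.trans_lt hβ)
    (by simpa using hs β hβ)).1.norm
  refine h.congr (Eventually.of_forall fun y => ?_)
  simp only [norm_mul, norm_cexp_kernel]
  simp

end TermwiseIntegration

/-! ### Taylor expansion of solutions of the heat equation -/

theorem hasSum_of_forall_eq {F G : ℕ → ℂ} {s : ℂ} (h : HasSum F s) (e : ∀ n, G n = F n) :
    HasSum G s := by
  rwa [funext e]

section HeatTaylor

variable {V : Set ℂ} {f : ℂ × ℂ → ℂ} {κ : ℂ}

theorem AnalyticOver.pd1 (hf : AnalyticOver V f) : AnalyticOver V (pd1 f) :=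
  fun p hp => AnalyticAt.pd1 (hf p hp)

/-- Mixed partial derivatives commute, so `∂_z` of a solution solves the same equation. -/
theorem heat_pd1 (hV : IsOpen V) (hf : AnalyticOver V f)
    (h : ∀ p : ℂ × ℂ, p.2 ∈ V → pd2 f p = κ * pd1 (pd1 f) p) {p : ℂ × ℂ} (hp : p.2 ∈ V) :
    pd2 (pd1 f) p = κ * pd1 (pd1 (pd1 f)) p := by
  have hev : pd2 f =ᶠ[𝓝 p] fun q => κ * pd1 (pd1 f) q :=
    (continuous_snd.continuousAt.eventually (hV.mem_nhds hp)).mono fun q hq => h q hq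
  rw [← pd1_pd2_comm (hf p ⟨trivial, hp⟩), pd1_congr hev]
  exact deriv_const_mul _ (hasDerivAt_pd1
    (AnalyticOver.pd1 (AnalyticOver.pd1 hf) p ⟨trivial, hp⟩).differentiableAt).differentiableAt

/-- Every `∂_u` is exchanged for `κ∂_z²`. The induction runs over all solutions, because its step
passes from `f` to `∂_z² f`. -/
theorem iteratedDeriv_heat (hV : IsOpen V) (n : ℕ) (hf : AnalyticOver V f)
    (h : ∀ p : ℂ × ℂ, p.2 ∈ V → pd2 f p = κ * pd1 (pd1 f) p) (z : ℂ) {u : ℂ} (hu : u ∈ V) :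
    iteratedDeriv n (fun w => f (z, w)) u
      = κ ^ n * iteratedDeriv (2 * n) (fun w => f (w, u)) z := by
  induction n generalizing f with
  | zero => simp
  | succ n ih =>
    have hev : deriv (fun w => f (z, w)) =ᶠ[𝓝 u] fun w => κ * pd1 (pd1 f) (z, w) :=
      (eventually_mem_set.2 (hV.mem_nhds hu)).mono fun w hw => h (z, w) hw
    rw [iteratedDeriv_succ', hev.iteratedDeriv_eq, iteratedDeriv_const_mul_field,
      ih (AnalyticOver.pd1 (AnalyticOver.pd1 hf)) fun p hp =>
        heat_pd1 hV (AnalyticOver.pd1 hf) (fun q hq => heat_pd1 hV hf h hq) hp,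
      show 2 * (n + 1) = 2 * n + 1 + 1 by ring, iteratedDeriv_succ', iteratedDeriv_succ', pow_succ']
    rw [mul_assoc]
    rfl

theorem hasSum_heat {R : ℝ} (hf : AnalyticOver (Metric.ball 0 R) f)
    (h : ∀ p : ℂ × ℂ, p.2 ∈ Metric.ball (0 : ℂ) R → pd2 f p = κ * pd1 (pd1 f) p) (z : ℂ) {u : ℂ}
    (hu : u ∈ Metric.ball (0 : ℂ) R) :
    HasSum (fun n : ℕ => (n.factorial : ℂ)⁻¹ * (κ * u) ^ n
      * iteratedDeriv (2 * n) (fun w => f (w, 0)) z) (f (z, u)) := by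
  have h0 : (0 : ℂ) ∈ Metric.ball (0 : ℂ) R := Metric.mem_ball_self (Metric.pos_of_mem_ball hu)
  have ht := hasSum_taylorSeries_on_ball (f := fun w => f (z, w))
    (hf.analyticOnNhd_slice z).differentiableOn hu
  refine hasSum_of_forall_eq ht fun n => ?_
  rw [iteratedDeriv_heat Metric.isOpen_ball n hf h z h0, sub_zero, mul_pow]
  simp only [smul_eq_mul]
  ring

theorem AnalyticOver.differentiable_slice (hf : AnalyticOver V f) {u : ℂ} (hu : u ∈ V) :
    Differentiable ℂ fun w => f (w, u) := fun w =>
  (hasDerivAt_pd1 (p := (w, u)) (hf (w, u) ⟨trivial, hu⟩).differentiableAt).differentiableAt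

end HeatTaylor

/-! ### Even and odd parts of entire functions -/

section EvenOdd

variable {g : ℂ → ℂ}

/-- `∑ g⁽²ⁿ⁾(z) y²ⁿ / (2n)!`. -/
noncomputable def evenPart (g : ℂ → ℂ) (z : ℂ) (y : ℝ) : ℂ :=
  ∑' n : ℕ, ((2 * n).factorial : ℂ)⁻¹ * iteratedDeriv (2 * n) g z * (y : ℂ) ^ (2 * n)

/-- `∑ g⁽²ⁿ⁺¹⁾(z) y²ⁿ / (2n+1)!`. -/
noncomputable def oddPart (g : ℂ → ℂ) (z : ℂ) (y : ℝ) : ℂ :=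
  ∑' n : ℕ, ((2 * n + 1).factorial : ℂ)⁻¹ * iteratedDeriv (2 * n + 1) g z * (y : ℂ) ^ (2 * n)

theorem hasSum_taylor (hg : Differentiable ℂ g) (z y : ℂ) :
    HasSum (fun n : ℕ => (n.factorial : ℂ)⁻¹ * iteratedDeriv n g z * y ^ n) (g (z + y)) := by
  have h := hasSum_taylorSeries_of_entire hg z (z + y)
  simp only [add_sub_cancel_left, smul_eq_mul] at h
  simpa only [mul_assoc, mul_comm (y ^ _)] using h

theorem hasSum_evenPart (hg : Differentiable ℂ g) (z : ℂ) (y : ℝ) :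
    HasSum (fun n : ℕ => ((2 * n).factorial : ℂ)⁻¹ * iteratedDeriv (2 * n) g z * (y : ℂ) ^ (2 * n))
      (evenPart g z y) :=
  ((hasSum_taylor hg z y).summable.comp_injective
    (mul_right_injective₀ (two_ne_zero : (2 : ℕ) ≠ 0))).hasSum

theorem hasSum_oddPart (hg : Differentiable ℂ g) (z : ℂ) (y : ℝ) :
    HasSum (fun n : ℕ => ((2 * n + 1).factorial : ℂ)⁻¹ * iteratedDeriv (2 * n + 1) g z
      * (y : ℂ) ^ (2 * n)) (oddPart g z y) := by
  refine Summable.hasSum ?_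
  -- For `y ≠ 0` the series is the odd half of the Taylor series divided by `y`; at `y = 0` only the
  -- term `n = 0` survives.
  rcases eq_or_ne y 0 with rfl | hy
  · refine summable_of_ne_finset_zero (s := {0}) fun n hn => ?_
    have : n ≠ 0 := by simpa using hn
    simp [this]
  · have hy' : (y : ℂ) ≠ 0 := ofReal_ne_zero.2 hy
    have h := ((hasSum_taylor hg z y).summable.comp_injective (i := fun n => 2 * n + 1)
      fun a b hab => by simpa using hab).mul_right (y : ℂ)⁻¹
    refine h.congr fun n => ?_
    simp only [Function.comp, pow_succ]
    field_simp

theorem eq_evenPart_add (hg : Differentiable ℂ g) (z : ℂ) (y : ℝ) :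
    g (z + y) = evenPart g z y + (y : ℂ) * oddPart g z y := by
  have h1 := hasSum_evenPart hg z y
  have h2 := (hasSum_oddPart hg z y).mul_left (y : ℂ)
  have h3 := HasSum.even_add_odd (f := fun n : ℕ => (n.factorial : ℂ)⁻¹ * iteratedDeriv n g z
    * (y : ℂ) ^ n) h1 (hasSum_of_forall_eq h2 fun n => by ring)
  exact (hasSum_taylor hg z y).unique h3

theorem oddPart_neg (z : ℂ) (y : ℝ) : oddPart g z (-y) = oddPart g z y := by
  simp [oddPart, pow_mul]

theorem lap_mul_oddPart (z b : ℂ) : lap (fun y => (y : ℂ) * oddPart g z y) 0 b = 0 := by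
  have h := integral_neg_eq_self
    (fun y : ℝ => (y : ℂ) * oddPart g z y * cexp (-(b * y ^ 2) + 0 * y)) volume
  simp only [oddPart_neg, ofReal_neg, neg_sq, neg_mul, zero_mul, mul_neg, neg_zero,
    integral_neg] at h
  simp only [lap, zero_mul]
  exact self_eq_neg.1 h.symm

end EvenOdd

/-! ### Gaussian representation of solutions of the heat equation -/

section GaussianRepresentation

variable {f : ℂ × ℂ → ℂ} {R c : ℝ}

/-- This is the absolute convergence of `hasSum_heat` at `u = -c/β`: there `κu = 1/(4β)`, and the
factor `(2n)!` of the moment cancels that of the Taylor coefficient. The condition `β > c/R` says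
`|u| < R`. -/
theorem summable_heat (hR : 0 < R) (hc : 0 < c) (hf : AnalyticOver (Metric.ball 0 R) f)
    (h : ∀ p : ℂ × ℂ, p.2 ∈ Metric.ball (0 : ℂ) R → pd2 f p = -(1 / (4 * c)) * pd1 (pd1 f) p)
    (z : ℂ) {β : ℝ} (hβ : c / R < β) :
    Summable fun n : ℕ => ‖((2 * n).factorial : ℂ)⁻¹ * iteratedDeriv (2 * n) (fun w => f (w, 0)) z‖
      * momentCoeff n * β⁻¹ ^ n := by
  have hβ0 : 0 < β := (div_pos hc hR).trans hβ
  have hu : (-(c / β) : ℂ) ∈ Metric.ball (0 : ℂ) R := by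
    rw [mem_ball_zero_iff, norm_neg, norm_div, norm_real, norm_real, Real.norm_of_nonneg hc.le,
      Real.norm_of_nonneg hβ0.le, div_lt_iff₀ hβ0]
    rwa [div_lt_iff₀ hR, mul_comm] at hβ
  refine (hasSum_heat hf h z hu).summable.norm.congr fun n => ?_
  have e : (-(1 / (4 * c)) * -(c / β) : ℂ) = ((4 * β)⁻¹ : ℝ) := by
    have hc' : (c : ℂ) ≠ 0 := ofReal_ne_zero.2 hc.ne'
    have hb' : (β : ℂ) ≠ 0 := ofReal_ne_zero.2 hβ0.ne'
    push_cast
    field_simp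
  rw [e]
  simp only [norm_mul, norm_pow, norm_inv, norm_real, norm_natCast, Real.norm_eq_abs, momentCoeff]
  rw [abs_of_pos hβ0, abs_of_pos (four_pos : (0 : ℝ) < 4), mul_inv, mul_pow, inv_pow (4 : ℝ)]
  field_simp

theorem gaussClass_evenPart (hR : 0 < R) (hc : 0 < c) (hf : AnalyticOver (Metric.ball 0 R) f)
    (h : ∀ p : ℂ × ℂ, p.2 ∈ Metric.ball (0 : ℂ) R → pd2 f p = -(1 / (4 * c)) * pd1 (pd1 f) p)
    (z : ℂ) : GaussClass (c / R) (evenPart (fun w => f (w, 0)) z) :=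
  gaussClass_of_hasSum (div_pos hc hR).le
    (hasSum_evenPart (hf.differentiable_slice (Metric.mem_ball_self hR)) z)
    fun _ hβ => summable_heat hR hc hf h z hβ

/-- The odd derivatives of `f` are even derivatives of `∂_z f`, which solves the same equation, and
`1/(2n+1)! ≤ 1/(2n)!`. The odd part does not contribute to the final value, but the integral of the
whole datum must converge. -/
theorem gaussClass_oddPart (hR : 0 < R) (hc : 0 < c) (hf : AnalyticOver (Metric.ball 0 R) f)
    (h : ∀ p : ℂ × ℂ, p.2 ∈ Metric.ball (0 : ℂ) R → pd2 f p = -(1 / (4 * c)) * pd1 (pd1 f) p)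
    (z : ℂ) : GaussClass (c / R) (oddPart (fun w => f (w, 0)) z) := by
  refine gaussClass_of_hasSum (div_pos hc hR).le
    (hasSum_oddPart (hf.differentiable_slice (Metric.mem_ball_self hR)) z) fun β hβ => ?_
  have hβ0 : 0 < β := (div_pos hc hR).trans hβ
  refine Summable.of_nonneg_of_le (fun n => ?_) (fun n => ?_)
    (summable_heat hR hc (AnalyticOver.pd1 hf)
      (fun p hp => heat_pd1 Metric.isOpen_ball hf h hp) z hβ)
  · have := momentCoeff_pos n
    positivity
  · have hn := (momentCoeff_pos n).le
    rw [iteratedDeriv_succ', norm_mul, norm_mul]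
    refine mul_le_mul_of_nonneg_right (mul_le_mul_of_nonneg_right
      (mul_le_mul ?_ le_rfl (norm_nonneg _) (norm_nonneg _)) hn) (by positivity)
    rw [norm_inv, norm_inv, norm_natCast, norm_natCast]
    gcongr
    omega

theorem gaussClass_heat (hR : 0 < R) (hc : 0 < c) (hf : AnalyticOver (Metric.ball 0 R) f)
    (h : ∀ p : ℂ × ℂ, p.2 ∈ Metric.ball (0 : ℂ) R → pd2 f p = -(1 / (4 * c)) * pd1 (pd1 f) p)
    (z : ℂ) : GaussClass (c / R) fun y : ℝ => f (z + y, 0) := by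
  have h1 := gaussClass_evenPart hR hc hf h z
  have h2 := (gaussClass_oddPart hR hc hf h z).mul_id
  have e : (fun y : ℝ => f (z + y, 0)) = fun y : ℝ => evenPart (fun w => f (w, 0)) z y
      + (y : ℂ) * oddPart (fun w => f (w, 0)) z y :=
    funext fun y => eq_evenPart_add (hf.differentiable_slice (Metric.mem_ball_self hR)) z y
  rw [e]
  refine ⟨h1.aesm.add h2.aesm, fun β hβ => ((h1.integrable β hβ).add (h2.integrable β hβ)).mono'
    ((h1.aesm.add h2.aesm).norm.mul (by fun_prop)) (Eventually.of_forall fun y => ?_)⟩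
  rw [Real.norm_of_nonneg (by positivity)]
  simp only [Pi.add_apply, ← add_mul]
  gcongr
  exact norm_add_le _ _

theorem neg_div_mem_ball (hR : 0 < R) (hc : 0 < c) {b : ℂ} (hb : c / R < b.re) :
    (-(c / b) : ℂ) ∈ Metric.ball (0 : ℂ) R := by
  have hn : c / R < ‖b‖ := hb.trans_le (re_le_norm b)
  have hb0 : 0 < ‖b‖ := (div_pos hc hR).trans hn
  rw [mem_ball_zero_iff, norm_neg, norm_div, norm_real, Real.norm_of_nonneg hc.le,
    div_lt_iff₀ hb0]
  rwa [div_lt_iff₀ hR, mul_comm] at hn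

/-- The odd part integrates to zero, and termwise integration of the even part reproduces the Taylor
series of `f` in `u` at `u = -c/b`. -/
theorem lap_heat (hR : 0 < R) (hc : 0 < c) (hf : AnalyticOver (Metric.ball 0 R) f)
    (h : ∀ p : ℂ × ℂ, p.2 ∈ Metric.ball (0 : ℂ) R → pd2 f p = -(1 / (4 * c)) * pd1 (pd1 f) p)
    (z : ℂ) {b : ℂ} (hb : c / R < b.re) :
    lap (fun y => f (z + y, 0)) 0 b = f (z, -(c / b)) * (Real.pi / b) ^ (1 / 2 : ℂ) := by
  have hb0 : 0 < b.re := (div_pos hc hR).trans hb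
  have h1 := gaussClass_evenPart hR hc hf h z
  have h2 := (gaussClass_oddPart hR hc hf h z).mul_id
  have hd := hf.differentiable_slice (Metric.mem_ball_self hR)
  have e : lap (fun y => f (z + y, 0)) 0 b = lap (evenPart (fun w => f (w, 0)) z) 0 b := by
    have e2 := lap_mul_oddPart (g := fun w => f (w, 0)) z b
    have e3 := integral_add (h1.integrable_integrand 0 hb) (h2.integrable_integrand 0 hb)
    refine Eq.trans ?_ (e3.trans (by rw [← lap, ← lap, e2, add_zero]))
    refine integral_congr_ae (Eventually.of_forall fun y => ?_)
    simp only [← add_mul]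
    rw [← eq_evenPart_add hd]
  have hs := (integrable_and_hasSum_lap (hasSum_evenPart hd z) hb0
    (summable_heat hR hc hf h z hb)).2
  have ht := (hasSum_heat hf h z (neg_div_mem_ball hR hc hb)).mul_right
    ((Real.pi / b : ℂ) ^ (1 / 2 : ℂ))
  rw [e]
  refine hs.unique (hasSum_of_forall_eq ht fun n => ?_)
  have hc' : (c : ℂ) ≠ 0 := ofReal_ne_zero.2 hc.ne'
  have hb' : b ≠ 0 := slitPlane_ne_zero (re_pos_mem_slitPlane hb0)
  have e3 : (-(1 / (4 * c)) * -(c / b) : ℂ) = 4⁻¹ * b⁻¹ := by field_simp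
  have h2n : ((2 * n).factorial : ℂ) ≠ 0 := Nat.cast_ne_zero.2 (Nat.factorial_ne_zero _)
  rw [e3, momentCoeff, mul_pow, inv_pow (4 : ℂ)]
  push_cast
  field_simp

theorem eq_of_eq_on_reals {F G : ℂ → ℂ} (hF : Differentiable ℂ F) (hG : Differentiable ℂ G)
    (h : ∀ x : ℝ, F x = G x) : F = G := by
  have ht : Tendsto (fun x : ℝ => (x : ℂ)) (𝓝[≠] 0) (𝓝[≠] 0) := by
    refine tendsto_nhdsWithin_iff.2 ⟨(continuous_ofReal.tendsto' 0 0 rfl).mono_left inf_le_left, ?_⟩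
    filter_upwards [self_mem_nhdsWithin] with x hx
    exact ofReal_ne_zero.2 hx
  exact AnalyticOnNhd.eq_of_frequently_eq (fun z _ => hF.analyticAt z) (fun z _ => hG.analyticAt z)
    (ht.frequently (Frequently.of_forall h))

theorem differentiable_gauss_lap {α : ℝ} {g : ℝ → ℂ} (hg : GaussClass α g) {b : ℂ}
    (hb : α < b.re) :
    Differentiable ℂ fun z : ℂ => cexp (-(b * z ^ 2)) * lap g (2 * b * z) b := fun z => by
  have h1 : DifferentiableAt ℂ (fun z : ℂ => lap g (2 * b * z) b) z :=
    DifferentiableAt.comp (g := fun s => lap g s b) z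
      (hg.hasDerivAt_lap_fst (2 * b * z) hb).differentiableAt (by fun_prop)
  exact DifferentiableAt.mul (by fun_prop) h1

theorem lap_shift (g : ℝ → ℂ) (x : ℝ) (b : ℂ) :
    lap (fun y => g (x + y)) 0 b = cexp (-(b * x ^ 2)) * lap g (2 * b * x) b := by
  rw [lap, lap, ← integral_const_mul]
  conv_rhs => rw [← integral_add_left_eq_self _ x]
  refine integral_congr_ae (Eventually.of_forall fun y => ?_)
  simp only
  rw [mul_left_comm, ← Complex.exp_add]
  congr 2
  push_cast
  ring

/-- For real `z` a translation of the integration variable turns `lap_heat` into this formula, with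
the datum evaluated on the real axis. Both sides are entire in `z`, which gives complex `z`. -/
theorem heat_eq_gauss (hR : 0 < R) (hc : 0 < c) (hf : AnalyticOver (Metric.ball 0 R) f)
    (h : ∀ p : ℂ × ℂ, p.2 ∈ Metric.ball (0 : ℂ) R → pd2 f p = -(1 / (4 * c)) * pd1 (pd1 f) p)
    (z : ℂ) {b : ℂ} (hb : c / R < b.re) :
    f (z, -(c / b)) * (Real.pi / b) ^ (1 / 2 : ℂ)
      = cexp (-(b * z ^ 2)) * lap (fun y => f (y, 0)) (2 * b * z) b := by
  have hg : GaussClass (c / R) fun y : ℝ => f (y, 0) := by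
    simpa using gaussClass_heat hR hc hf h 0
  refine congrFun (eq_of_eq_on_reals
    ((hf.differentiable_slice (neg_div_mem_ball hR hc hb)).mul_const _)
    (differentiable_gauss_lap hg hb) fun x => ?_) z
  rw [← lap_heat hR hc hf h x hb, ← lap_shift]
  simp only [ofReal_add]

end GaussianRepresentation

/-! ### The Gaussian integral in the variable `u = -c/b` -/

section GaussIntegral

variable {hb m ω : ℝ}

theorem gaussIntegrand_eq (g : ℝ → ℂ) (z : ℂ) {u b : ℂ}
    (hu : (2 * Real.pi * hb * m * ω / u : ℂ) = -b) (ξ : ℝ) :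
    gaussIntegrand hb m ω g z u ξ
      = cexp (-(b * z ^ 2)) * (g ξ * cexp (-(b * ξ ^ 2) + 2 * b * z * ξ)) := by
  rw [gaussIntegrand, mul_left_comm, ← Complex.exp_add, mul_div_right_comm, hu]
  congr 2
  ring

/-- The normalising factor is `(b/π)^{1/2}`. Since `Re b > 0`, the principal square roots of `b/π`
and `π/b` are inverse to each other, so no sign ambiguity arises. -/
theorem gaussIntegral_eq (g : ℝ → ℂ) (z : ℂ) {u b : ℂ}
    (hu : (2 * Real.pi * hb * m * ω / u : ℂ) = -b) (hbre : 0 < b.re) {F : ℂ} :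
    F = gaussIntegral hb m ω g z u ↔
      F * (Real.pi / b) ^ (1 / 2 : ℂ) = cexp (-(b * z ^ 2)) * lap g (2 * b * z) b := by
  have hpi : (Real.pi : ℂ) ≠ 0 := ofReal_ne_zero.2 Real.pi_ne_zero
  have hb0 : b ≠ 0 := slitPlane_ne_zero (re_pos_mem_slitPlane hbre)
  have hre : 0 < (b / Real.pi).re := by
    rw [div_ofReal_re]; exact div_pos hbre Real.pi_pos
  have e1 : (-(2 * m * ω * hb) / u : ℂ) = b / Real.pi := by
    rw [eq_div_iff hpi, ← neg_eq_iff_eq_neg.2 hu]; ring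
  have e2 : (Real.pi / b : ℂ) ^ (1 / 2 : ℂ) = ((b / Real.pi) ^ (1 / 2 : ℂ))⁻¹ := by
    rw [← inv_cpow _ _ (mem_slitPlane_iff_arg.1 (re_pos_mem_slitPlane hre)).1, inv_div]
  have h0 : (b / Real.pi : ℂ) ^ (1 / 2 : ℂ) ≠ 0 := by
    rw [Ne, cpow_eq_zero_iff]
    exact fun h => div_ne_zero hb0 hpi h.1
  rw [gaussIntegral, e1, e2]
  simp only [gaussIntegrand_eq g z hu, integral_const_mul]
  rw [← lap, mul_inv_eq_iff_eq_mul₀ h0, mul_comm (_ ^ _)]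

variable {R : ℝ} {f2 : ℂ × ℂ → ℂ}

/-- Solutions of the heat equation on a disc are Gaussian integrals of their initial data. -/
theorem heatLike_gaussIntegral (hhb : 0 < hb) (hm : 0 < m) (hω : 0 < ω) (hR : 0 < R)
    (hf : AnalyticOver (Metric.ball 0 R) f2) (h : HeatLike hb m ω (Metric.ball 0 R) f2)
    (z : ℂ) {u : ℂ} (hu : ‖u + R / 2‖ < R / 2) :
    Integrable (gaussIntegrand hb m ω (fun ξ : ℝ => f2 (ξ, 0)) z u) ∧
      f2 (z, u) = gaussIntegral hb m ω (fun ξ : ℝ => f2 (ξ, 0)) z u := by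
  set c : ℝ := 2 * Real.pi * hb * m * ω with hc
  have hc0 : 0 < c := by positivity
  have hc' : (c : ℂ) ≠ 0 := ofReal_ne_zero.2 hc0.ne'
  have hκ : ∀ p : ℂ × ℂ, p.2 ∈ Metric.ball (0 : ℂ) R →
      pd2 f2 p = -(1 / (4 * c)) * pd1 (pd1 f2) p := fun p hp => by
    have := (heatLike_iff hhb hm hω).1 h p.1 p.2 hp
    have hcc : (c : ℂ) = 2 * Real.pi * hb * m * ω := by rw [hc]; push_cast; rfl
    change pd1 (pd1 f2) p + 8 * Real.pi * hb * m * ω * pd2 f2 p = 0 at this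
    field_simp
    linear_combination this + 4 * pd2 f2 p * hcc
  -- The disc `|u + R/2| < R/2` in the form that becomes `Re b > c/R` after division by `|u|²`.
  have hnorm : ‖u‖ ^ 2 + R * u.re < 0 := by
    have h1 : ‖u + R / 2‖ ^ 2 < (R / 2) ^ 2 := by gcongr
    rw [Complex.sq_norm, normSq_apply] at h1
    rw [Complex.sq_norm, normSq_apply]
    simp at h1
    nlinarith
  have hu0 : u ≠ 0 := fun h0 => by simp [h0] at hnorm
  set b : ℂ := -(c / u) with hb_def
  have hub : (2 * Real.pi * hb * m * ω / u : ℂ) = -b := by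
    rw [hb_def, hc]; push_cast; ring
  have hcb : -(c / b) = u := by rw [hb_def]; field_simp
  have hbre : c / R < b.re := by
    have hn : 0 < normSq u := normSq_pos.2 hu0
    rw [Complex.sq_norm] at hnorm
    rw [hb_def, neg_re, div_re, ofReal_re, ofReal_im, zero_mul, zero_div, add_zero,
      div_lt_iff₀ hR, ← neg_div, div_mul_eq_mul_div, lt_div_iff₀ hn]
    nlinarith
  have hg : GaussClass (c / R) fun y : ℝ => f2 (y, 0) := by
    simpa using gaussClass_heat hR hc0 hf hκ 0
  refine ⟨?_, ?_⟩
  · refine Integrable.congr ((hg.integrable_integrand (2 * b * z) hbre).const_mul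
      (cexp (-(b * z ^ 2)))) (Eventually.of_forall fun ξ => ?_)
    exact (gaussIntegrand_eq (fun ξ : ℝ => f2 (ξ, 0)) z hub ξ).symm
  · rw [gaussIntegral_eq _ z hub ((div_pos hc0 hR).trans hbre), ← heat_eq_gauss hR hc0 hf hκ z hbre,
      hcb]

end GaussIntegral

/-! ### Gaussian integrals solve the heat equation -/

section GaussianDerivatives

variable {α : ℝ} {g : ℝ → ℂ}

theorem hasDerivAt_gauss_lap_fst (hg : GaussClass α g) {b : ℂ} (hb : α < b.re) (z : ℂ) :
    HasDerivAt (fun z : ℂ => cexp (-(b * z ^ 2)) * lap g (2 * b * z) b)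
      (-(2 * b * z) * (cexp (-(b * z ^ 2)) * lap g (2 * b * z) b)
        + 2 * b * (cexp (-(b * z ^ 2)) * lap (fun y => (y : ℂ) * g y) (2 * b * z) b)) z := by
  have h1 := HasDerivAt.comp z (hg.hasDerivAt_lap_fst (2 * b * z) hb)
    ((hasDerivAt_id z).const_mul (2 * b))
  have h2 := (((hasDerivAt_pow 2 z).const_mul b).neg).cexp
  refine (h2.mul h1).congr_deriv ?_
  simp
  ring

/-- Here `b` occurs in both arguments of `lap`, so the chain rule rests on joint differentiability,
not only on the two partial derivatives. -/
theorem hasDerivAt_gauss_lap_snd (hg : GaussClass α g) {b : ℂ} (hb : α < b.re) (z : ℂ) :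
    HasDerivAt (fun b : ℂ => cexp (-(b * z ^ 2)) * lap g (2 * b * z) b)
      (cexp (-(b * z ^ 2)) * (-z ^ 2 * lap g (2 * b * z) b
        + 2 * z * lap (fun y => (y : ℂ) * g y) (2 * b * z) b
        - lap (fun y => (y : ℂ) * ((y : ℂ) * g y)) (2 * b * z) b)) b := by
  have h1 := hasDerivAt_comp_pair (F := fun p : ℂ × ℂ => lap g p.1 p.2)
    (hg.analyticOnNhd_lap (2 * b * z, b) hb).differentiableAt
    (((hasDerivAt_id b).const_mul 2).mul_const z) (hasDerivAt_id b) rfl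
  have e1 : pd1 (fun p : ℂ × ℂ => lap g p.1 p.2) (2 * b * z, b) = _ :=
    (hg.hasDerivAt_lap_fst (2 * b * z) hb).deriv
  have e2 : pd2 (fun p : ℂ × ℂ => lap g p.1 p.2) (2 * b * z, b) = _ :=
    (hg.hasDerivAt_lap_snd (2 * b * z) hb).deriv
  rw [e1, e2] at h1
  have h2 := (((hasDerivAt_id b).mul_const (z ^ 2)).neg).cexp
  refine (h2.mul h1).congr_deriv ?_
  simp
  ring

end GaussianDerivatives

/-! ### The heat equation and the initial value from the integral formula -/

section Converse

variable {α c : ℝ} {g : ℝ → ℂ} {f : ℂ × ℂ → ℂ}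

/-- The formula is available only for real `b`. As `f` is analytic, its derivative along the real
curve `b ↦ -c/b` already determines `∂_u f`, and the comparison with `∂_z²` is made in terms of the
transforms of `g`, `y g` and `y² g`. -/
theorem heat_of_gauss (hα : 0 ≤ α) (hg : GaussClass α g) (hc : c ≠ 0)
    (h : ∀ z : ℂ, ∀ b : ℝ, α < b → f (z, -(c / b)) * (Real.pi / b) ^ (1 / 2 : ℂ)
      = cexp (-(b * z ^ 2)) * lap g (2 * b * z) b)
    (z : ℂ) {b : ℝ} (hb : α < b) (hf : AnalyticAt ℂ f (z, -(c / b))) :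
    pd1 (pd1 f) (z, -(c / b)) + 4 * c * pd2 f (z, -(c / b)) = 0 := by
  have hb0 : 0 < b := hα.trans_lt hb
  have hbc : (b : ℂ) ≠ 0 := ofReal_ne_zero.2 hb0.ne'
  have hcc : (c : ℂ) ≠ 0 := ofReal_ne_zero.2 hc
  have hre : α < (b : ℂ).re := hb
  set s : ℂ := (Real.sqrt Real.pi : ℂ)⁻¹ with hs
  have hsq : (Real.sqrt Real.pi : ℂ) ≠ 0 := ofReal_ne_zero.2 (Real.sqrt_pos.2 Real.pi_pos).ne'
  have key : ∀ z : ℂ, ∀ b : ℝ, α < b → f (z, -(c / b))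
      = s * (b : ℂ) ^ (1 / 2 : ℂ) * (cexp (-(b * z ^ 2)) * lap g (2 * b * z) b) := by
    intro z b hb
    have hre : 0 < (b : ℂ).re := hα.trans_lt hb
    have h1 : (b : ℂ) ^ (1 / 2 : ℂ) * (b : ℂ) ^ (-(1 / 2) : ℂ) = 1 := by
      rw [← cpow_add _ _ (slitPlane_ne_zero (re_pos_mem_slitPlane hre)), add_neg_cancel, cpow_zero]
    rw [← h z b hb, div_cpow_half hre Real.pi_pos, hs]
    field_simp
    rw [mul_assoc, h1, mul_one]
  have d1 : ∀ z, pd1 f (z, -(c / b)) = s * (b : ℂ) ^ (1 / 2 : ℂ)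
      * (-(2 * b * z) * (cexp (-(b * z ^ 2)) * lap g (2 * b * z) b)
        + 2 * b * (cexp (-(b * z ^ 2)) * lap (fun y => (y : ℂ) * g y) (2 * b * z) b)) := fun z => by
    rw [pd1, funext fun ζ => key ζ b hb]
    exact ((hasDerivAt_gauss_lap_fst hg hre z).const_mul _).deriv
  have d2 : pd1 (pd1 f) (z, -(c / b)) = s * (b : ℂ) ^ (1 / 2 : ℂ) * cexp (-(b * z ^ 2))
      * ((4 * b ^ 2 * z ^ 2 - 2 * b) * lap g (2 * b * z) b
        - 8 * b ^ 2 * z * lap (fun y => (y : ℂ) * g y) (2 * b * z) b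
        + 4 * b ^ 2 * lap (fun y => (y : ℂ) * ((y : ℂ) * g y)) (2 * b * z) b) := by
    have hd := ((((((hasDerivAt_id' z).const_mul (2 * b : ℂ)).fun_neg.fun_mul
        (hasDerivAt_gauss_lap_fst hg hre z)).fun_add
        ((hasDerivAt_gauss_lap_fst hg.mul_id hre z).const_mul (2 * b : ℂ))).const_mul
        (s * (b : ℂ) ^ (1 / 2 : ℂ))))
    rw [pd1, funext d1]
    exact hd.deriv.trans (by ring)
  have hcurve : HasDerivAt (fun b : ℝ => (-(c / b) : ℂ)) (c / b ^ 2) b := by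
    have := ((hasDerivAt_inv hbc).const_mul (c : ℂ)).neg.comp_ofReal
    refine (this.congr_of_eventuallyEq (Eventually.of_forall fun t => ?_)).congr_deriv ?_
    · simp [div_eq_mul_inv]
    · field_simp
  have h3 := hasDerivAt_comp_real_pair hf.differentiableAt
    (hasDerivAt_const b z) hcurve rfl
  have h4 := ((((hasDerivAt_id (b : ℂ)).cpow_const (c := 1 / 2) (re_pos_mem_slitPlane hb0)).const_mul
    s).mul (hasDerivAt_gauss_lap_snd hg hre z)).comp_ofReal
  have h5 := h3.unique (h4.congr_of_eventuallyEq ((lt_mem_nhds hb).mono fun t ht => key z t ht))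
  have h6 : pd2 f (z, -(c / b)) = b ^ 2 / c * (c / b ^ 2 * pd2 f (z, -(c / b))) := by
    field_simp
  rw [zero_mul, zero_add] at h5
  rw [h6, h5, d2]
  simp only [id, cpow_sub _ _ hbc, cpow_one]
  field_simp
  ring

theorem tendsto_abs_mul_gauss :
    Tendsto (fun x : ℝ => ‖x‖ ^ Module.finrank ℝ ℝ * Real.exp (-Real.pi * x ^ 2))
      (Bornology.cobounded ℝ) (𝓝 0) := by
  rw [Metric.cobounded_eq_cocompact]
  simpa using tendsto_rpow_abs_mul_exp_neg_mul_sq_cocompact Real.pi_pos 1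

/-- A fixed part `exp(-(α+1)y²)` of the weight is joined to `g` to make it integrable; the rest, `r
exp(-πr²y²)`, is an approximate identity as `r → ∞`. -/
theorem tendsto_gauss_peak (hg : GaussClass α g) (hgc : Continuous g) (x : ℝ) :
    Tendsto (fun r : ℝ => (r : ℂ) * lap (fun y => g (x + y)) 0 ((α + 1 + Real.pi * r ^ 2 : ℝ) : ℂ))
      atTop (𝓝 (g x)) := by
  have hint : Integrable fun y : ℝ => g (x + y) * cexp (-((α + 1 : ℝ) * y ^ 2)) := by
    have h := ((hg.integrable_integrand (2 * (α + 1 : ℝ) * x) (w := ((α + 1 : ℝ) : ℂ))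
      (by simp)).comp_add_left x).const_mul (cexp (-((α + 1 : ℝ) * x ^ 2)))
    refine h.congr (Eventually.of_forall fun y => ?_)
    simp only
    rw [mul_left_comm, ← Complex.exp_add]
    congr 2
    push_cast
    ring
  have h := tendsto_integral_comp_smul_smul_of_integrable (μ := (volume : Measure ℝ))
    (φ := fun x : ℝ => Real.exp (-Real.pi * x ^ 2)) (fun x => (Real.exp_pos _).le)
    (by rw [integral_gaussian, div_self Real.pi_ne_zero, Real.sqrt_one]) tendsto_abs_mul_gauss
    hint (Continuous.continuousAt (by fun_prop))
  simp only [add_zero, ofReal_zero, ne_eq, OfNat.ofNat_ne_zero, not_false_eq_true, zero_pow,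
    mul_zero, neg_zero, Complex.exp_zero, mul_one] at h
  refine h.congr fun r => ?_
  rw [lap, ← integral_const_mul]
  refine integral_congr_ae (Eventually.of_forall fun y => ?_)
  simp only [Module.finrank_self, pow_one, real_smul, smul_eq_mul, ofReal_mul, ofReal_exp]
  rw [mul_assoc, mul_left_comm (cexp _), ← Complex.exp_add]
  congr 3
  push_cast
  ring

theorem tendsto_mul_sqrt_div (hα : 0 ≤ α) :
    Tendsto (fun r : ℝ => r * Real.sqrt (Real.pi / (α + 1 + Real.pi * r ^ 2))) atTop (𝓝 1) := by
  have h1 : Tendsto (fun r : ℝ => α + 1 + Real.pi * r ^ 2) atTop atTop :=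
    tendsto_atTop_add_const_left _ _ ((tendsto_pow_atTop two_ne_zero).const_mul_atTop Real.pi_pos)
  have h2 : Tendsto (fun r : ℝ => Real.sqrt (1 - (α + 1) / (α + 1 + Real.pi * r ^ 2))) atTop
      (𝓝 1) := by
    have := (Real.continuous_sqrt.tendsto (1 - 0)).comp
      (tendsto_const_nhds.sub ((tendsto_const_nhds (x := α + 1)).div_atTop h1))
    simpa [Function.comp_def] using this
  refine h2.congr' ?_
  filter_upwards [eventually_ge_atTop 0] with r hr
  have hp : 0 < α + 1 + Real.pi * r ^ 2 := by
    have := Real.pi_pos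
    positivity
  nth_rewrite 2 [← Real.sqrt_sq hr]
  rw [← Real.sqrt_mul (sq_nonneg r)]
  congr 1
  field_simp
  ring

theorem ofReal_cpow_half {x : ℝ} (hx : 0 ≤ x) : (x : ℂ) ^ (1 / 2 : ℂ) = (Real.sqrt x : ℂ) := by
  rw [Real.sqrt_eq_rpow, ofReal_cpow hx]
  norm_num

/-- With `b = α + 1 + πr²` and `r → ∞`, the point `u = -c/b` tends to `0`. The same quantity then
tends to `f (x, 0)` by continuity of `f` and to `g x` by the approximate identity, since `r
(π/b)^{1/2} → 1`. -/
theorem initial_of_gauss (hα : 0 ≤ α) (hg : GaussClass α g) (hgc : Continuous g) (x : ℝ)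
    (hf : ContinuousAt (fun u => f (x, u)) 0)
    (h : ∀ b : ℝ, α < b → f (x, -(c / b)) * (Real.pi / b) ^ (1 / 2 : ℂ)
      = cexp (-(b * x ^ 2)) * lap g (2 * b * x) b) : f (x, 0) = g x := by
  set β : ℝ → ℝ := fun r => α + 1 + Real.pi * r ^ 2 with hβ
  have hβα : ∀ r, α < β r := fun r => by
    have : 0 ≤ Real.pi * r ^ 2 := mul_nonneg Real.pi_pos.le (sq_nonneg r)
    simp only [hβ]; linarith
  have h1 : Tendsto β atTop atTop :=
    tendsto_atTop_add_const_left _ _ ((tendsto_pow_atTop two_ne_zero).const_mul_atTop Real.pi_pos)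
  have h2 : Tendsto (fun r : ℝ => (-(c / β r) : ℂ)) atTop (𝓝 0) := by
    have h3 : Tendsto (fun r : ℝ => -(c / β r)) atTop (𝓝 0) := by
      simpa using (tendsto_const_nhds.div_atTop h1).neg
    have := (continuous_ofReal.tendsto 0).comp h3
    simpa [Function.comp_def] using this
  have h4 := ((continuous_ofReal.tendsto 1).comp (tendsto_mul_sqrt_div hα)).mul (hf.tendsto.comp h2)
  rw [ofReal_one, one_mul] at h4
  refine tendsto_nhds_unique (h4.congr fun r => ?_) (tendsto_gauss_peak hg hgc x)
  have e := h (β r) (hβα r)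
  have hpos : 0 ≤ Real.pi / β r := div_nonneg Real.pi_pos.le (hα.trans (hβα r).le)
  rw [← lap_shift, ← ofReal_div Real.pi (β r), ofReal_cpow_half hpos] at e
  simp only [Function.comp_def]
  rw [← e, ofReal_mul]
  ring

end Converse

/-! ### Passage from real `z` and a short interval of `u` to `ℂ × {|u| < R}` -/

section GaussIntegralConverse

variable {h2 hb m ω E R δ : ℝ} {g : ℝ → ℂ} {f2 : ℂ × ℂ → ℂ}

/-- Gaussian integrals solve the heat equation and take their initial data. -/
theorem heatLike_of_gaussIntegral (hhb : 0 < hb) (hm : 0 < m) (hω : 0 < ω) (hδ : 0 < δ)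
    (hδR : δ ≤ R) (hg : Continuous g) (hf : AnalyticOver (Metric.ball 0 R) f2)
    (h : ∀ z u : ℝ, -δ < u → u < 0 →
      Integrable (gaussIntegrand hb m ω g z u) ∧ f2 (z, u) = gaussIntegral hb m ω g z u) :
    HeatLike hb m ω (Metric.ball 0 R) f2 ∧ ∀ ξ : ℝ, f2 (ξ, 0) = g ξ := by
  set c : ℝ := 2 * Real.pi * hb * m * ω with hc
  have hc0 : 0 < c := by positivity
  have hcc : (c : ℂ) = 2 * Real.pi * hb * m * ω := by rw [hc]; push_cast; rfl
  have hR : 0 < R := hδ.trans_le hδR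
  -- Under `u = -c/b` the interval `-δ < u < 0` corresponds to `b > α`.
  set α := c / δ with hα
  have hα0 : 0 < α := div_pos hc0 hδ
  have hrange : ∀ b : ℝ, α < b → -δ < -(c / b) ∧ -(c / b) < 0 := fun b hb => by
    have hb0 : 0 < b := hα0.trans hb
    refine ⟨neg_lt_neg ?_, neg_lt_zero.2 (div_pos hc0 hb0)⟩
    rw [div_lt_iff₀ hb0]
    rwa [hα, div_lt_iff₀ hδ, mul_comm] at hb
  have hub : ∀ b : ℝ, α < b → (2 * Real.pi * hb * m * ω / (-(c / b) : ℝ) : ℂ) = -b := fun b hb => by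
    have h1 : (b : ℂ) ≠ 0 := ofReal_ne_zero.2 (hα0.trans hb).ne'
    have h2 : (c : ℂ) ≠ 0 := ofReal_ne_zero.2 hc0.ne'
    rw [← hcc]
    push_cast
    field_simp
  -- Absolute convergence at `z = 0` alone puts `g` in the class; complex `z` is then reached
  -- because both sides of the formula are entire in `z`.
  have hgc : GaussClass α g := by
    refine ⟨hg.aestronglyMeasurable, fun β hβ => ?_⟩
    have h0 := (h 0 (-(c / β)) (hrange β hβ).1 (hrange β hβ).2).1.norm
    refine h0.congr (Eventually.of_forall fun y => ?_)
    simp only [gaussIntegrand_eq g _ (hub β hβ), norm_mul, norm_cexp_kernel]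
    simp
  have hreal : ∀ x b : ℝ, α < b → f2 (x, -(c / b)) * (Real.pi / b) ^ (1 / 2 : ℂ)
      = cexp (-(b * x ^ 2)) * lap g (2 * b * x) b := fun x b hb => by
    rw [← gaussIntegral_eq (F := f2 (x, -(c / b))) g x (hub b hb) (hα0.trans hb),
      ← (h x (-(c / b)) (hrange b hb).1 (hrange b hb).2).2]
    push_cast
    rfl
  have hmem : ∀ b : ℝ, α < b → (-(c / b) : ℂ) ∈ Metric.ball (0 : ℂ) R := fun b hb =>
    Metric.ball_subset_ball hδR (neg_div_mem_ball hδ hc0 (b := b) hb)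
  have hcplx : ∀ z : ℂ, ∀ b : ℝ, α < b → f2 (z, -(c / b)) * (Real.pi / b) ^ (1 / 2 : ℂ)
      = cexp (-(b * z ^ 2)) * lap g (2 * b * z) b := fun z b hb =>
    congrFun (eq_of_eq_on_reals ((hf.differentiable_slice (hmem b hb)).mul_const _)
      (differentiable_gauss_lap (b := b) hgc hb) fun x => hreal x b hb) z
  refine ⟨?_, fun ξ => initial_of_gauss hα0.le hgc hg ξ
    ((hf.analyticOnNhd_slice ξ) 0 (Metric.mem_ball_self hR)).continuousAt (hreal ξ)⟩
  rw [heatLike_iff hhb hm hω]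
  intro z
  -- The heat equation holds at real points `u` accumulating at `-c/(α+1)`, where `α + 1` is merely
  -- some value above `α`; the identity theorem carries it to the disc.
  have hev : ∀ᶠ b : ℝ in 𝓝[≠] (α + 1), pd1 (pd1 f2) (z, -(c / b))
      + 8 * Real.pi * hb * m * ω * pd2 f2 (z, -(c / b)) = 0 := by
    refine ((lt_mem_nhds (lt_add_one α)).filter_mono inf_le_left).mono fun b hb => ?_
    have := heat_of_gauss hα0.le hgc hc0.ne' hcplx z hb (hf _ ⟨trivial, hmem b hb⟩)
    rw [hcc] at this
    rw [hcc]
    linear_combination this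
  have ht : Tendsto (fun b : ℝ => (-(c / b) : ℂ)) (𝓝[≠] (α + 1))
      (𝓝[≠] (-(c / (α + 1 : ℝ)) : ℂ)) := by
    have hne : ((α + 1 : ℝ) : ℂ) ≠ 0 := ofReal_ne_zero.2 (by linarith)
    refine tendsto_nhdsWithin_iff.2 ⟨ContinuousAt.tendsto (x := α + 1)
      (f := fun b : ℝ => (-(c / b) : ℂ)) ?_ |>.mono_left inf_le_left, ?_⟩
    · exact (continuousAt_const.div continuous_ofReal.continuousAt hne).neg
    · filter_upwards [self_mem_nhdsWithin] with b hb heq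
      refine hb ?_
      have h1 : (c / b : ℂ) = c / (α + 1 : ℝ) := neg_injective heq
      have h2 : c / b = c / (α + 1) := by exact_mod_cast h1
      have h3 := congrArg (fun t => c / t) h2
      simpa [div_div_cancel₀ hc0.ne'] using h3
  exact fun u hu => ((hf.heat_expr _).analyticOnNhd_slice z).eqOn_zero_of_preconnected_of_frequently_eq_zero
    (convex_ball _ _).isPreconnected (hmem (α + 1) (lt_add_one α)) (ht.frequently hev.frequently) hu

theorem solves_ham_of_gaussIntegral (hhb : 0 < hb) (hm : 0 < m) (hω : 0 < ω) (hE : 0 < E)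
    (hδ : 0 < δ) (hδR : δ ≤ R) (hg : Continuous g) (hf : AnalyticOver (Metric.ball 0 R) f2)
    (h : ∀ z u : ℝ, -δ < u → u < 0 →
      Integrable (gaussIntegrand hb m ω g z u) ∧ f2 (z, u) = gaussIntegral hb m ω g z u) :
    HeatLike hb m ω (Metric.ball 0 R) f2 ∧ (∀ ξ : ℝ, f2 (ξ, 0) = g ξ) ∧
      Solves hb (ham hb m ω) (region m ω E (Metric.ball 0 R)) (geomSol h2 hb m ω E f2) := by
  have hh := heatLike_of_gaussIntegral hhb hm hω hδ hδR hg hf h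
  -- The radius `R` may exceed `1`, so the disc need not be an `IsRotDomain`; openness and rotation
  -- invariance are enough here.
  refine ⟨hh.1, hh.2, solves_ham_geomSol hhb hm hω hE Metric.isOpen_ball hf (fun u hu θ => ?_) hh.1⟩
  rw [mem_ball_zero_iff] at hu ⊢
  rwa [norm_mul, mul_comm I, norm_exp_ofReal_mul_I, one_mul]

end GaussIntegralConverse

end ShearOsc
-- Assembly of the claims
theorem mainTheorem1 (h2 hb m ω E : ℝ) (hhb : 0 < hb) (hm : 0 < m) (hω : 0 < ω) (hE : 0 < E)
    (c : ℂ) (hc : c ≠ 0) :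
    -- the image space is annihilated by the analyticity and the structural operators
    (∀ F ∈ imageSpace h2 hb (gaussianVec hb E c),
      ContDiff ℝ ((⊤ : ℕ∞) : WithTop ℕ∞) F ∧ (∀ x, opC hb E F x = 0) ∧ (∀ x, opS h2 hb F x = 0)) ∧
    -- the reduced Hamiltonian is `H` plus multiples of `C` and `S`
    (∀ f : Pt → ℂ, ContDiff ℝ 2 f → ∀ x : Pt,
      redHam h2 hb m ω E f x =
        ham hb m ω f x
          + (I / (4 * Real.pi * m) * d1 (opC hb E f) x
            + I / (2 * Real.pi * m) * (-I / 2 * E + x.2.1) * d3 (opC hb E f) x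
            + I * hb / (2 * m) * x.1 * (-E + 2 * I * x.2.1) * opC hb E f x)
          + (-(1 / (4 * Real.pi * m)) * (I * x.2.1 + E) ^ 2 + m * ω ^ 2 / (4 * Real.pi))
            * opS h2 hb f x) ∧
    -- on the image space the two Schrodinger equations are equivalent
    (∀ f : ℝ → Pt → ℂ, (∀ t, f t ∈ imageSpace h2 hb (gaussianVec hb E c)) → ∀ Ω : Set Pt,
      (Solves hb (ham hb m ω) Ω f ↔ Solves hb (redHam h2 hb m ω E) Ω f)) ∧
    (∀ V : Set ℂ, IsRotDomain V → (region m ω E V).Nonempty →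
      -- the explicit formula satisfies the analyticity condition and the reduced equation;
      -- it satisfies the original equation iff the structural condition iff the heat equation
      (∀ f2 : ℂ × ℂ → ℂ, AnalyticOver V f2 →
        ContDiffOn ℝ ((⊤ : ℕ∞) : WithTop ℕ∞) (fun p : ℝ × Pt => geomSol h2 hb m ω E f2 p.1 p.2)
          (Set.univ ×ˢ region m ω E V) ∧
        (∀ t : ℝ, ∀ x ∈ region m ω E V, opC hb E (geomSol h2 hb m ω E f2 t) x = 0) ∧
        Solves hb (redHam h2 hb m ω E) (region m ω E V) (geomSol h2 hb m ω E f2) ∧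
        ((∀ t : ℝ, ∀ x ∈ region m ω E V, opS h2 hb (geomSol h2 hb m ω E f2 t) x = 0) ↔
          HeatLike hb m ω V f2) ∧
        (Solves hb (ham hb m ω) (region m ω E V) (geomSol h2 hb m ω E f2) ↔
          HeatLike hb m ω V f2)) ∧
      -- it is the general solution of the reduced equation
      (∀ (f : ℝ → Pt → ℂ) (f1 : ℝ → ℂ × ℂ → ℂ),
        ContinuousOn (fun p : ℝ × (ℂ × ℂ) => f1 p.1 p.2)
          (Set.univ ×ˢ (Set.univ ×ˢ {w : ℂ | 0 < w.re ∧ cayley m ω w ∈ V})) →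
        (∀ t, AnalyticOnNhd ℂ (f1 t) (Set.univ ×ˢ {w : ℂ | 0 < w.re ∧ cayley m ω w ∈ V})) →
        (∀ t : ℝ, ∀ x ∈ region m ω E V,
          f t x = cexp (-(Real.pi * hb * E * x.1 ^ 2))
            * f1 t (x.2.2 - I * E * x.1, I * x.2.1 + E)) →
        Solves hb (redHam h2 hb m ω E) (region m ω E V) f →
        ∃ f2 : ℂ × ℂ → ℂ, AnalyticOver V f2 ∧
          ∀ t : ℝ, ∀ x ∈ region m ω E V, f t x = geomSol h2 hb m ω E f2 t x)) ∧
    -- the heat equation is solved by the Gaussian integral of the initial datum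
    (∀ (R : ℝ) (f2 : ℂ × ℂ → ℂ), 0 < R → AnalyticOver (Metric.ball 0 R) f2 →
      HeatLike hb m ω (Metric.ball 0 R) f2 →
      ∀ z u : ℂ, ‖u + R / 2‖ < R / 2 →
        Integrable (gaussIntegrand hb m ω (fun ξ : ℝ => f2 (ξ, 0)) z u) ∧
        f2 (z, u) = gaussIntegral hb m ω (fun ξ : ℝ => f2 (ξ, 0)) z u) ∧
    (∀ (R δ : ℝ) (g : ℝ → ℂ) (f2 : ℂ × ℂ → ℂ), 0 < δ → δ ≤ R → Continuous g →
      AnalyticOver (Metric.ball 0 R) f2 →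
      (∀ z u : ℝ, -δ < u → u < 0 →
        Integrable (gaussIntegrand hb m ω g z u) ∧ f2 (z, u) = gaussIntegral hb m ω g z u) →
      HeatLike hb m ω (Metric.ball 0 R) f2 ∧ (∀ ξ : ℝ, f2 (ξ, 0) = g ξ) ∧
      Solves hb (ham hb m ω) (region m ω E (Metric.ball 0 R)) (geomSol h2 hb m ω E f2)) ∧
    -- the general solution on the image space: every initial datum, every solution
    (∀ k0 : Lp ℂ 2 (volume : Measure ℝ), ∃ f2 : ℂ × ℂ → ℂ,
      AnalyticOver (Metric.ball 0 1) f2 ∧ HeatLike hb m ω (Metric.ball 0 1) f2 ∧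
      (∀ x : Pt, geomSol h2 hb m ω E f2 0 x = cst h2 hb (gaussianVec hb E c) k0 x) ∧
      Solves hb (ham hb m ω) Set.univ (geomSol h2 hb m ω E f2)) ∧
    (∀ k : ℝ → Lp ℂ 2 (volume : Measure ℝ), Continuous k →
      (Solves hb (ham hb m ω) Set.univ (fun t => cst h2 hb (gaussianVec hb E c) (k t)) ↔
        ∃ f2 : ℂ × ℂ → ℂ,
          AnalyticOver (Metric.ball 0 1) f2 ∧ HeatLike hb m ω (Metric.ball 0 1) f2 ∧
          ∀ (t : ℝ) (x : Pt), cst h2 hb (gaussianVec hb E c) (k t) x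
            = geomSol h2 hb m ω E f2 t x)) := by
  have hmω : 0 < m * ω := mul_pos hm hω
  refine ⟨fun F hF => imageSpace_properties hhb hE hF,
    fun f hf x => redHam_eq hm.ne' hf.contDiffAt,
    fun f hf Ω => solves_ham_iff_solves_redHam hhb hm hE hf Ω,
    fun V hV hne => ⟨fun f2 hf => ⟨contDiffOn_geomSol hmω hE hf hV.rotate,
      fun t _ hx => opC_geomSol hmω hE hf hV.rotate t hx, solves_redHam_geomSol hm hω hE hf hV.rotate, ?_, ?_⟩, ?_⟩,
    ?_, ?_, fun k => exists_geomSol_initial hhb hm hω hE k,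
    fun k hk => solves_ham_cst_iff hhb hm hω hE hk⟩
  · exact ⟨fun h => heatLike_of_opS hhb hm hω hE hV hne hf fun x hx _ => h 0 x hx,
      fun h t x hx => opS_geomSol_eq_zero hhb hm hω hE hf hV.rotate h t hx⟩
  · exact ⟨fun h => heatLike_of_solves_ham hhb hm hω hE hV hne hf h,
      fun h => solves_ham_geomSol hhb hm hω hE hV.isOpen hf hV.rotate h⟩
  · exact fun f f1 hc ha hf hsol =>
      exists_eq_geomSol hhb hm hω hE hV (F := f1) hc ha hf hsol
  · exact fun R f2 hR hf h z u hu => heatLike_gaussIntegral hhb hm hω hR hf h z hu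
  · exact fun R δ g f2 hδ hδR hg hf h =>
      solves_ham_of_gaussIntegral hhb hm hω hE hδ hδR hg hf h
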